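/- **Setting.** Let $X$ be a CAT(0) cube complex with its path metric $d$ (a complex of unit Euclidean cubes whose length metric is CAT(0)), and let $G$ be a group acting on $X$ properly and cocompactly by automorphisms of the cube complex. Suppose that $X$ is $\delta$-hyperbolic (each side of a geodesic triangle lies in the $\delta$-neighbourhood of the other two sides); this holds for some $\delta$ exactly when $G$ is hyperbolic. For subsets put $d(A,B)=\inf\{d(a,b): a\in A,\,b\in B\}$. A *wall* of $X$ is a connected component of the complex of midcubes of $X$, regarded as a subset of $X$; an edge $e$ is *dual* to the unique wall $W(e)$ that it meets; a *half-space* is the closure of a component of $X\setminus W$ for a wall $W$. Let $R>1$ be such that $G\cdot B=X$ for every ball $B$ of radius $R$ and $R\ge\delta+2\sqrt{\dim X}$. Let $\phi:G\to\mathcal G$ be a surjective homomorphism with kernel $K$, let $W_1,\dots,W_m$ be representatives of the $G$-orbits of walls of $X$, and let $H_i$ be normal subgroups of finite index in the stabilisers $G_{W_i}$, such that each $\phi(H_i)$ is finite, $\phi(g)\notin\phi(H_i)$ whenever $g\in G\setminus H_i$ and $d(gW_i,W_i)\le 2R$, and $K$ is torsion-free. Let $\mathcal X=X/K$ with the quotient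 metric, and write $\overline W$ for the image in $\mathcal X$ of a wall $W$ of $X$; the walls of $\mathcal X$ are these images. Let $\Gamma$ be the graph whose vertices are the walls of $\mathcal X$, two distinct walls being adjacent if their distance is at most $R$; let $k$ be a bound for the vertex degrees of $\Gamma$, and let $C_{k+1}(\Gamma)$ be the set of proper colourings of $\Gamma$ with colours $1,\dots,k+1$. For $c\in C_{k+1}(\Gamma)$ and an edge $e$ of $X$ put $c(e)=c(\overline{W(e)})$, and let $[c]_e$ be the set of those $c'\in C_{k+1}(\Gamma)$ that agree with $c$ on the ball of radius $c(e)$ in $\Gamma$ centred at $\overline{W(e)}$. Let $j\ge 0$ be an integer, and let $(Z,H,(c_x))$ be a triple in which $Z\subset X$ is a non-empty intersection of half-spaces, $H\le G$ is a subgroup that preserves $Z$ and acts on it freely and cocompactly, and $c_x\in C_{k+1}(\Gamma)$ is given for each vertex $x$ of $X$ in $Z$, with $c_{hx}=hc_x:=c_x\circ h^{-1}$ for $h\in H$, such that 1. if an edge $e$ joins vertices $x,y\in Z$, then $[c_x]_e=[c_y]_e$; 2. if an edge $e$ joins vertices $x,y$ with $x\in Z$, then $y\in Z$ if and only if $c_x(e)>j$.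 A *$j$-boundary wall* of $Z$ is a wall $W$ to which some edge $e$ is dual that joins a vertex $x\in Z$ to a vertex $y\notin Z$ and has $c_x(e)=j$. A *portal* leading to $Z$ is a set $P=Z\cap W$ with $W$ a $j$-boundary wall of $Z$. **Lemma 8.5.** If $P_0\ne P_1$ are distinct portals leading to $Z$, then their setwise stabilisers in $H$ intersect trivially: $H_{P_0}\cap H_{P_1}=\{1\}$. -/

import Mathlib

open scoped Pointwise

/-- The distance between two subsets with respect to a distance function `d`. -/
noncomputable def setDist {Y : Type*} (d : Y → Y → ℝ) (A B : Set Y) : ℝ :=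
  sInf (Set.image2 d A B)

theorem setDist_comm {Y : Type*} {d : Y → Y → ℝ} (hd : ∀ x y, d x y = d y x) (A B : Set Y) :
    setDist d A B = setDist d B A := by
  unfold setDist
  rw [Set.image2_swap]
  simp only [hd]

/-! ### CAT(0) and hyperbolic metric spaces -/

/-- The union of all geodesic segments from `x` to `y` (in a geodesic space). -/
def geodSeg {X : Type*} [MetricSpace X] (x y : X) : Set X :=
  {p | dist x p + dist p y = dist x y}

/-- A geodesic space: any two points are joined by an isometrically embedded interval. -/
def IsGeodesicSpace (X : Type*) [MetricSpace X] : Prop :=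
  ∀ x y : X, ∃ γ : ℝ → X, γ 0 = x ∧ γ (dist x y) = y ∧
    ∀ s ∈ Set.Icc 0 (dist x y), ∀ t ∈ Set.Icc 0 (dist x y), dist (γ s) (γ t) = |s - t|

/-- A CAT(0) space: a geodesic space in which, for every geodesic triangle `x y z`, points `p`, `q`
on two of its sides are at most as far apart as the comparison points `p'`, `q'` in a comparison
triangle `x' y' z'` in the Euclidean plane. -/
def IsCAT0 (X : Type*) [MetricSpace X] : Prop :=
  IsGeodesicSpace X ∧
  ∀ (x y z p q : X) (x' y' z' p' q' : EuclideanSpace ℝ (Fin 2)),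
    dist x' y' = dist x y → dist y' z' = dist y z → dist x' z' = dist x z →
    p ∈ geodSeg x y → q ∈ geodSeg x z →
    dist x' p' = dist x p → dist p' y' = dist p y →
    dist x' q' = dist x q → dist q' z' = dist q z →
    dist p q ≤ dist p' q'

/-- `δ`-hyperbolicity: every side of a geodesic triangle lies in the `δ`-neighbourhood of the
union of the other two sides. -/
def IsDeltaHyperbolic (X : Type*) [MetricSpace X] (δ : ℝ) : Prop :=
  ∀ x y z : X, ∀ p ∈ geodSeg x y, ∃ q ∈ geodSeg x z ∪ geodSeg y z, dist p q ≤ δ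

/-! ### Cube complexes -/

/-- The unit cube `[0,1]ⁿ`. -/
def unitCube (n : ℕ) : Set (EuclideanSpace ℝ (Fin n)) :=
  {v | ∀ i, v i ∈ Set.Icc (0 : ℝ) 1}

/-- The face of `[0,1]ⁿ` on which the coordinate `i` is fixed to be `0` (resp. `1`) whenever
`σ i = some false` (resp. `σ i = some true`), and is free when `σ i = none`. -/
def cubeFace {n : ℕ} (σ : Fin n → Option Bool) : Set (EuclideanSpace ℝ (Fin n)) :=
  {v | v ∈ unitCube n ∧ ∀ i b, σ i = some b → v i = if b then 1 else 0}

/-- `StringLength dim chart x y ℓ`: there is a chain of points from `x` to `y`, consecutive ones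
lying in a common cube, the sum of whose Euclidean distances measured in these cubes is `ℓ`. -/
inductive StringLength {X Cube : Type*} (dim : Cube → ℕ)
    (chart : (C : Cube) → EuclideanSpace ℝ (Fin (dim C)) → X) : X → X → ℝ → Prop
  | refl (x : X) : StringLength dim chart x x 0
  | step (C : Cube) (v w : EuclideanSpace ℝ (Fin (dim C))) (y : X) (ℓ : ℝ)
      (hv : v ∈ unitCube (dim C)) (hw : w ∈ unitCube (dim C))
      (h : StringLength dim chart (chart C w) y ℓ) :
      StringLength dim chart (chart C v) y (dist v w + ℓ)

/-- The structure of a cube complex on a metric space `X`: unit Euclidean cubes glued along faces by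
isometries, with the induced length metric. Only the restriction of `chart C` to the unit cube
is meaningful. -/
structure CubeComplex (X : Type*) [MetricSpace X] where
  Cube : Type*
  dim : Cube → ℕ
  chart : (C : Cube) → EuclideanSpace ℝ (Fin (dim C)) → X
  injOn : ∀ C, Set.InjOn (chart C) (unitCube (dim C))
  cover : ∀ x, ∃ C, x ∈ chart C '' unitCube (dim C)
  /-- every face of a cube is a cube -/
  face_mem : ∀ C (σ : Fin (dim C) → Option Bool),
    ∃ D, chart D '' unitCube (dim D) = chart C '' cubeFace σ
  /-- two cubes that meet are glued along an isometry between a face of one and a face of the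
  other -/
  glue : ∀ C D, (chart C '' unitCube (dim C) ∩ chart D '' unitCube (dim D)).Nonempty →
    ∃ (σ : Fin (dim C) → Option Bool) (τ : Fin (dim D) → Option Bool)
      (f : cubeFace σ ≃ᵢ cubeFace τ),
      ∀ v ∈ unitCube (dim C), ∀ w ∈ unitCube (dim D),
        chart C v = chart D w ↔ ∃ hv : v ∈ cubeFace σ, (f ⟨v, hv⟩ : EuclideanSpace ℝ _) = w
  /-- the metric is the length metric -/
  dist_isGLB : ∀ x y, IsGLB {ℓ | StringLength dim chart x y ℓ} (dist x y)

namespace CubeComplex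

variable {X : Type*} [MetricSpace X] (S : CubeComplex X)

/-- The closed cube `C`, as a subset of `X`. -/
def cell (C : S.Cube) : Set X := S.chart C '' unitCube (S.dim C)

/-- The vertices of `X`. -/
def IsVertex (x : X) : Prop := ∃ C, S.dim C = 0 ∧ x ∈ S.cell C

/-- `E` is an edge of `X`, and it joins the vertices `x` and `y`. -/
def Joins (E : S.Cube) (x y : X) : Prop :=
  S.dim E = 1 ∧ S.IsVertex x ∧ S.IsVertex y ∧ x ≠ y ∧ x ∈ S.cell E ∧ y ∈ S.cell E

/-- The midcube of the cube `m.1` on which the coordinate `m.2` is `1/2`. -/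
def midcube (m : Σ C : S.Cube, Fin (S.dim C)) : Set X :=
  S.chart m.1 '' {v | v ∈ unitCube (S.dim m.1) ∧ v m.2 = 1 / 2}

/-- Two midcubes lie in the same component of the wall complex: the equivalence relation
generated by one midcube being a face of the other. -/
def SameWall : (Σ C : S.Cube, Fin (S.dim C)) → (Σ C : S.Cube, Fin (S.dim C)) → Prop :=
  Relation.EqvGen fun m m' => S.midcube m ⊆ S.midcube m'

/-- The walls of `X`, as subsets of `X`. -/
def IsWall (W : Set X) : Prop :=
  ∃ m, W = ⋃ m' ∈ {m' | S.SameWall m m'}, S.midcube m'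

/-- The type of walls of `X`. -/
def Wall : Type _ := {W : Set X // S.IsWall W}

/-- The edge `E` is dual to the wall `W`, i.e. `W = W(E)`. -/
def Dual (E : S.Cube) (W : S.Wall) : Prop := S.dim E = 1 ∧ (S.cell E ∩ W.1).Nonempty

/-- The half-spaces of `X`: closures of the components of complements of walls. -/
def IsHalfSpace (A : Set X) : Prop :=
  ∃ W : S.Wall, ∃ x ∈ W.1ᶜ, A = closure (connectedComponentIn W.1ᶜ x)

/-- A group acts on `X` by automorphisms of the cube complex. -/
def IsCubicalAction (G : Type*) [Group G] [MulAction G X] : Prop :=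
  ∀ (g : G) (C : S.Cube), ∃ (D : S.Cube) (f : unitCube (S.dim C) ≃ᵢ unitCube (S.dim D)),
    ∀ v : unitCube (S.dim C), g • S.chart C v = S.chart D (f v)

end CubeComplex

/-- A proper action: every point has a ball that meets only finitely many of its translates. -/
def IsProperAction (G X : Type*) [Group G] [MetricSpace X] [MulAction G X] : Prop :=
  ∀ x : X, ∃ r > 0, {g : G | (g • Metric.ball x r ∩ Metric.ball x r).Nonempty}.Finite

/-- The subgroup `H` preserves `Z` and acts on it cocompactly. -/
def ActsCocompactlyOn {G X : Type*} [Group G] [MetricSpace X] [MulAction G X]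
    (H : Subgroup G) (Z : Set X) : Prop :=
  (∀ h ∈ H, h • Z = Z) ∧ ∃ B ⊆ Z, IsCompact B ∧ ∀ z ∈ Z, ∃ h ∈ H, h • z ∈ B

/-! ### The quotient by a normal subgroup and its graph of walls -/

section Quotient

variable {G X : Type*} [Group G] [MetricSpace X] [MulAction G X]

/-- The quotient space `X / K`. -/
abbrev QuotSpace (K : Subgroup G) (X : Type*) [MetricSpace X] [MulAction G X] : Type _ :=
  MulAction.orbitRel.Quotient K X

/-- The quotient map `X → X / K`. -/
def quotMap (K : Subgroup G) (x : X) : QuotSpace K X := Quotient.mk _ x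

/-- The quotient metric on `X / K`. -/
noncomputable def quotDist (K : Subgroup G) (a b : QuotSpace K X) : ℝ :=
  setDist dist {x : X | quotMap K x = a} {y : X | quotMap K y = b}

theorem quotDist_comm (K : Subgroup G) (a b : QuotSpace K X) :
    quotDist K a b = quotDist K b a :=
  setDist_comm dist_comm _ _

/-- The walls of `X / K`: the images of the walls of `X`. -/
def QuotWall (S : CubeComplex X) (K : Subgroup G) : Type _ :=
  {A : Set (QuotSpace K X) // ∃ W : S.Wall, A = quotMap K '' W.1}

/-- The image in `X / K` of a wall of `X`. -/
def CubeComplex.Wall.bar {S : CubeComplex X} (W : S.Wall) (K : Subgroup G) : QuotWall S K :=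
  ⟨quotMap K '' W.1, W, rfl⟩

/-- The graph `Γ`: its vertices are the walls of `X / K`, and two distinct walls are adjacent if they
are at distance at most `R`. -/
def wallGraph (S : CubeComplex X) (K : Subgroup G) (R : ℝ) : SimpleGraph (QuotWall S K) where
  Adj A B := A ≠ B ∧ setDist (quotDist K) A.1 B.1 ≤ R
  symm := ⟨fun A B h => ⟨h.1.symm, (setDist_comm (quotDist_comm K) B.1 A.1).trans_le h.2⟩⟩
  loopless := ⟨fun _ h => h.1 rfl⟩

end Quotient

/-- The proper colourings of a graph with colours `1, …, n`. -/
def colourings {V : Type*} (Γ : SimpleGraph V) (n : ℕ) : Set (V → ℕ) :=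
  {c | (∀ v, c v ∈ Set.Icc 1 n) ∧ ∀ u v, Γ.Adj u v → c u ≠ c v}

/-- The class of colourings that agree with `c` on the ball of radius `c v` centred at `v`. -/
def colourClass {V : Type*} (Γ : SimpleGraph V) (n : ℕ) (v : V) (c : V → ℕ) : Set (V → ℕ) :=
  {c' | c' ∈ colourings Γ n ∧ ∀ u, Γ.edist v u ≤ (c v : ℕ∞) → c' u = c u}

/-- The requirements on the homomorphism `φ : G → 𝒢` whose kernel `K` defines the quotient `X / K`:
for representatives `W i` of the `G`-orbits of walls there are normal finite index subgroups `N i`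
of the stabilisers of the `W i` such that the `φ (N i)` are finite, `φ` separates from
`φ (N i)` all `g ∉ N i` moving `W i` by at most `2R`, and the kernel is torsion-free. -/
structure HasFiniteWallKernel {G 𝒢 X : Type*} [Group G] [Group 𝒢] [MetricSpace X] [MulAction G X]
    (S : CubeComplex X) (R : ℝ) (φ : G →* 𝒢) {m : ℕ} (W : Fin m → S.Wall)
    (N : Fin m → Subgroup G) : Prop where
  surjective : Function.Surjective φ
  representatives : ∀ V : S.Wall, ∃! i, ∃ g : G, g • (W i).1 = V.1
  le_stabilizer : ∀ i, N i ≤ MulAction.stabilizer G (W i).1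
  normal : ∀ i, ((N i).subgroupOf (MulAction.stabilizer G (W i).1)).Normal
  finiteIndex : ∀ i, ((N i).subgroupOf (MulAction.stabilizer G (W i).1)).FiniteIndex
  finite_image : ∀ i, (φ '' (N i : Set G)).Finite
  separates : ∀ i, ∀ g ∉ N i, setDist dist (g • (W i).1) (W i).1 ≤ 2 * R → φ g ∉ (N i).map φ
  torsionFree : ∀ g ∈ φ.ker, IsOfFinOrder g → g = 1

/-- The conditions on a single triple `(Z, H, (c_x))` in the `j`-th stage of the construction.
Only the values of `c` at vertices of `X` that lie in `Z` are meaningful. -/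
structure IsStageTriple {G X : Type*} [Group G] [MetricSpace X] [MulAction G X]
    (S : CubeComplex X) (K : Subgroup G) (R : ℝ) (k j : ℕ)
    (Z : Set X) (H : Subgroup G) (c : X → QuotWall S K → ℕ) : Prop where
  nonempty : Z.Nonempty
  halfSpaces : ∃ 𝒜 : Set (Set X), (∀ A ∈ 𝒜, S.IsHalfSpace A) ∧ Z = ⋂₀ 𝒜
  cocompact : ActsCocompactlyOn H Z
  free : ∀ h ∈ H, ∀ z ∈ Z, h • z = z → h = 1
  colouring : ∀ x ∈ Z, S.IsVertex x → c x ∈ colourings (wallGraph S K R) (k + 1)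
  /-- `c_{hx} = h c_x`, where `(h c)(hW) = c(W)` -/
  equivariant : ∀ x ∈ Z, S.IsVertex x → ∀ h ∈ H, ∀ W W' : S.Wall, W'.1 = h • W.1 →
    c (h • x) (W'.bar K) = c x (W.bar K)
  /-- adjacent vertices of `Z` induce the same class of colourings at the edge joining them -/
  compatible : ∀ (E : S.Cube) (x y : X) (W : S.Wall), S.Joins E x y → S.Dual E W →
    x ∈ Z → y ∈ Z →
    colourClass (wallGraph S K R) (k + 1) (W.bar K) (c x) =
      colourClass (wallGraph S K R) (k + 1) (W.bar K) (c y)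
  /-- an edge at a vertex of `Z` stays in `Z` exactly when its wall has colour `> j` -/
  interior : ∀ (E : S.Cube) (x y : X) (W : S.Wall), S.Joins E x y → S.Dual E W →
    x ∈ Z → (y ∈ Z ↔ j < c x (W.bar K))

/-- `W` is a `j`-boundary wall of `Z`: some edge dual to `W` crosses out of `Z`, and `W` has
colour `j` there. -/
def IsBoundaryWall {G X : Type*} [Group G] [MetricSpace X] [MulAction G X]
    (S : CubeComplex X) (K : Subgroup G) (j : ℕ)
    (Z : Set X) (c : X → QuotWall S K → ℕ) (W : S.Wall) : Prop :=
  ∃ (E : S.Cube) (x y : X), S.Joins E x y ∧ S.Dual E W ∧ x ∈ Z ∧ y ∉ Z ∧ c x (W.bar K) = j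

/-- `P` is a portal leading to `Z`: the intersection of `Z` with a `j`-boundary wall. -/
def IsPortal {G X : Type*} [Group G] [MetricSpace X] [MulAction G X]
    (S : CubeComplex X) (K : Subgroup G) (j : ℕ)
    (Z : Set X) (c : X → QuotWall S K → ℕ) (P : Set X) : Prop :=
  ∃ W : S.Wall, IsBoundaryWall S K j Z c W ∧ P = Z ∩ W.1

/-! Suppose `h ≠ 1` in `H` stabilises two portals `Z ∩ W₀` and `Z ∩ W₁`. As `X` is complete (the
action of `G` is proper and cocompact) and `Z` is closed and convex, a bounded orbit of `h` in `Z`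
would give a fixed point in `Z`, namely a circumcentre; freeness excludes this, so `h` has unbounded
orbits. Both portals are non-empty, convex and invariant under `h`. A long geodesic in one portal,
from a point to its translate by a power of `h`, fellow-travels one in the other, and near the
midpoints hyperbolicity brings the portals within `δ + ε` of each other for every `ε > 0`
(`IsCAT0.exists_dist_le_of_unbounded`). Since `X` has an edge, `δ + 2 ≤ R`, so the portals contain
points `p₀`, `p₁` with `dist p₀ p₁ + 1 / 2 ≤ R`.

Such portals coincide (`IsBoundaryWall.eq_of_dist_le`). When an edge in `Z` is crossed, the
colouring is unchanged on a ball of radius at least `1` in the graph of walls about the wall of the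
edge. Hence the colour of `W₀` is constant along the geodesic from `p₀` to `p₁`, which stays in `Z`
and close to `W₀` (`IsStageTriple.colour_eq_of_geodSeg`). So near `p₁` both walls have colour `j`.
If their images in `X / K` were distinct, they would be adjacent, contrary to properness of the
colouring. If the images agree, the walls differ by an element of `K`, and the separation property
of `φ` forces this element to stabilise the wall (`HasFiniteWallKernel.eq_of_bar_eq`).

The bulk of the work is the geometry of walls, derived from the gluing axioms and the CAT(0)
inequality alone: walls are closed, convex and cross a cube in at most one direction, and
half-spaces are convex. The tool is the fiber, a unit segment in a coordinate direction of a cube,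
whose midpoint lies on the wall. Fibers can be carried to nearby points (`exists_lift`), and any two
fibers of a wall bound, up to orientation, a finely subdivided flat strip (`Strip.extend`,
`InWall.exists_strip`). The midpoints of the fibers of a strip trace the geodesic between the
midpoints of its two ends. -/

/-! ### Coordinates in Euclidean cubes -/

section Coordinates

variable {n k : ℕ}

/-- The vector `v` with its coordinate `i` replaced by `a`. -/
noncomputable def setCoord (v : EuclideanSpace ℝ (Fin n)) (i : Fin n) (a : ℝ) :
    EuclideanSpace ℝ (Fin n) :=
  WithLp.toLp 2 (Function.update v.ofLp i a)

@[simp] theorem setCoord_same (v : EuclideanSpace ℝ (Fin n)) (i : Fin n) (a : ℝ) :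
    setCoord v i a i = a := by
  simp [setCoord]

theorem setCoord_ne (v : EuclideanSpace ℝ (Fin n)) {i l : Fin n} (h : l ≠ i) (a : ℝ) :
    setCoord v i a l = v l := by
  simp [setCoord, h]

@[simp] theorem setCoord_self (v : EuclideanSpace ℝ (Fin n)) (i : Fin n) :
    setCoord v i (v i) = v := by
  ext l; simp [setCoord]

@[simp] theorem setCoord_setCoord (v : EuclideanSpace ℝ (Fin n)) (i : Fin n) (a b : ℝ) :
    setCoord (setCoord v i a) i b = setCoord v i b := by
  ext l; simp [setCoord]

theorem setCoord_mem_unitCube {v : EuclideanSpace ℝ (Fin n)} (hv : v ∈ unitCube n) (i : Fin n)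
    {a : ℝ} (ha : a ∈ Set.Icc (0 : ℝ) 1) : setCoord v i a ∈ unitCube n := by
  intro l
  by_cases h : l = i
  · subst h; simpa using ha
  · rw [setCoord_ne v h]; exact hv l

theorem setCoord_mem_cubeFace {σ : Fin n → Option Bool} {v : EuclideanSpace ℝ (Fin n)}
    (hv : v ∈ cubeFace σ) {i : Fin n} (hi : σ i = none) {a : ℝ} (ha : a ∈ Set.Icc (0 : ℝ) 1) :
    setCoord v i a ∈ cubeFace σ := by
  refine ⟨setCoord_mem_unitCube hv.1 i ha, fun l b hl => ?_⟩
  have h : l ≠ i := by rintro rfl; simp [hi] at hl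
  rw [setCoord_ne v h]; exact hv.2 l b hl

theorem eq_none_of_mem_cubeFace {σ : Fin n → Option Bool} {v : EuclideanSpace ℝ (Fin n)}
    (hv : v ∈ cubeFace σ) {i : Fin n} (h0 : v i ≠ 0) (h1 : v i ≠ 1) : σ i = none := by
  rcases h : σ i with _ | b
  · rfl
  · have := hv.2 i b h
    cases b <;> simp_all

theorem cubeFace_none : cubeFace (fun _ : Fin n => (none : Option Bool)) = unitCube n := by
  ext v; simp [cubeFace]

theorem dist_sq_eq_sum (v w : EuclideanSpace ℝ (Fin n)) :
    dist v w ^ 2 = ∑ l, (v l - w l) ^ 2 := by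
  rw [EuclideanSpace.dist_sq_eq]
  simp [Real.dist_eq, sq_abs]

theorem dist_sq_eq_add_sum (v w : EuclideanSpace ℝ (Fin n)) (i : Fin n) :
    dist v w ^ 2 = (v i - w i) ^ 2 + ∑ l ∈ Finset.univ.erase i, (v l - w l) ^ 2 := by
  rw [dist_sq_eq_sum, Finset.add_sum_erase _ (fun l => (v l - w l) ^ 2) (Finset.mem_univ i)]

theorem sq_sub_le_dist_sq (v w : EuclideanSpace ℝ (Fin n)) (i : Fin n) :
    (v i - w i) ^ 2 ≤ dist v w ^ 2 := by
  rw [dist_sq_eq_add_sum v w i]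
  have := Finset.sum_nonneg (s := Finset.univ.erase i) (fun l _ => sq_nonneg (v l - w l))
  linarith

theorem abs_sub_le_dist (v w : EuclideanSpace ℝ (Fin n)) (i : Fin n) :
    |v i - w i| ≤ dist v w :=
  abs_le_of_sq_le_sq (sq_sub_le_dist_sq v w i) dist_nonneg

/-- Changing one coordinate of both vectors leaves the contribution of the others unchanged. -/
theorem dist_setCoord_sq (v w : EuclideanSpace ℝ (Fin n)) (i : Fin n) (a b : ℝ) :
    dist (setCoord v i a) (setCoord w i b) ^ 2
      = (a - b) ^ 2 + (dist v w ^ 2 - (v i - w i) ^ 2) := by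
  rw [dist_sq_eq_add_sum _ _ i, dist_sq_eq_add_sum v w i]
  simp only [setCoord_same]
  have : ∑ l ∈ Finset.univ.erase i, (setCoord v i a l - setCoord w i b l) ^ 2
      = ∑ l ∈ Finset.univ.erase i, (v l - w l) ^ 2 := by
    refine Finset.sum_congr rfl fun l hl => ?_
    have h := Finset.ne_of_mem_erase hl
    rw [setCoord_ne v h, setCoord_ne w h]
  rw [this]; ring

theorem dist_setCoord_right_sq (v w : EuclideanSpace ℝ (Fin n)) (i : Fin n) (b : ℝ) :
    dist v (setCoord w i b) ^ 2 = (v i - b) ^ 2 + (dist v w ^ 2 - (v i - w i) ^ 2) := by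
  have := dist_setCoord_sq v w i (v i) b
  rwa [setCoord_self] at this

theorem dist_setCoord_setCoord (v : EuclideanSpace ℝ (Fin n)) (i : Fin n) (a b : ℝ) :
    dist (setCoord v i a) (setCoord v i b) = |a - b| := by
  have := dist_setCoord_sq v v i a b
  simp only [dist_self, sub_self] at this
  rw [← abs_of_nonneg (dist_nonneg (x := setCoord v i a)), ← sq_eq_sq_iff_abs_eq_abs]
  linarith

theorem dist_setCoord_ne_sq (v : EuclideanSpace ℝ (Fin n)) {i l : Fin n} (h : i ≠ l) (a b : ℝ) :
    dist (setCoord v i a) (setCoord v l b) ^ 2 = (a - v i) ^ 2 + (v l - b) ^ 2 := by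
  rw [dist_setCoord_right_sq, setCoord_ne v h.symm]
  have := dist_setCoord_setCoord v i a (v i)
  rw [setCoord_self] at this
  rw [this, sq_abs]; ring

theorem convex_unitCube : Convex ℝ (unitCube n) := by
  intro v hv w hw a b ha hb hab i
  have := (convex_Icc (0 : ℝ) 1) (hv i) (hw i) ha hb hab
  simpa using this

/-- Reversing the unit interval if `o` holds. -/
def flipLevel (o : Bool) (a : ℝ) : ℝ := if o then 1 - a else a

@[simp] theorem flipLevel_true (a : ℝ) : flipLevel true a = 1 - a := rfl

@[simp] theorem flipLevel_false (a : ℝ) : flipLevel false a = a := rfl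

@[simp] theorem flipLevel_flipLevel (o : Bool) (a : ℝ) : flipLevel o (flipLevel o a) = a := by
  cases o <;> simp

@[simp] theorem flipLevel_half (o : Bool) : flipLevel o (1 / 2) = 1 / 2 := by
  cases o <;> norm_num

theorem flipLevel_sub_sq (o : Bool) (a b : ℝ) :
    (flipLevel o a - flipLevel o b) ^ 2 = (a - b) ^ 2 := by
  cases o <;> simp; ring

theorem flipLevel_mem_Icc {o : Bool} {a : ℝ} (ha : a ∈ Set.Icc (0 : ℝ) 1) :
    flipLevel o a ∈ Set.Icc (0 : ℝ) 1 := by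
  cases o <;> simp_all

theorem flipLevel_mem_Ioo {o : Bool} {a : ℝ} (ha : a ∈ Set.Ioo (0 : ℝ) 1) :
    flipLevel o a ∈ Set.Ioo (0 : ℝ) 1 := by
  cases o <;> simp_all

/-- A surjective isometry between faces of cubes maps corners to corners. -/
theorem corner_of_isometry {σ : Fin n → Option Bool} {τ : Fin k → Option Bool}
    {F : EuclideanSpace ℝ (Fin n) → EuclideanSpace ℝ (Fin k)}
    (hF : Set.MapsTo F (cubeFace σ) (cubeFace τ)) (hsurj : Set.SurjOn F (cubeFace σ) (cubeFace τ))
    (hd : ∀ v ∈ cubeFace σ, ∀ w ∈ cubeFace σ, dist (F v) (F w) = dist v w)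
    {u : EuclideanSpace ℝ (Fin n)} (hu : u ∈ cubeFace σ) (hc : ∀ l, u l = 0 ∨ u l = 1)
    (l : Fin k) : F u l = 0 ∨ F u l = 1 := by
  by_contra! hcon
  set c := F u l with hcdef
  have hFu := hF hu
  have hl : τ l = none := eq_none_of_mem_cubeFace hFu hcon.1 hcon.2
  have hc0 : 0 < c := lt_of_le_of_ne (hFu.1 l).1 hcon.1.symm
  have hc1 : c < 1 := lt_of_le_of_ne (hFu.1 l).2 hcon.2
  -- Moving the coordinate `l` of `F u` by `± r` stays in the face `τ`. Preimages of the two points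
  -- have `u` as their midpoint, but a corner of a cube is not the midpoint of two distinct points
  -- of the cube.
  obtain ⟨r, hr, hrc, hrc'⟩ : ∃ r > 0, r ≤ c ∧ r ≤ 1 - c :=
    ⟨min c (1 - c), lt_min hc0 (by linarith), min_le_left _ _, min_le_right _ _⟩
  obtain ⟨a, ha, hFa⟩ := hsurj (setCoord_mem_cubeFace hFu hl (a := c - r) ⟨by linarith, by linarith⟩)
  obtain ⟨b, hb, hFb⟩ := hsurj (setCoord_mem_cubeFace hFu hl (a := c + r) ⟨by linarith, by linarith⟩)
  have hab : dist a b = 2 * r := by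
    rw [← hd a ha b hb, hFa, hFb, dist_setCoord_setCoord, abs_of_neg (by linarith)]; ring
  have hau : dist a u = r := by
    rw [← hd a ha u hu, hFa]
    nth_rw 2 [← setCoord_self (F u) l]
    rw [dist_setCoord_setCoord, abs_of_neg (by linarith)]; ring
  have hub : dist u b = r := by
    rw [← hd u hu b hb, hFb]
    nth_rw 1 [← setCoord_self (F u) l]
    rw [dist_setCoord_setCoord, abs_of_neg (by linarith)]; ring
  have hmid : u = midpoint ℝ a b := eq_midpoint_of_dist_eq_half (by rw [hau, hab]; ring)
    (by rw [hub, hab]; ring)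
  have : a = b := by
    ext t
    have h1 : u t = (a t + b t) / 2 := by
      rw [hmid, midpoint_eq_smul_add]; simp; ring
    have h2 := ha.1 t
    have h3 := hb.1 t
    rcases hc t with h | h
    · linarith [h2.1, h3.1]
    · linarith [h2.2, h3.2]
  rw [this, dist_self] at hab
  linarith

/-- A surjective isometry between faces of cubes permutes the coordinate directions, up to
reversals. -/
theorem exists_coord_of_isometry {σ : Fin n → Option Bool} {τ : Fin k → Option Bool}
    {F : EuclideanSpace ℝ (Fin n) → EuclideanSpace ℝ (Fin k)}
    (hF : Set.MapsTo F (cubeFace σ) (cubeFace τ)) (hsurj : Set.SurjOn F (cubeFace σ) (cubeFace τ))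
    (hd : ∀ v ∈ cubeFace σ, ∀ w ∈ cubeFace σ, dist (F v) (F w) = dist v w)
    {i : Fin n} (hi : σ i = none) :
    ∃ (l : Fin k) (o : Bool), ∀ w ∈ cubeFace σ, ∀ a ∈ Set.Icc (0 : ℝ) 1,
      F (setCoord w i a) = setCoord (F w) l (flipLevel o a) := by
  classical
  -- a corner of the face with `i`-th coordinate `0`, and the adjacent one
  set u : EuclideanSpace ℝ (Fin n) :=
    WithLp.toLp 2 (fun l => if σ l = some true then (1 : ℝ) else 0) with hu
  have hul : ∀ l, u l = if σ l = some true then (1 : ℝ) else 0 := fun l => rfl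
  have hui : u i = 0 := by simp [hul, hi]
  have huσ : u ∈ cubeFace σ := by
    refine ⟨fun l => ?_, fun l b hl => ?_⟩
    · rw [hul]; split_ifs <;> simp
    · rw [hul, hl]; cases b <;> simp
  have huc : ∀ l, u l = 0 ∨ u l = 1 := fun l => by rw [hul]; split_ifs <;> simp
  have hu'σ : setCoord u i 1 ∈ cubeFace σ := setCoord_mem_cubeFace huσ hi (by simp)
  have hu'c : ∀ l, setCoord u i 1 l = 0 ∨ setCoord u i 1 l = 1 := fun l => by
    by_cases h : l = i
    · subst h; simp
    · rw [setCoord_ne u h]; exact huc l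
  have hFc := corner_of_isometry hF hsurj hd huσ huc
  have hFc' := corner_of_isometry hF hsurj hd hu'σ hu'c
  set U := F u
  set U' := F (setCoord u i 1)
  have hUU' : dist U U' = 1 := by
    rw [hd u huσ _ hu'σ]
    nth_rw 1 [← setCoord_self u i]
    rw [dist_setCoord_setCoord, hui]; simp
  obtain ⟨l, hl⟩ : ∃ l, U l ≠ U' l := by
    by_contra! h
    have : U = U' := by ext t; exact h t
    rw [this, dist_self] at hUU'; norm_num at hUU'
  have hl1 : (U l - U' l) ^ 2 = 1 := by
    rcases hFc l with h | h <;> rcases hFc' l with h' | h' <;> simp_all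
  have hrest : ∑ t ∈ Finset.univ.erase l, (U t - U' t) ^ 2 = 0 := by
    have := dist_sq_eq_add_sum U U' l
    rw [hUU', hl1] at this; linarith
  have hU' : U' = setCoord U l (U' l) := by
    ext t
    by_cases h : t = l
    · subst h; simp
    · rw [setCoord_ne U h]
      have := (Finset.sum_eq_zero_iff_of_nonneg (fun t _ => sq_nonneg (U t - U' t))).1 hrest t
        (by simp [h])
      have := pow_eq_zero_iff (n := 2) (by norm_num) |>.1 this
      linarith
  obtain ⟨o, ho, ho'⟩ : ∃ o, U l = flipLevel o 0 ∧ U' l = flipLevel o 1 := by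
    rcases hFc l with h | h <;> rcases hFc' l with h' | h'
    · exact absurd (h.trans h'.symm) hl
    · exact ⟨false, by simp [h], by simp [h']⟩
    · exact ⟨true, by simp [h], by simp [h']⟩
    · exact absurd (h.trans h'.symm) hl
  -- The difference of the squared distances from a point to two adjacent corners is affine in the
  -- coordinate in which they differ, and `F` preserves both distances.
  have hcoord : ∀ w ∈ cubeFace σ, F w l = flipLevel o (w i) := by
    intro w hw
    have e1 := dist_setCoord_right_sq w u i 1
    have e2 := dist_setCoord_right_sq (F w) U l (U' l)
    rw [← hU', hd w hw _ hu'σ, hd w hw u huσ] at e2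
    rw [e1, hui, ho, ho'] at e2
    cases o <;> simp at e2 ⊢ <;> linarith
  refine ⟨l, o, fun w hw a ha => ?_⟩
  have hw' : setCoord w i a ∈ cubeFace σ := setCoord_mem_cubeFace hw hi ha
  have h1 : F (setCoord w i a) l = flipLevel o a := by rw [hcoord _ hw', setCoord_same]
  -- The coordinate `l` already accounts for the whole displacement, so no other coordinate of the
  -- image moves.
  have h2 : dist (F (setCoord w i a)) (F w) ^ 2 = (a - w i) ^ 2 := by
    rw [hd _ hw' _ hw]
    nth_rw 2 [← setCoord_self w i]
    rw [dist_setCoord_setCoord, sq_abs]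
  have h3 := dist_sq_eq_add_sum (F (setCoord w i a)) (F w) l
  rw [h2, h1, hcoord w hw, flipLevel_sub_sq] at h3
  have h4 : ∑ t ∈ Finset.univ.erase l, (F (setCoord w i a) t - F w t) ^ 2 = 0 := by linarith
  ext t
  by_cases h : t = l
  · subst h; rw [h1, setCoord_same]
  · rw [setCoord_ne _ h]
    have := (Finset.sum_eq_zero_iff_of_nonneg
      (fun t _ => sq_nonneg (F (setCoord w i a) t - F w t))).1 h4 t (by simp [h])
    have := pow_eq_zero_iff (n := 2) (by norm_num) |>.1 this
    linarith

end Coordinates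

/-! ### Geodesics in CAT(0) spaces -/

section CAT0

theorem exists_comparison_triangle {a b c : ℝ} (ha : 0 ≤ a) (hb : 0 ≤ b)
    (hab : a ≤ b + c) (hba : b ≤ a + c) (hc : c ≤ a + b) :
    ∃ x y z : EuclideanSpace ℝ (Fin 2), dist x y = a ∧ dist y z = c ∧ dist x z = b := by
  have key : ∀ (x y : EuclideanSpace ℝ (Fin 2)) (r : ℝ), 0 ≤ r →
      (x 0 - y 0) ^ 2 + (x 1 - y 1) ^ 2 = r ^ 2 → dist x y = r := by
    intro x y r hr h
    have := dist_sq_eq_sum x y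
    rw [Fin.sum_univ_two, h] at this
    exact (pow_left_inj₀ dist_nonneg hr two_ne_zero).1 this
  have hc0 : 0 ≤ c := by linarith
  rcases eq_or_lt_of_le ha with h0 | h0
  · have hbc : b = c := by linarith
    refine ⟨!₂[0, 0], !₂[0, 0], !₂[b, 0], key _ _ _ ha ?_, key _ _ _ hc0 ?_, key _ _ _ hb ?_⟩ <;>
      simp [← h0, hbc]
  -- Law of cosines: `α` is the first coordinate of `z` when `x` is the origin and `y` lies on the
  -- first axis.
  · set α := (a ^ 2 + b ^ 2 - c ^ 2) / (2 * a) with hα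
    have hαa : 2 * a * α = a ^ 2 + b ^ 2 - c ^ 2 := by rw [hα]; field_simp
    have h1 : α ≤ b := by
      rw [hα, div_le_iff₀ (by linarith)]; nlinarith
    have h2 : -b ≤ α := by
      rw [hα, le_div_iff₀ (by linarith)]; nlinarith
    have h3 : 0 ≤ b ^ 2 - α ^ 2 := by nlinarith
    have h4 := Real.sq_sqrt h3
    refine ⟨!₂[0, 0], !₂[a, 0], !₂[α, √(b ^ 2 - α ^ 2)], key _ _ _ ha ?_, key _ _ _ hc0 ?_,
      key _ _ _ hb ?_⟩ <;> simp <;> nlinarith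

variable {X : Type*} [MetricSpace X]

/-- `m` is the point on a geodesic from `x` to `y` at the fraction `t` of the distance. -/
def IsGeodPoint (t : ℝ) (x y m : X) : Prop :=
  dist x m = t * dist x y ∧ dist m y = (1 - t) * dist x y

theorem IsGeodPoint.symm {t : ℝ} {x y m : X} (h : IsGeodPoint t x y m) :
    IsGeodPoint (1 - t) y x m := by
  refine ⟨?_, ?_⟩
  · rw [dist_comm y m, h.2, dist_comm y x]
  · rw [dist_comm m x, h.1, dist_comm y x]; ring

theorem IsGeodPoint.mem_geodSeg {t : ℝ} {x y m : X} (h : IsGeodPoint t x y m) :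
    m ∈ geodSeg x y := by
  simp only [geodSeg, Set.mem_ofPred_eq, h.1, h.2]; ring

theorem exists_isGeodPoint_of_mem_geodSeg {x y m : X} (h : m ∈ geodSeg x y) :
    ∃ t ∈ Set.Icc (0 : ℝ) 1, IsGeodPoint t x y m := by
  have h' : dist x m + dist m y = dist x y := h
  rcases eq_or_lt_of_le (dist_nonneg (x := x) (y := y)) with h0 | h0
  · refine ⟨0, by simp, ?_, ?_⟩ <;>
      nlinarith [dist_nonneg (x := x) (y := m), dist_nonneg (x := m) (y := y)]
  · refine ⟨dist x m / dist x y, ⟨by positivity, ?_⟩, ?_, ?_⟩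
    · rw [div_le_one h0]; linarith [dist_nonneg (x := m) (y := y)]
    · field_simp
    · field_simp; linarith

theorem geodSeg_comm (x y : X) : geodSeg x y = geodSeg y x := by
  ext m
  simp only [geodSeg, Set.mem_ofPred_eq]
  rw [dist_comm y m, dist_comm m x, dist_comm y x, add_comm]

theorem left_mem_geodSeg (x y : X) : x ∈ geodSeg x y := by simp [geodSeg]

theorem right_mem_geodSeg (x y : X) : y ∈ geodSeg x y := by simp [geodSeg]

/-- Geodesics parametrized proportionally to arc length on `[0,1]`. -/
theorem IsGeodesicSpace.exists_path (hX : IsGeodesicSpace X) (x y : X) :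
    ∃ γ : ℝ → X, γ 0 = x ∧ γ 1 = y ∧ ∀ s ∈ Set.Icc (0 : ℝ) 1, ∀ t ∈ Set.Icc (0 : ℝ) 1,
      dist (γ s) (γ t) = |s - t| * dist x y := by
  obtain ⟨γ, h0, h1, h⟩ := hX x y
  have hmem : ∀ s ∈ Set.Icc (0 : ℝ) 1, s * dist x y ∈ Set.Icc 0 (dist x y) := fun s hs =>
    ⟨mul_nonneg hs.1 dist_nonneg, mul_le_of_le_one_left dist_nonneg hs.2⟩
  refine ⟨fun t => γ (t * dist x y), by simpa using h0, by simpa using h1, fun s hs t ht => ?_⟩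
  rw [h _ (hmem s hs) _ (hmem t ht), ← sub_mul, abs_mul, abs_of_nonneg (dist_nonneg (x := x))]

theorem isGeodPoint_of_path {x y : X} {γ : ℝ → X} (h0 : γ 0 = x) (h1 : γ 1 = y)
    (h : ∀ s ∈ Set.Icc (0 : ℝ) 1, ∀ t ∈ Set.Icc (0 : ℝ) 1, dist (γ s) (γ t) = |s - t| * dist x y)
    {t : ℝ} (ht : t ∈ Set.Icc (0 : ℝ) 1) : IsGeodPoint t x y (γ t) := by
  constructor
  · rw [← h0, h 0 (by simp) t ht, h0, zero_sub, abs_neg, abs_of_nonneg ht.1]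
  · rw [← h1, h t ht 1 (by simp), h1, abs_sub_comm, abs_of_nonneg (by linarith [ht.2])]

theorem IsGeodesicSpace.exists_isGeodPoint (hX : IsGeodesicSpace X) (x y : X) {t : ℝ}
    (ht : t ∈ Set.Icc (0 : ℝ) 1) : ∃ m, IsGeodPoint t x y m := by
  obtain ⟨γ, h0, h1, h⟩ := hX.exists_path x y
  exact ⟨γ t, isGeodPoint_of_path h0 h1 h ht⟩

/-- Points at the same fraction of two sides of a triangle issuing from a common vertex. -/
theorem IsCAT0.dist_le_of_common_left (hX : IsCAT0 X) {t : ℝ} (ht : t ∈ Set.Icc (0 : ℝ) 1)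
    {x y z p q : X} (hp : IsGeodPoint t x y p) (hq : IsGeodPoint t x z q) :
    dist p q ≤ t * dist y z := by
  obtain ⟨x', y', z', h1, h2, h3⟩ := exists_comparison_triangle (dist_nonneg (x := x) (y := y))
    (dist_nonneg (x := x) (y := z)) (c := dist y z)
    (by linarith [dist_triangle x z y, dist_comm z y]) (dist_triangle x y z)
    (by linarith [dist_triangle y x z, dist_comm x y])
  have key := hX.2 x y z p q x' y' z' (AffineMap.lineMap x' y' t) (AffineMap.lineMap x' z' t)
    h1 h2 h3 hp.mem_geodSeg hq.mem_geodSeg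
    (by rw [dist_left_lineMap, h1, hp.1, Real.norm_of_nonneg ht.1])
    (by rw [dist_lineMap_right, h1, hp.2, Real.norm_of_nonneg (by linarith [ht.2])])
    (by rw [dist_left_lineMap, h3, hq.1, Real.norm_of_nonneg ht.1])
    (by rw [dist_lineMap_right, h3, hq.2, Real.norm_of_nonneg (by linarith [ht.2])])
  refine key.trans (le_of_eq ?_)
  rw [← h2, dist_eq_norm, dist_eq_norm y' z', ← Real.norm_of_nonneg ht.1, ← norm_smul,
    Real.norm_of_nonneg ht.1]
  congr 1
  simp only [AffineMap.lineMap_apply, vsub_eq_sub, vadd_eq_add]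
  module

/-- Convexity of the metric: the quadrilateral is cut along the diagonal from `x` to `y'`, and each
triangle contributes one summand. -/
theorem IsCAT0.dist_isGeodPoint_le (hX : IsCAT0 X) {t : ℝ} (ht : t ∈ Set.Icc (0 : ℝ) 1)
    {x y x' y' p p' : X} (hp : IsGeodPoint t x y p) (hp' : IsGeodPoint t x' y' p') :
    dist p p' ≤ (1 - t) * dist x x' + t * dist y y' := by
  obtain ⟨q, hq⟩ := hX.1.exists_isGeodPoint x y' ht
  have h1 := hX.dist_le_of_common_left ht hp hq
  have h2 := hX.dist_le_of_common_left (t := 1 - t) ⟨by linarith [ht.2], by linarith [ht.1]⟩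
    hq.symm hp'.symm
  linarith [dist_triangle p q p']

theorem IsCAT0.isGeodPoint_unique (hX : IsCAT0 X) {t : ℝ} (ht : t ∈ Set.Icc (0 : ℝ) 1)
    {x y p q : X} (hp : IsGeodPoint t x y p) (hq : IsGeodPoint t x y q) : p = q := by
  have := hX.dist_le_of_common_left ht hp hq
  rw [dist_self, mul_zero] at this
  exact dist_le_zero.1 this

/-- The distance from a point to a point of a geodesic is at most the Euclidean one. -/
theorem IsCAT0.dist_sq_le (hX : IsCAT0 X) {t : ℝ} (ht : t ∈ Set.Icc (0 : ℝ) 1)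
    {x y p : X} (hp : IsGeodPoint t x y p) (z : X) :
    dist p z ^ 2 ≤ (1 - t) * dist x z ^ 2 + t * dist y z ^ 2 - t * (1 - t) * dist x y ^ 2 := by
  obtain ⟨x', y', z', h1, h2, h3⟩ := exists_comparison_triangle (dist_nonneg (x := x) (y := y))
    (dist_nonneg (x := x) (y := z)) (c := dist y z)
    (by linarith [dist_triangle x z y, dist_comm z y]) (dist_triangle x y z)
    (by linarith [dist_triangle y x z, dist_comm x y])
  have key := hX.2 x y z p z x' y' z' (AffineMap.lineMap x' y' t) z'
    h1 h2 h3 hp.mem_geodSeg (right_mem_geodSeg x z)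
    (by rw [dist_left_lineMap, h1, hp.1, Real.norm_of_nonneg ht.1])
    (by rw [dist_lineMap_right, h1, hp.2, Real.norm_of_nonneg (by linarith [ht.2])])
    h3 (by simp)
  have : dist p z ^ 2 ≤ dist (AffineMap.lineMap x' y' t) z' ^ 2 :=
    pow_le_pow_left₀ dist_nonneg key 2
  refine this.trans (le_of_eq ?_)
  rw [← h1, ← h2, ← h3]
  simp only [dist_sq_eq_sum, Fin.sum_univ_two, AffineMap.lineMap_apply, vsub_eq_sub, vadd_eq_add,
    PiLp.add_apply, PiLp.smul_apply, PiLp.sub_apply, smul_eq_mul]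
  ring

/-- If `m` lies on a geodesic from `a`, and `y`, `m`, `z` lie on a short geodesic overlapping with
it, then the concatenation is a geodesic. -/
theorem IsCAT0.dist_eq_add_of_overlap (hX : IsCAT0 X) {a y m z : X} {A η : ℝ} (hη : 0 < η)
    (hA : η ≤ A) (ham : dist a m = A) (hay : dist a y = A - η) (hym : dist y m = η)
    (hmz : dist m z = η) (hyz : dist y z = 2 * η) : dist a z = A + η := by
  have hA0 : 0 < A := by linarith
  have hp : IsGeodPoint (1 - η / A) a m y := by
    refine ⟨?_, ?_⟩
    · rw [ham, hay]; field_simp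
    · rw [ham, hym]; field_simp; ring
  -- Comparison for `y` on the side from `a` to `m`, seen from `z`. Since `y` and `z` are as far
  -- apart as `2 * η`, the inequality can be solved for a lower bound on `dist a z`.
  have key := hX.dist_sq_le (t := 1 - η / A)
    ⟨by rw [sub_nonneg, div_le_one hA0]; exact hA, by simp; positivity⟩ hp z
  rw [hyz, hmz, ham] at key
  have key2 : (A + η) ^ 2 ≤ dist a z ^ 2 := by
    have e : (1 - (1 - η / A)) * dist a z ^ 2 + (1 - η / A) * η ^ 2
        - (1 - η / A) * (1 - (1 - η / A)) * A ^ 2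
        = (η / A) * (dist a z ^ 2 - (A + η) ^ 2) + (2 * η) ^ 2 := by
      field_simp; ring
    rw [e] at key
    have : 0 ≤ (η / A) * (dist a z ^ 2 - (A + η) ^ 2) := by linarith
    have := nonneg_of_mul_nonneg_right this (by positivity)
    linarith
  have h1 : A + η ≤ dist a z := abs_le_of_sq_le_sq' key2 dist_nonneg |>.2
  linarith [dist_triangle a m z]

theorem IsCAT0.eq_path_of_mem_geodSeg (hX : IsCAT0 X) {x y : X} {γ : ℝ → X} (h0 : γ 0 = x)
    (h1 : γ 1 = y)
    (h : ∀ s ∈ Set.Icc (0 : ℝ) 1, ∀ t ∈ Set.Icc (0 : ℝ) 1, dist (γ s) (γ t) = |s - t| * dist x y) :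
    geodSeg x y = γ '' Set.Icc 0 1 := by
  ext m
  constructor
  · intro hm
    obtain ⟨t, ht, hm⟩ := exists_isGeodPoint_of_mem_geodSeg hm
    exact ⟨t, ht, hX.isGeodPoint_unique ht (isGeodPoint_of_path h0 h1 h ht) hm⟩
  · rintro ⟨t, ht, rfl⟩
    exact (isGeodPoint_of_path h0 h1 h ht).mem_geodSeg

theorem continuousOn_path {x y : X} {γ : ℝ → X}
    (h : ∀ s ∈ Set.Icc (0 : ℝ) 1, ∀ t ∈ Set.Icc (0 : ℝ) 1, dist (γ s) (γ t) = |s - t| * dist x y) :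
    ContinuousOn γ (Set.Icc 0 1) := by
  have : LipschitzOnWith (Real.toNNReal (dist x y)) γ (Set.Icc 0 1) := by
    refine LipschitzOnWith.of_dist_le_mul fun s hs t ht => ?_
    rw [h s hs t ht, Real.coe_toNNReal _ dist_nonneg, Real.dist_eq, mul_comm]
  exact this.continuousOn

theorem IsCAT0.isCompact_geodSeg (hX : IsCAT0 X) (x y : X) : IsCompact (geodSeg x y) := by
  obtain ⟨γ, h0, h1, h⟩ := hX.1.exists_path x y
  rw [hX.eq_path_of_mem_geodSeg h0 h1 h]
  exact isCompact_Icc.image_of_continuousOn (continuousOn_path h)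

theorem IsCAT0.isPreconnected_geodSeg (hX : IsCAT0 X) (x y : X) :
    IsPreconnected (geodSeg x y) := by
  obtain ⟨γ, h0, h1, h⟩ := hX.1.exists_path x y
  rw [hX.eq_path_of_mem_geodSeg h0 h1 h]
  exact isPreconnected_Icc.image _ (continuousOn_path h)

/-- Geodesic convexity. -/
def GeodConvex (A : Set X) : Prop := ∀ x ∈ A, ∀ y ∈ A, geodSeg x y ⊆ A

theorem GeodConvex.inter {A B : Set X} (hA : GeodConvex A) (hB : GeodConvex B) :
    GeodConvex (A ∩ B) := fun x hx y hy _ hm =>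
  ⟨hA x hx.1 y hy.1 hm, hB x hx.2 y hy.2 hm⟩

theorem IsCAT0.geodConvex_closure (hX : IsCAT0 X) {A : Set X} (hA : GeodConvex A) :
    GeodConvex (closure A) := by
  intro x hx y hy m hm
  obtain ⟨t, ht, hm⟩ := exists_isGeodPoint_of_mem_geodSeg hm
  rw [Metric.mem_closure_iff] at hx hy ⊢
  intro ε hε
  obtain ⟨x', hx', hxx'⟩ := hx ε hε
  obtain ⟨y', hy', hyy'⟩ := hy ε hε
  obtain ⟨m', hm'⟩ := hX.1.exists_isGeodPoint x' y' ht
  refine ⟨m', hA x' hx' y' hy' hm'.mem_geodSeg, (hX.dist_isGeodPoint_le ht hm hm').trans_lt ?_⟩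
  rcases eq_or_lt_of_le ht.1 with h | h
  · subst h; simpa using hxx'
  · nlinarith [ht.2]

/-- A closed set containing the midpoints of its points is convex. -/
theorem IsCAT0.geodConvex_of_midpoint (hX : IsCAT0 X) {A : Set X} (hcl : IsClosed A)
    (hmid : ∀ x ∈ A, ∀ y ∈ A, ∀ m, IsGeodPoint (1 / 2) x y m → m ∈ A) : GeodConvex A := by
  intro x hx y hy m hm
  obtain ⟨γ, h0, h1, h⟩ := hX.1.exists_path x y
  rw [hX.eq_path_of_mem_geodSeg h0 h1 h] at hm
  obtain ⟨t, ht, rfl⟩ := hm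
  set T := Set.Icc (0 : ℝ) 1 ∩ γ ⁻¹' A with hT
  have hTcl : IsClosed T := (continuousOn_path h).preimage_isClosed_of_isClosed isClosed_Icc hcl
  by_contra hmA
  -- the complementary gap containing `t`
  have hL : (T ∩ Set.Iic t).Nonempty := ⟨0, ⟨by simp, by simpa [h0] using hx⟩, ht.1⟩
  have hU : (T ∩ Set.Ici t).Nonempty := ⟨1, ⟨by simp, by simpa [h1] using hy⟩, ht.2⟩
  have hLc : IsCompact (T ∩ Set.Iic t) :=
    (isCompact_Icc (a := (0 : ℝ)) (b := 1)).of_isClosed_subset (hTcl.inter isClosed_Iic)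
      fun s hs => hs.1.1
  have hUc : IsCompact (T ∩ Set.Ici t) :=
    (isCompact_Icc (a := (0 : ℝ)) (b := 1)).of_isClosed_subset (hTcl.inter isClosed_Ici)
      fun s hs => hs.1.1
  obtain ⟨a, ⟨haT, hat⟩, ha⟩ := hLc.exists_isGreatest hL
  obtain ⟨b, ⟨hbT, htb⟩, hb⟩ := hUc.exists_isLeast hU
  have hat' : a < t := lt_of_le_of_ne hat fun e => hmA (e ▸ haT.2)
  have htb' : t < b := lt_of_le_of_ne htb fun e => hmA (e ▸ hbT.2)
  have hcI : (a + b) / 2 ∈ Set.Icc (0 : ℝ) 1 :=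
    ⟨by linarith [haT.1.1, hbT.1.1], by linarith [haT.1.2, hbT.1.2]⟩
  have hc : (a + b) / 2 ∈ T := by
    refine ⟨hcI, hmid _ haT.2 _ hbT.2 _ ⟨?_, ?_⟩⟩
    · rw [h _ haT.1 _ hcI, h _ haT.1 _ hbT.1, abs_of_neg (by linarith), abs_of_neg (by linarith)]
      ring
    · rw [h _ hcI _ hbT.1, h _ haT.1 _ hbT.1, abs_of_neg (by linarith), abs_of_neg (by linarith)]
      ring
  rcases le_total ((a + b) / 2) t with hct | hct
  · have := ha ⟨hc, hct⟩; linarith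
  · have := hb ⟨hc, hct⟩; linarith

end CAT0

/-! ### Gluing, fibers and stars in a cube complex -/

namespace CubeComplex

variable {X : Type*} [MetricSpace X] (S : CubeComplex X)

theorem chart_mem_cell {C : S.Cube} {v : EuclideanSpace ℝ (Fin (S.dim C))}
    (hv : v ∈ unitCube (S.dim C)) : S.chart C v ∈ S.cell C := ⟨v, hv, rfl⟩

/-- The gluing axiom in terms of a map between Euclidean spaces. -/
theorem exists_glue_map (C D : S.Cube) (h : (S.cell C ∩ S.cell D).Nonempty) :
    ∃ (σ : Fin (S.dim C) → Option Bool) (τ : Fin (S.dim D) → Option Bool)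
      (F : EuclideanSpace ℝ (Fin (S.dim C)) → EuclideanSpace ℝ (Fin (S.dim D))),
      Set.MapsTo F (cubeFace σ) (cubeFace τ) ∧ Set.SurjOn F (cubeFace σ) (cubeFace τ) ∧
      (∀ v ∈ cubeFace σ, ∀ w ∈ cubeFace σ, dist (F v) (F w) = dist v w) ∧
      ∀ v ∈ unitCube (S.dim C), ∀ w ∈ unitCube (S.dim D),
        S.chart C v = S.chart D w ↔ v ∈ cubeFace σ ∧ F v = w := by
  classical
  obtain ⟨σ, τ, f, hf⟩ := S.glue C D h
  have hFv : ∀ v (hv : v ∈ cubeFace σ),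
      (if hv : v ∈ cubeFace σ then (f ⟨v, hv⟩ : EuclideanSpace ℝ (Fin (S.dim D))) else 0)
        = f ⟨v, hv⟩ := fun v hv => by simp [hv]
  refine ⟨σ, τ, fun v => if hv : v ∈ cubeFace σ then f ⟨v, hv⟩ else 0, ?_, ?_, ?_, ?_⟩
  · intro v hv
    simp only [hFv v hv]
    exact (f ⟨v, hv⟩).2
  · intro w hw
    refine ⟨f.symm ⟨w, hw⟩, (f.symm ⟨w, hw⟩).2, ?_⟩
    simp
  · intro v hv w hw
    simp only [hFv v hv, hFv w hw]
    rw [← Subtype.dist_eq, f.dist_eq, Subtype.dist_eq]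
  · intro v hv w hw
    rw [hf v hv w hw]
    constructor
    · rintro ⟨h1, h2⟩; exact ⟨h1, (hFv v h1).trans h2⟩
    · rintro ⟨h1, h2⟩; exact ⟨h1, (hFv v h1).symm.trans h2⟩

/-- `φ` runs through a unit segment of the cube `m.1` in the direction of the coordinate `m.2`. -/
def IsFiber (m : Σ C : S.Cube, Fin (S.dim C)) (φ : unitInterval → X) : Prop :=
  ∃ v ∈ unitCube (S.dim m.1), ∃ o : Bool, ∀ a : unitInterval,
    φ a = S.chart m.1 (setCoord v m.2 (flipLevel o a))

variable {S}

theorem isFiber_chart {C : S.Cube} {v : EuclideanSpace ℝ (Fin (S.dim C))}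
    (hv : v ∈ unitCube (S.dim C)) (i : Fin (S.dim C)) (o : Bool) :
    S.IsFiber ⟨C, i⟩ fun a => S.chart C (setCoord v i (flipLevel o a)) :=
  ⟨v, hv, o, fun _ => rfl⟩

theorem IsFiber.symm {m : Σ C : S.Cube, Fin (S.dim C)} {φ : unitInterval → X}
    (h : S.IsFiber m φ) : S.IsFiber m (φ ∘ unitInterval.symm) := by
  obtain ⟨v, hv, o, h⟩ := h
  refine ⟨v, hv, !o, fun a => ?_⟩
  rw [Function.comp_apply, h]
  cases o <;> simp

/-- A fiber passes through each of its points along a coordinate direction. -/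
theorem IsFiber.exists_at {C : S.Cube} {i : Fin (S.dim C)} {φ : unitInterval → X}
    (h : S.IsFiber ⟨C, i⟩ φ) {a : unitInterval} {w : EuclideanSpace ℝ (Fin (S.dim C))}
    (hw : w ∈ unitCube (S.dim C)) (ha : φ a = S.chart C w) :
    ∃ o : Bool, w i = flipLevel o a ∧ ∀ b : unitInterval,
      φ b = S.chart C (setCoord w i (flipLevel o b)) := by
  obtain ⟨v, hv, o, h⟩ := h
  have hw' : w = setCoord v i (flipLevel o a) :=
    S.injOn C hw (setCoord_mem_unitCube hv i (flipLevel_mem_Icc a.2)) (ha.symm.trans (h a))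
  refine ⟨o, by rw [hw']; simp, fun b => ?_⟩
  rw [h b, hw', setCoord_setCoord]

theorem IsFiber.mem_cell {m : Σ C : S.Cube, Fin (S.dim C)} {φ : unitInterval → X}
    (h : S.IsFiber m φ) (a : unitInterval) : φ a ∈ S.cell m.1 := by
  obtain ⟨v, hv, o, h⟩ := h
  rw [h a]
  exact S.chart_mem_cell (setCoord_mem_unitCube hv _ (flipLevel_mem_Icc a.2))

/-- Parallel fibers of a cube that have interior points in another cube are parallel fibers of
that cube. -/
theorem IsFiber.transfer_all {m : Σ C : S.Cube, Fin (S.dim C)} {φ : unitInterval → X}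
    (h : S.IsFiber m φ) {a : unitInterval} (ha : (a : ℝ) ∈ Set.Ioo (0 : ℝ) 1) {D : S.Cube}
    (hD : φ a ∈ S.cell D) : ∃ l, ∀ (ψ : unitInterval → X) (b : unitInterval),
      S.IsFiber m ψ → (b : ℝ) ∈ Set.Ioo (0 : ℝ) 1 → ψ b ∈ S.cell D → S.IsFiber ⟨D, l⟩ ψ := by
  obtain ⟨σ, τ, F, hF, hsurj, hd, hglue⟩ := S.exists_glue_map m.1 D ⟨φ a, h.mem_cell a, hD⟩
  have key : ∀ (ψ : unitInterval → X) (b : unitInterval),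
      S.IsFiber m ψ → (b : ℝ) ∈ Set.Ioo (0 : ℝ) 1 → ψ b ∈ S.cell D →
      ∃ v ∈ cubeFace σ, σ m.2 = none ∧ ∃ o : Bool, ∀ c : unitInterval,
        ψ c = S.chart m.1 (setCoord v m.2 (flipLevel o c)) := by
    rintro ψ b ⟨v, hv, o, h⟩ hb ⟨w, hw, hwb⟩
    have hva := setCoord_mem_unitCube hv m.2 (flipLevel_mem_Icc (o := o) b.2)
    have h1 := (hglue _ hva w hw).1 (by rw [← h b, hwb])
    have hI := flipLevel_mem_Ioo (o := o) hb
    refine ⟨_, h1.1, eq_none_of_mem_cubeFace h1.1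
      (by rw [setCoord_same]; exact hI.1.ne') (by rw [setCoord_same]; exact hI.2.ne), o,
      fun c => ?_⟩
    rw [h c, setCoord_setCoord]
  obtain ⟨-, -, hi, -⟩ := key φ a h ha hD
  -- The direction `l` depends only on the gluing isometry, so it serves all fibers parallel to `φ`
  -- at once.
  obtain ⟨l, o', hl⟩ := exists_coord_of_isometry hF hsurj hd hi
  refine ⟨l, fun ψ b hψ hb hbD => ?_⟩
  obtain ⟨v, hv, -, o, h⟩ := key ψ b hψ hb hbD
  refine ⟨F v, (hF hv).1, xor o o', fun c => ?_⟩
  have hc := flipLevel_mem_Icc (o := o) c.2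
  have h2 := setCoord_mem_cubeFace hv hi hc
  rw [h c, (hglue _ h2.1 _ (hF h2).1).2 ⟨h2, rfl⟩, hl _ hv _ hc]
  cases o <;> cases o' <;> simp

/-- A fiber an interior point of which lies in a cube is a fiber of that cube. -/
theorem IsFiber.transfer {m : Σ C : S.Cube, Fin (S.dim C)} {φ : unitInterval → X}
    (h : S.IsFiber m φ) {a : unitInterval} (ha : (a : ℝ) ∈ Set.Ioo (0 : ℝ) 1) {D : S.Cube}
    (hD : φ a ∈ S.cell D) : ∃ l, S.IsFiber ⟨D, l⟩ φ := by
  obtain ⟨l, hl⟩ := h.transfer_all ha hD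
  exact ⟨l, hl φ a h ha hD⟩

/-- The point is interior to the fiber through it in direction `i`, so this fiber is also a fiber of
`C`, in some direction `l`. Coordinates strictly between `0` and `1` are thus visible in every cube
containing the point. -/
theorem exists_coord_eq {C D : S.Cube} {v : EuclideanSpace ℝ (Fin (S.dim C))}
    {w : EuclideanSpace ℝ (Fin (S.dim D))} (hv : v ∈ unitCube (S.dim C))
    (hw : w ∈ unitCube (S.dim D)) (h : S.chart C v = S.chart D w) {i : Fin (S.dim D)}
    (hi : w i ∈ Set.Ioo (0 : ℝ) 1) : ∃ l o, v l = flipLevel o (w i) := by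
  have hf := isFiber_chart hw i false
  have hval : (fun a : unitInterval => S.chart D (setCoord w i (flipLevel false a)))
      ⟨w i, hw i⟩ = S.chart C v := by simp [h]
  obtain ⟨l, hl⟩ := hf.transfer (a := ⟨w i, hw i⟩) hi (D := C)
    (Set.mem_of_eq_of_mem hval (S.chart_mem_cell hv))
  obtain ⟨o, ho, -⟩ := hl.exists_at hv hval
  exact ⟨l, o, ho⟩

theorem dist_eq_of_chart_eq {C D : S.Cube} {v v' : EuclideanSpace ℝ (Fin (S.dim C))}
    {w w' : EuclideanSpace ℝ (Fin (S.dim D))} (hv : v ∈ unitCube (S.dim C))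
    (hv' : v' ∈ unitCube (S.dim C)) (hw : w ∈ unitCube (S.dim D)) (hw' : w' ∈ unitCube (S.dim D))
    (h : S.chart C v = S.chart D w) (h' : S.chart C v' = S.chart D w') :
    dist v v' = dist w w' := by
  obtain ⟨σ, τ, F, hF, hsurj, hd, hglue⟩ := S.exists_glue_map C D
    ⟨_, S.chart_mem_cell hv, h ▸ S.chart_mem_cell hw⟩
  have h1 := (hglue v hv w hw).1 h
  have h2 := (hglue v' hv' w' hw').1 h'
  rw [← h1.2, ← h2.2, hd _ h1.1 _ h2.1]

theorem dist_chart_le {C : S.Cube} {v w : EuclideanSpace ℝ (Fin (S.dim C))}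
    (hv : v ∈ unitCube (S.dim C)) (hw : w ∈ unitCube (S.dim C)) :
    dist (S.chart C v) (S.chart C w) ≤ dist v w := by
  have := (S.dist_isGLB (S.chart C v) (S.chart C w)).1
    (StringLength.step C v w _ 0 hv hw (StringLength.refl _))
  simpa using this

/-- The coordinates of `v` have distance at least `ε` from those of `0`, `1` that they differ
from. -/
def HasRoom {n : ℕ} (ε : ℝ) (v : EuclideanSpace ℝ (Fin n)) : Prop :=
  ∀ i, (v i ≠ 0 → ε ≤ v i) ∧ (v i ≠ 1 → ε ≤ 1 - v i)

theorem exists_hasRoom {n : ℕ} {v : EuclideanSpace ℝ (Fin n)} (hv : v ∈ unitCube n) :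
    ∃ ε > 0, ε ≤ 1 ∧ HasRoom ε v := by
  have key : ∀ᶠ ε in nhdsWithin (0 : ℝ) (Set.Ioi 0), ∀ i,
      (v i ≠ 0 → ε ≤ v i) ∧ (v i ≠ 1 → ε ≤ 1 - v i) := by
    refine Filter.eventually_all.2 fun i => Filter.Eventually.and ?_ ?_
    · by_cases h : v i = 0
      · simp [h]
      · have : 0 < v i := lt_of_le_of_ne (hv i).1 (Ne.symm h)
        filter_upwards [mem_nhdsWithin_of_mem_nhds (Iic_mem_nhds this)] with ε hε _ using hε
    · by_cases h : v i = 1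
      · simp [h]
      · have : 0 < 1 - v i := by linarith [lt_of_le_of_ne (hv i).2 h]
        filter_upwards [mem_nhdsWithin_of_mem_nhds (Iic_mem_nhds this)] with ε hε _ using hε
  have h1 : ∀ᶠ ε in nhdsWithin (0 : ℝ) (Set.Ioi 0), ε ≤ 1 :=
    mem_nhdsWithin_of_mem_nhds (Iic_mem_nhds one_pos)
  obtain ⟨ε, ⟨hε, h1⟩, h0⟩ := ((key.and h1).and self_mem_nhdsWithin).exists
  exact ⟨ε, h0, h1, hε⟩

/-- If `v` missed the value prescribed by the face in one coordinate, this coordinate alone would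
separate it from `x` by at least `ε`. -/
theorem HasRoom.mem_cubeFace {n : ℕ} {ε : ℝ} {v x : EuclideanSpace ℝ (Fin n)}
    (h : HasRoom ε v) (hv : v ∈ unitCube n) (hd : dist v x < ε) {σ : Fin n → Option Bool}
    (hx : x ∈ cubeFace σ) : v ∈ cubeFace σ := by
  refine ⟨hv, fun i b hb => ?_⟩
  have h1 := hx.2 i b hb
  have h2 := (abs_sub_le_dist v x i).trans_lt hd
  by_contra hne
  cases b
  · simp at h1 hne
    rw [h1, sub_zero, abs_of_nonneg (hv i).1] at h2
    linarith [(h i).1 hne]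
  · simp at h1 hne
    rw [h1, abs_sub_comm, abs_of_nonneg (by linarith [(hv i).2])] at h2
    linarith [(h i).2 hne]

/-- Room is a property of the point and not of the cube: a coordinate of `w` other than `0` and `1`
occurs among those of `v` up to reversal. The bound `ε ≤ 1` covers the remaining coordinates. -/
theorem HasRoom.transfer {C D : S.Cube} {v : EuclideanSpace ℝ (Fin (S.dim C))}
    {w : EuclideanSpace ℝ (Fin (S.dim D))} (hv : v ∈ unitCube (S.dim C))
    (hw : w ∈ unitCube (S.dim D)) (h : S.chart C v = S.chart D w) {ε : ℝ} (hε : ε ≤ 1)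
    (hr : HasRoom ε v) : HasRoom ε w := by
  intro i
  by_cases h0 : w i = 0
  · simp [h0, hε]
  by_cases h1 : w i = 1
  · simp [h1, hε]
  have hi : w i ∈ Set.Ioo (0 : ℝ) 1 :=
    ⟨lt_of_le_of_ne (hw i).1 (Ne.symm h0), lt_of_le_of_ne (hw i).2 h1⟩
  obtain ⟨l, o, hl⟩ := exists_coord_eq hv hw h hi
  have hI := flipLevel_mem_Ioo (o := o) hi
  rw [← hl] at hI
  have h2 := (hr l).1 hI.1.ne'
  have h3 := (hr l).2 hI.2.ne
  cases o <;> simp at hl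
  · rw [hl] at h2 h3; exact ⟨fun _ => h2, fun _ => h3⟩
  · rw [hl] at h2 h3; exact ⟨fun _ => by linarith, fun _ => by linarith⟩

/-- Whenever a string of total length below `ε` passes to a new cube, the face of contact contains
`v` because of the room around it. So `v` is carried along into the new cube, and the triangle
inequality there replaces two pieces of the string by one. -/
theorem exists_common_cube_of_string {x y : X} {ℓ ε : ℝ}
    (h : StringLength S.dim S.chart x y ℓ) (hε : ε ≤ 1) :
    ∀ (C : S.Cube), ∀ v ∈ unitCube (S.dim C), ∀ w ∈ unitCube (S.dim C), S.chart C w = x →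
      HasRoom ε v → dist v w + ℓ < ε →
      ∃ D, ∃ v' ∈ unitCube (S.dim D), ∃ w' ∈ unitCube (S.dim D),
        S.chart D v' = S.chart C v ∧ S.chart D w' = y ∧ dist v' w' ≤ dist v w + ℓ := by
  have hnn : ∀ {x y : X} {ℓ : ℝ}, StringLength S.dim S.chart x y ℓ → 0 ≤ ℓ := by
    intro x y ℓ h
    induction h with
    | refl => exact le_rfl
    | step C v w y ℓ hv hw h ih => positivity
  induction h with
  | refl x =>
    intro C v hv w hw hx _ _
    exact ⟨C, v, hv, w, hw, rfl, hx, by simp⟩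
  | step C' a b y ℓ ha hb hs ih =>
    intro C v hv w hw hx hr hlt
    have hℓ := hnn hs
    obtain ⟨σ, τ, F, hF, hsurj, hd, hglue⟩ := S.exists_glue_map C C'
      ⟨_, S.chart_mem_cell hw, hx ▸ S.chart_mem_cell ha⟩
    have h1 := (hglue w hw a ha).1 hx
    have hvσ : v ∈ cubeFace σ :=
      hr.mem_cubeFace hv (by linarith [dist_nonneg (x := a) (y := b)]) h1.1
    have hFv := hF hvσ
    have hch : S.chart C v = S.chart C' (F v) := (hglue v hv _ hFv.1).2 ⟨hvσ, rfl⟩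
    have hdd : dist (F v) a = dist v w := by rw [← h1.2, hd _ hvσ _ h1.1]
    have htri := dist_triangle (F v) a b
    obtain ⟨D, v', hv', w', hw', e1, e2, e3⟩ := ih C' (F v) hFv.1 b hb rfl
      (hr.transfer hv hFv.1 hch hε) (by linarith)
    exact ⟨D, v', hv', w', hw', e1.trans hch.symm, e2, by linarith⟩

/-- Points close to `p` lie in a common cube with `p`, and their distance from `p` is measured in
that cube. -/
theorem exists_common_cube {C : S.Cube} {v : EuclideanSpace ℝ (Fin (S.dim C))}
    (hv : v ∈ unitCube (S.dim C)) {ε : ℝ} (hε : ε ≤ 1) (hr : HasRoom ε v) {z : X}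
    (hz : dist (S.chart C v) z < ε) :
    ∃ D, ∃ v' ∈ unitCube (S.dim D), ∃ w' ∈ unitCube (S.dim D),
        S.chart D v' = S.chart C v ∧ S.chart D w' = z ∧ dist v' w' = dist (S.chart C v) z := by
  have key : ∀ ℓ, StringLength S.dim S.chart (S.chart C v) z ℓ → ℓ < ε →
      ∃ D, ∃ v' ∈ unitCube (S.dim D), ∃ w' ∈ unitCube (S.dim D),
        S.chart D v' = S.chart C v ∧ S.chart D w' = z ∧ dist v' w' ≤ ℓ := by
    intro ℓ hℓ hlt
    simpa using exists_common_cube_of_string hℓ hε C v hv v hv rfl hr (by simpa using hlt)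
  have hglb := S.dist_isGLB (S.chart C v) z
  obtain ⟨ℓ, hℓ, -, hlt⟩ := hglb.exists_between hz
  obtain ⟨D, v', hv', w', hw', e1, e2, -⟩ := key ℓ hℓ hlt
  refine ⟨D, v', hv', w', hw', e1, e2, le_antisymm ?_ (e1 ▸ e2 ▸ dist_chart_le hv' hw')⟩
  -- Shorter strings may lead to other common cubes, but the distance of the two points measured in
  -- a cube does not depend on the cube; so it is bounded by the infimum of the lengths.
  refine le_of_forall_gt_imp_ge_of_dense fun r hr' => ?_
  obtain ⟨ℓ', hℓ', -, hlt'⟩ := hglb.exists_between (lt_min hz hr')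
  obtain ⟨D', v'', hv'', w'', hw'', e1', e2', e3'⟩ := key ℓ' hℓ' (hlt'.trans_le (min_le_left _ _))
  rw [dist_eq_of_chart_eq hv' hw' hv'' hw'' (e1.trans e1'.symm) (e2.trans e2'.symm)]
  exact e3'.trans (hlt'.le.trans (min_le_right _ _))

/-- Every point has a neighbourhood each point of which lies in a common cube with it. -/
theorem exists_star (S : CubeComplex X) (p : X) :
    ∃ ε > 0, ∀ z, dist p z < ε → ∃ D, p ∈ S.cell D ∧ z ∈ S.cell D := by
  obtain ⟨C, v, hv, rfl⟩ := S.cover p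
  obtain ⟨ε, hε, hε1, hr⟩ := exists_hasRoom hv
  refine ⟨ε, hε, fun z hz => ?_⟩
  obtain ⟨D, v', hv', w', hw', e1, e2, -⟩ := exists_common_cube hv hε1 hr hz
  exact ⟨D, ⟨v', hv', e1⟩, ⟨w', hw', e2⟩⟩

theorem dist_chart_eq_of_lt {C : S.Cube} {v w : EuclideanSpace ℝ (Fin (S.dim C))}
    (hv : v ∈ unitCube (S.dim C)) (hw : w ∈ unitCube (S.dim C)) {ε : ℝ} (hε : ε ≤ 1)
    (hr : HasRoom ε v) (hd : dist v w < ε) : dist (S.chart C v) (S.chart C w) = dist v w := by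
  obtain ⟨D, v', hv', w', hw', e1, e2, e3⟩ := exists_common_cube hv hε hr
    ((dist_chart_le hv hw).trans_lt hd)
  rw [← e3, dist_eq_of_chart_eq hv' hw' hv hw e1 e2]

/-- Charts preserve the distances between points in the interior of the same face. -/
theorem dist_chart_eq_of_hasRoom (hX : IsCAT0 X) {C : S.Cube}
    {v w : EuclideanSpace ℝ (Fin (S.dim C))}
    (hv : v ∈ unitCube (S.dim C)) (hw : w ∈ unitCube (S.dim C)) {ε : ℝ} (hε0 : 0 < ε) (hε : ε ≤ 1)
    (hr : ∀ t ∈ Set.Icc (0 : ℝ) 1, HasRoom ε (AffineMap.lineMap v w t)) :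
    dist (S.chart C v) (S.chart C w) = dist v w := by
  rcases eq_or_ne v w with rfl | hne
  · simp
  have hvw : 0 < dist v w := dist_pos.2 hne
  -- The step `η = dist v w / N` satisfies `2 * η < ε`, so the chart is isometric on any three
  -- consecutive points of the subdivision.
  obtain ⟨N, hN⟩ := exists_nat_gt (2 * dist v w / ε)
  have hN0 : (0 : ℝ) < N := lt_of_le_of_lt (by positivity) hN
  have hη : 2 * (dist v w / N) < ε := by
    rw [div_lt_iff₀ hε0] at hN
    rw [← mul_div_assoc, div_lt_iff₀ hN0]; linarith
  set η := dist v w / N with hηdef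
  have hη0 : 0 < η := by positivity
  set u : ℕ → EuclideanSpace ℝ (Fin (S.dim C)) := fun j => AffineMap.lineMap v w ((j : ℝ) / N)
  have hI : ∀ j ≤ N, (j : ℝ) / N ∈ Set.Icc (0 : ℝ) 1 := fun j hj =>
    ⟨by positivity, by rw [div_le_one hN0]; exact_mod_cast hj⟩
  have hu : ∀ j ≤ N, u j ∈ unitCube (S.dim C) := fun j hj =>
    convex_unitCube.lineMap_mem hv hw (hI j hj)
  have hdu : ∀ j l, dist (u j) (u l) = |(j : ℝ) - l| * η := fun j l => by
    simp only [u]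
    rw [dist_lineMap_lineMap, Real.dist_eq, ← sub_div, abs_div, abs_of_pos hN0, hηdef]; ring
  have hnear : ∀ j ≤ N, ∀ l ≤ N, |(j : ℝ) - l| ≤ 2 →
      dist (S.chart C (u j)) (S.chart C (u l)) = |(j : ℝ) - l| * η := fun j hj l hl h => by
    rw [← hdu, dist_chart_eq_of_lt (hu j hj) (hu l hl) hε (hr _ (hI j hj))]
    rw [hdu]; nlinarith
  -- A local geodesic is a geodesic: overlapping pieces of length `2 * η` are appended one step at a
  -- time. Two consecutive distances are carried through the induction because the overlap argument
  -- needs both.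
  have key : ∀ j, j + 1 ≤ N → dist (S.chart C (u 0)) (S.chart C (u j)) = j * η ∧
      dist (S.chart C (u 0)) (S.chart C (u (j + 1))) = (j + 1 : ℕ) * η := by
    intro j
    induction j with
    | zero =>
      intro hj
      refine ⟨by simp, ?_⟩
      rw [hnear 0 (by omega) 1 hj (by norm_num)]; norm_num
    | succ j ih =>
      intro hj
      obtain ⟨h1, h2⟩ := ih (by omega)
      refine ⟨h2, ?_⟩
      have h3 := hX.dist_eq_add_of_overlap (a := S.chart C (u 0)) (y := S.chart C (u j))
        (m := S.chart C (u (j + 1))) (z := S.chart C (u (j + 1 + 1))) (A := (j + 1 : ℕ) * η) hη0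
        (by push_cast; nlinarith [(Nat.cast_nonneg j : (0 : ℝ) ≤ j)]) h2
        (by rw [h1]; push_cast; ring)
        (by rw [hnear j (by omega) (j + 1) (by omega)] <;> push_cast <;> simp)
        (by rw [hnear (j + 1) (by omega) (j + 1 + 1) (by omega)] <;> push_cast <;> simp)
        (by
          have : (j : ℝ) - ((j : ℝ) + 1 + 1) = -2 := by ring
          rw [hnear j (by omega) (j + 1 + 1) (by omega)] <;> push_cast <;> rw [this] <;> simp)
      rw [h3]; push_cast; ring
  obtain ⟨j, rfl⟩ : ∃ j, N = j + 1 := ⟨N - 1, by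
    have : 0 < N := by exact_mod_cast hN0
    omega⟩
  have h := (key j le_rfl).2
  have h0 : u 0 = v := by simp [u]
  have h1 : u (j + 1) = w := by
    simp only [u]; rw [div_self hN0.ne']; simp
  rw [h0, h1] at h
  rw [h, hηdef]; field_simp

/-- The charts of a CAT(0) cube complex are isometric embeddings. -/
theorem dist_chart_eq (hX : IsCAT0 X) {C : S.Cube} {v w : EuclideanSpace ℝ (Fin (S.dim C))}
    (hv : v ∈ unitCube (S.dim C)) (hw : w ∈ unitCube (S.dim C)) :
    dist (S.chart C v) (S.chart C w) = dist v w := by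
  have hmem : ∀ t ∈ Set.Icc (0 : ℝ) 1, AffineMap.lineMap v w t ∈ unitCube (S.dim C) :=
    fun t ht => convex_unitCube.lineMap_mem hv hw ht
  have hco : ∀ (t : ℝ) i, (AffineMap.lineMap v w t : EuclideanSpace ℝ (Fin (S.dim C))) i
      = v i + t * (w i - v i) := fun t i => by
    simp [AffineMap.lineMap_apply]; ring
  -- The points at parameters `s` and `1 - s` are interior to the same face of the cube, so there is
  -- uniform room along the segment between them.
  have hz : ∀ s ∈ Set.Ioo (0 : ℝ) (1 / 2),
      dist (S.chart C (AffineMap.lineMap v w s)) (S.chart C (AffineMap.lineMap v w (1 - s)))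
        = (1 - 2 * s) * dist v w := by
    intro s hs
    have hs1 : s ∈ Set.Icc (0 : ℝ) 1 := ⟨hs.1.le, by linarith [hs.2]⟩
    have hs2 : 1 - s ∈ Set.Icc (0 : ℝ) 1 := ⟨by linarith [hs.2], by linarith [hs.1]⟩
    obtain ⟨ε, hε, hε1, hr⟩ := exists_hasRoom (hmem s hs1)
    obtain ⟨ε', hε', hε1', hr'⟩ := exists_hasRoom (hmem _ hs2)
    rw [dist_chart_eq_of_hasRoom hX (hmem s hs1) (hmem _ hs2) (lt_min hε hε')
      ((min_le_left _ _).trans hε1), dist_lineMap_lineMap, Real.dist_eq, abs_of_neg (by linarith [hs.2])]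
    · ring
    · intro t ht i
      have hc : (AffineMap.lineMap (AffineMap.lineMap v w s) (AffineMap.lineMap v w (1 - s)) t :
          EuclideanSpace ℝ (Fin (S.dim C))) i
          = (1 - t) * (AffineMap.lineMap v w s : EuclideanSpace ℝ (Fin (S.dim C))) i
            + t * (AffineMap.lineMap v w (1 - s) : EuclideanSpace ℝ (Fin (S.dim C))) i := by
        simp [AffineMap.lineMap_apply]; ring
      have hri := hr i
      have hri' := hr' i
      rw [hc]
      rw [hco] at hri hri' ⊢
      rw [hco]
      obtain ⟨ht0, ht1⟩ := ht
      obtain ⟨hs0, hs3⟩ := hs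
      obtain ⟨hv0, hv1⟩ := hv i
      obtain ⟨hw0, hw1⟩ := hw i
      constructor
      · intro hne
        by_cases hvw : v i = 0 ∧ w i = 0
        · rw [hvw.1, hvw.2] at hne; simp at hne
        · have hpos : 0 < v i + w i := by
            by_contra hcon
            exact hvw ⟨by linarith, by linarith⟩
          have a1 := hri.1 (by
            intro h0
            have : s * (v i + w i) ≤ v i + s * (w i - v i) := by nlinarith
            nlinarith)
          have a2 := hri'.1 (by
            intro h0
            have : s * (v i + w i) ≤ v i + (1 - s) * (w i - v i) := by nlinarith
            nlinarith)
          nlinarith [min_le_left ε ε', min_le_right ε ε']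
      · intro hne
        by_cases hvw : v i = 1 ∧ w i = 1
        · rw [hvw.1, hvw.2] at hne; exact absurd (by ring) hne
        · have hpos : 0 < 2 - v i - w i := by
            by_contra hcon
            exact hvw ⟨by linarith, by linarith⟩
          have a1 := hri.2 (by
            intro h0
            have : s * (2 - v i - w i) ≤ 1 - (v i + s * (w i - v i)) := by nlinarith
            nlinarith)
          have a2 := hri'.2 (by
            intro h0
            have : s * (2 - v i - w i) ≤ 1 - (v i + (1 - s) * (w i - v i)) := by nlinarith
            nlinarith)
          nlinarith [min_le_left ε ε', min_le_right ε ε']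
  refine le_antisymm (dist_chart_le hv hw) ?_
  -- Returning to `v` and `w` costs at most `s * dist v w` at each end; then `s` tends to `0`.
  have hbound : ∀ s ∈ Set.Ioo (0 : ℝ) (1 / 2),
      (1 - 4 * s) * dist v w ≤ dist (S.chart C v) (S.chart C w) := by
    intro s hs
    have hs1 : s ∈ Set.Icc (0 : ℝ) 1 := ⟨hs.1.le, by linarith [hs.2]⟩
    have hs2 : 1 - s ∈ Set.Icc (0 : ℝ) 1 := ⟨by linarith [hs.2], by linarith [hs.1]⟩
    have h1 := dist_chart_le (S := S) (hmem s hs1) hv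
    have h2 := dist_chart_le (S := S) hw (hmem _ hs2)
    rw [dist_lineMap_left, Real.norm_of_nonneg hs.1.le] at h1
    rw [dist_right_lineMap, Real.norm_of_nonneg (by linarith [hs.1])] at h2
    have h3 := hz s hs
    have h4 := dist_triangle4 (S.chart C (AffineMap.lineMap v w s)) (S.chart C v) (S.chart C w)
      (S.chart C (AffineMap.lineMap v w (1 - s)))
    linarith
  have hlim : Filter.Tendsto (fun s : ℝ => (1 - 4 * s) * dist v w)
      (nhdsWithin 0 (Set.Ioi 0)) (nhds ((1 - 4 * 0) * dist v w)) := by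
    apply Filter.Tendsto.mono_left _ nhdsWithin_le_nhds
    exact Continuous.tendsto (by fun_prop) 0
  rw [mul_zero, sub_zero, one_mul] at hlim
  refine le_of_tendsto hlim ?_
  filter_upwards [Ioo_mem_nhdsGT (show (0 : ℝ) < 1 / 2 by norm_num)] with s hs using hbound s hs

end CubeComplex

/-! ### Parallel fibers -/

/-- The level `1/2`. -/
noncomputable def halfLevel : unitInterval := ⟨1 / 2, by norm_num, by norm_num⟩

@[simp] theorem coe_halfLevel : (halfLevel : ℝ) = 1 / 2 := rfl

theorem halfLevel_mem_Ioo : (halfLevel : ℝ) ∈ Set.Ioo (0 : ℝ) 1 := by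
  constructor <;> norm_num

@[simp] theorem symm_halfLevel : unitInterval.symm halfLevel = halfLevel := by
  ext; norm_num

/-- The triangle inequality in the Euclidean plane, by Cauchy–Schwarz. -/
theorem add_sq_add_add_sq_le {x₁ x₂ h₁ h₂ ℓ₁ ℓ₂ : ℝ} (hℓ₁ : 0 ≤ ℓ₁) (hℓ₂ : 0 ≤ ℓ₂)
    (H₁ : x₁ ^ 2 + h₁ ^ 2 ≤ ℓ₁ ^ 2) (H₂ : x₂ ^ 2 + h₂ ^ 2 ≤ ℓ₂ ^ 2) :
    (x₁ + x₂) ^ 2 + (h₁ + h₂) ^ 2 ≤ (ℓ₁ + ℓ₂) ^ 2 := by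
  have h : x₁ * x₂ + h₁ * h₂ ≤ ℓ₁ * ℓ₂ := by
    refine (abs_le_of_sq_le_sq' ?_ (mul_nonneg hℓ₁ hℓ₂)).2
    calc (x₁ * x₂ + h₁ * h₂) ^ 2
        ≤ (x₁ ^ 2 + h₁ ^ 2) * (x₂ ^ 2 + h₂ ^ 2) := by nlinarith [sq_nonneg (x₁ * h₂ - x₂ * h₁)]
      _ ≤ ℓ₁ ^ 2 * ℓ₂ ^ 2 := by gcongr
      _ = (ℓ₁ * ℓ₂) ^ 2 := by ring
  nlinarith

/-- Two vectors of length at most `ℓ` whose sum has length at least `2 ℓ` are equal. -/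
theorem eq_of_add_sq_add_add_sq_ge {x₁ x₂ h₁ h₂ ℓ : ℝ}
    (H₁ : x₁ ^ 2 + h₁ ^ 2 ≤ ℓ ^ 2) (H₂ : x₂ ^ 2 + h₂ ^ 2 ≤ ℓ ^ 2)
    (H : (2 * ℓ) ^ 2 ≤ (x₁ + x₂) ^ 2 + (h₁ + h₂) ^ 2) : x₁ = x₂ := by
  have : (x₁ - x₂) ^ 2 ≤ 0 := by nlinarith [sq_nonneg (h₁ - h₂)]
  have := pow_eq_zero_iff (n := 2) (by norm_num) |>.1 (le_antisymm this (sq_nonneg _))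
  linarith

section Hor

variable {X : Type*} [MetricSpace X]

/-- `φ` and `ψ` are at most as far apart as parallel unit segments in the plane with horizontal
distance `h`. -/
def Hor (φ ψ : unitInterval → X) (h : ℝ) : Prop :=
  0 ≤ h ∧ ∀ a b : unitInterval, dist (φ a) (ψ b) ≤ √(((a : ℝ) - b) ^ 2 + h ^ 2)

theorem Hor.symm {φ ψ : unitInterval → X} {h : ℝ} (H : Hor φ ψ h) : Hor ψ φ h := by
  refine ⟨H.1, fun a b => ?_⟩
  rw [dist_comm, show ((a : ℝ) - b) ^ 2 = ((b : ℝ) - a) ^ 2 by ring]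
  exact H.2 b a

theorem Hor.mono {φ ψ : unitInterval → X} {h h' : ℝ} (H : Hor φ ψ h) (hh : h ≤ h') :
    Hor φ ψ h' :=
  ⟨H.1.trans hh, fun a b => (H.2 a b).trans (Real.sqrt_le_sqrt (by nlinarith [H.1]))⟩

theorem Hor.dist_le {φ ψ : unitInterval → X} {h : ℝ} (H : Hor φ ψ h) (a : unitInterval) :
    dist (φ a) (ψ a) ≤ h := by
  have := H.2 a a
  rwa [sub_self, zero_pow two_ne_zero, zero_add, Real.sqrt_sq H.1] at this

theorem Hor.dist_sq_le {φ ψ : unitInterval → X} {h : ℝ} (H : Hor φ ψ h) (a b : unitInterval) :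
    dist (φ a) (ψ b) ^ 2 ≤ ((a : ℝ) - b) ^ 2 + h ^ 2 := by
  have := pow_le_pow_left₀ dist_nonneg (H.2 a b) 2
  rwa [Real.sq_sqrt (by positivity)] at this

theorem Hor.eq_of_zero {φ ψ : unitInterval → X} (H : Hor φ ψ 0) : φ = ψ :=
  funext fun a => dist_le_zero.1 (H.dist_le a)

theorem Hor.comp_symm {φ ψ : unitInterval → X} {h : ℝ} (H : Hor φ ψ h) :
    Hor (φ ∘ unitInterval.symm) (ψ ∘ unitInterval.symm) h := by
  refine ⟨H.1, fun a b => ?_⟩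
  have := H.2 (unitInterval.symm a) (unitInterval.symm b)
  rw [unitInterval.coe_symm_eq, unitInterval.coe_symm_eq] at this
  rwa [show ((a : ℝ) - b) ^ 2 = (1 - (a : ℝ) - (1 - b)) ^ 2 by ring]

/-- In the planar model, the straight segment from level `a` on the first line to level `b` on the
third crosses the middle line at level `(1 - s) * a + s * b` with `s = h₁ / (h₁ + h₂)`. Passing
through `ψ` at this level makes the two planar bounds add up exactly. -/
theorem Hor.trans {φ ψ χ : unitInterval → X} {h₁ h₂ : ℝ} (H₁ : Hor φ ψ h₁) (H₂ : Hor ψ χ h₂) :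
    Hor φ χ (h₁ + h₂) := by
  refine ⟨add_nonneg H₁.1 H₂.1, fun a b => ?_⟩
  rcases eq_or_lt_of_le (add_nonneg H₁.1 H₂.1) with h0 | h0
  · have e1 : h₁ = 0 := by linarith [H₁.1, H₂.1]
    have e2 : h₂ = 0 := by linarith [H₁.1, H₂.1]
    subst e1 e2
    rw [H₁.eq_of_zero]
    simpa using H₂.2 a b
  · set s := h₁ / (h₁ + h₂) with hs
    have hs0 : 0 ≤ s := div_nonneg H₁.1 h0.le
    have hs1 : s ≤ 1 := by rw [hs, div_le_one h0]; linarith [H₂.1]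
    have e1 : h₁ = s * (h₁ + h₂) := by rw [hs]; field_simp
    have e2 : h₂ = (1 - s) * (h₁ + h₂) := by linarith
    have hc : (1 - s) * (a : ℝ) + s * b ∈ Set.Icc (0 : ℝ) 1 :=
      ⟨by nlinarith [a.2.1, b.2.1], by nlinarith [a.2.2, b.2.2]⟩
    have d1 := H₁.2 a ⟨_, hc⟩
    have d2 := H₂.2 ⟨_, hc⟩ b
    set Q := √(((a : ℝ) - b) ^ 2 + (h₁ + h₂) ^ 2)
    have f1 : √(((a : ℝ) - ((1 - s) * (a : ℝ) + s * b)) ^ 2 + h₁ ^ 2) = s * Q := by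
      have : ((a : ℝ) - ((1 - s) * (a : ℝ) + s * b)) ^ 2 + h₁ ^ 2
          = s ^ 2 * (((a : ℝ) - b) ^ 2 + (h₁ + h₂) ^ 2) := by
        nth_rw 1 [e1]; ring
      rw [this, Real.sqrt_mul (sq_nonneg s), Real.sqrt_sq hs0]
    have f2 : √((((1 - s) * (a : ℝ) + s * b) - b) ^ 2 + h₂ ^ 2) = (1 - s) * Q := by
      have : (((1 - s) * (a : ℝ) + s * b) - b) ^ 2 + h₂ ^ 2
          = (1 - s) ^ 2 * (((a : ℝ) - b) ^ 2 + (h₁ + h₂) ^ 2) := by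
        nth_rw 1 [e2]; ring
      rw [this, Real.sqrt_mul (sq_nonneg _), Real.sqrt_sq (by linarith)]
    rw [f1] at d1
    rw [f2] at d2
    linarith [dist_triangle (φ a) (ψ ⟨_, hc⟩) (χ b)]

end Hor

namespace CubeComplex

variable {X : Type*} [MetricSpace X] {S : CubeComplex X}

theorem IsFiber.direction_unique {C : S.Cube} {i l : Fin (S.dim C)} {φ : unitInterval → X}
    (h : S.IsFiber ⟨C, i⟩ φ) (h' : S.IsFiber ⟨C, l⟩ φ) : i = l := by
  obtain ⟨w, hw, hwa⟩ := h.mem_cell halfLevel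
  obtain ⟨o, ho, H⟩ := h.exists_at hw hwa.symm
  obtain ⟨o', ho', H'⟩ := h'.exists_at hw hwa.symm
  by_contra hne
  have e := S.injOn C
    (setCoord_mem_unitCube hw i (flipLevel_mem_Icc (o := o) (0 : unitInterval).2))
    (setCoord_mem_unitCube hw l (flipLevel_mem_Icc (o := o') (0 : unitInterval).2))
    ((H 0).symm.trans (H' 0))
  have e' := congrArg (fun v : EuclideanSpace ℝ (Fin (S.dim C)) => v i) e
  simp only [setCoord_same, setCoord_ne w hne] at e'
  rw [ho, coe_halfLevel, flipLevel_half] at e'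
  cases o <;> norm_num at e'

/-- Fibers of the same cube in the same direction and with the same orientation. -/
theorem hor_chart {C : S.Cube} {v w : EuclideanSpace ℝ (Fin (S.dim C))}
    (hv : v ∈ unitCube (S.dim C)) (hw : w ∈ unitCube (S.dim C)) (i : Fin (S.dim C)) (o : Bool) :
    Hor (fun a : unitInterval => S.chart C (setCoord v i (flipLevel o a)))
      (fun a : unitInterval => S.chart C (setCoord w i (flipLevel o a)))
      (√(dist v w ^ 2 - (v i - w i) ^ 2)) := by
  refine ⟨Real.sqrt_nonneg _, fun a b => ?_⟩
  rw [Real.sq_sqrt (sub_nonneg.2 (sq_sub_le_dist_sq v w i)), ← flipLevel_sub_sq o a b,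
    ← dist_setCoord_sq, Real.sqrt_sq dist_nonneg]
  exact dist_chart_le (setCoord_mem_unitCube hv i (flipLevel_mem_Icc a.2))
    (setCoord_mem_unitCube hw i (flipLevel_mem_Icc b.2))

theorem IsFiber.hor_refl {m : Σ C : S.Cube, Fin (S.dim C)} {φ : unitInterval → X}
    (h : S.IsFiber m φ) : Hor φ φ 0 := by
  obtain ⟨v, hv, o, h⟩ := h
  have := hor_chart hv hv m.2 o
  rw [← funext h] at this
  simpa using this

/-- All fibers of `C` in direction `i` become fibers of `D` in one common direction, which the
shared fiber `φ` identifies as `l`. Their midpoints make up the midcube. -/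
theorem midcube_subset_of_isFiber {C D : S.Cube} {i : Fin (S.dim C)} {l : Fin (S.dim D)}
    {φ : unitInterval → X} (h : S.IsFiber ⟨C, i⟩ φ) (h' : S.IsFiber ⟨D, l⟩ φ)
    (hCD : S.cell C ⊆ S.cell D) : S.midcube ⟨C, i⟩ ⊆ S.midcube ⟨D, l⟩ := by
  obtain ⟨l', hl'⟩ := h.transfer_all halfLevel_mem_Ioo (hCD (h.mem_cell _))
  have : l' = l :=
    (hl' φ halfLevel h halfLevel_mem_Ioo (hCD (h.mem_cell _))).direction_unique h'
  subst this
  rintro x ⟨w, ⟨hw, hwi⟩, rfl⟩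
  have hf := isFiber_chart hw i false
  have hf' := hl' _ halfLevel hf halfLevel_mem_Ioo (hCD (hf.mem_cell _))
  have hx : S.chart C w = S.chart C (setCoord w i (flipLevel false halfLevel)) := by
    rw [flipLevel_false, coe_halfLevel, ← hwi, setCoord_self]
  obtain ⟨u, hu, huw⟩ := hCD (S.chart_mem_cell hw)
  obtain ⟨o, ho, -⟩ := hf'.exists_at (a := halfLevel) hu (hx.symm.trans huw.symm)
  exact ⟨u, ⟨hu, by rw [ho, coe_halfLevel, flipLevel_half]⟩, huw⟩

theorem SameWall.of_subset {m m' : Σ C : S.Cube, Fin (S.dim C)}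
    (h : S.midcube m ⊆ S.midcube m') : S.SameWall m m' :=
  Relation.EqvGen.rel (r := fun m m' => S.midcube m ⊆ S.midcube m') m m' h

theorem SameWall.refl (m : Σ C : S.Cube, Fin (S.dim C)) : S.SameWall m m :=
  Relation.EqvGen.refl m

theorem SameWall.symm {m m' : Σ C : S.Cube, Fin (S.dim C)} (h : S.SameWall m m') :
    S.SameWall m' m :=
  Relation.EqvGen.symm _ _ h

theorem SameWall.trans {m m' m'' : Σ C : S.Cube, Fin (S.dim C)} (h : S.SameWall m m')
    (h' : S.SameWall m' m'') : S.SameWall m m'' :=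
  Relation.EqvGen.trans _ _ _ h h'

/-- The intersection of two cubes is a cube. -/
theorem exists_cell_eq_inter {C D : S.Cube} (hne : (S.cell C ∩ S.cell D).Nonempty) :
    ∃ E, S.cell E = S.cell C ∩ S.cell D := by
  obtain ⟨σ, τ, F, hF, hsurj, hd, hglue⟩ := S.exists_glue_map C D hne
  obtain ⟨E, hE⟩ := S.face_mem C σ
  refine ⟨E, Set.Subset.antisymm ?_ ?_⟩
  · rw [cell, hE]
    rintro _ ⟨v, hv, rfl⟩
    exact ⟨⟨v, hv.1, rfl⟩, F v, (hF hv).1, ((hglue v hv.1 _ (hF hv).1).2 ⟨hv, rfl⟩).symm⟩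
  · rintro p ⟨⟨v, hv, hv'⟩, ⟨w, hw, hw'⟩⟩
    rw [cell, hE]
    exact ⟨v, ((hglue v hv w hw).1 (hv'.trans hw'.symm)).1, hv'⟩

/-- The fiber is also a fiber of the cube in which `C` and `D` intersect, and the corresponding
midcube is contained in both midcubes. -/
theorem sameWall_of_isFiber {m m' : Σ C : S.Cube, Fin (S.dim C)} {φ : unitInterval → X}
    (h : S.IsFiber m φ) (h' : S.IsFiber m' φ) : S.SameWall m m' := by
  obtain ⟨C, i⟩ := m
  obtain ⟨D, l⟩ := m'
  have hφ : φ halfLevel ∈ S.cell C ∩ S.cell D := ⟨h.mem_cell _, h'.mem_cell _⟩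
  obtain ⟨E, hE⟩ := exists_cell_eq_inter ⟨_, hφ⟩
  obtain ⟨j, hj⟩ := h.transfer halfLevel_mem_Ioo (hE ▸ hφ)
  exact (SameWall.of_subset (midcube_subset_of_isFiber hj h (hE ▸ Set.inter_subset_left))).symm.trans
    (SameWall.of_subset (midcube_subset_of_isFiber hj h' (hE ▸ Set.inter_subset_right)))

/-- A fiber belonging to the wall of the midcube `m`. -/
def InWall (m : Σ C : S.Cube, Fin (S.dim C)) (φ : unitInterval → X) : Prop :=
  ∃ m', S.SameWall m m' ∧ S.IsFiber m' φ

theorem InWall.symm {m : Σ C : S.Cube, Fin (S.dim C)} {φ : unitInterval → X}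
    (h : S.InWall m φ) : S.InWall m (φ ∘ unitInterval.symm) :=
  let ⟨m', hm, h⟩ := h
  ⟨m', hm, h.symm⟩

theorem InWall.sameWall {m m' : Σ C : S.Cube, Fin (S.dim C)} {φ : unitInterval → X}
    (h : S.InWall m φ) (h' : S.IsFiber m' φ) : S.SameWall m m' :=
  let ⟨_, hm, h⟩ := h
  hm.trans (sameWall_of_isFiber h h')

/-- Fibers can be transported along short strings. -/
theorem exists_lift_of_string {m : Σ C : S.Cube, Fin (S.dim C)} {x z : X} {ℓ : ℝ}
    (h : StringLength S.dim S.chart x z ℓ) :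
    ∀ (φ : unitInterval → X) (a : unitInterval), S.InWall m φ → φ a = x → ℓ < a → ℓ < 1 - a →
      0 ≤ ℓ ∧ ∃ (ψ : unitInterval → X) (b : unitInterval) (r : ℝ), S.InWall m ψ ∧ ψ b = z ∧
        Hor φ ψ r ∧ ((a : ℝ) - b) ^ 2 + r ^ 2 ≤ ℓ ^ 2 := by
  have hnn : ∀ {x y : X} {ℓ : ℝ}, StringLength S.dim S.chart x y ℓ → 0 ≤ ℓ := by
    intro x y ℓ h
    induction h with
    | refl => exact le_rfl
    | step C v w y ℓ hv hw h ih => positivity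
  induction h with
  | refl x =>
    rintro φ a ⟨m', hm', hφ⟩ ha - -
    exact ⟨le_rfl, φ, a, 0, ⟨m', hm', hφ⟩, ha, hφ.hor_refl, by simp⟩
  | step C v w z ℓ hv hw hs ih =>
    intro φ a hφ ha hlt hlt'
    have hℓ := hnn hs
    have hvw := dist_nonneg (x := v) (y := w)
    refine ⟨by positivity, ?_⟩
    -- The string is too short to reach an end of the fiber. Hence the fiber transfers to `C`, and
    -- the level after this step still leaves room for the rest of the string.
    have ha0 : (a : ℝ) ∈ Set.Ioo (0 : ℝ) 1 := ⟨by linarith, by linarith⟩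
    have hφ0 := hφ
    obtain ⟨m', hm', hφ⟩ := hφ
    obtain ⟨l, hl⟩ := hφ.transfer ha0 (D := C) (by rw [ha]; exact S.chart_mem_cell hv)
    obtain ⟨o, ho, H⟩ := hl.exists_at hv ha
    have hψ := isFiber_chart hw l o
    have hbmem := flipLevel_mem_Icc (o := o) (hw l)
    set b : unitInterval := ⟨flipLevel o (w l), hbmem⟩ with hb
    have hab : ((a : ℝ) - b) ^ 2 = (v l - w l) ^ 2 := by
      rw [ho, ← flipLevel_sub_sq o]; simp [hb]
    have habs : |(a : ℝ) - b| ≤ dist v w :=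
      (sq_eq_sq_iff_abs_eq_abs _ _).1 hab ▸ abs_sub_le_dist v w l
    rw [abs_le] at habs
    have hbz : S.chart C (setCoord w l (flipLevel o b)) = S.chart C w := by
      simp [hb]
    obtain ⟨-, ψ, c, r, hψw, hc, hr, hsq⟩ := ih _ b
      ⟨_, hφ0.sameWall hl, hψ⟩ hbz (by linarith [habs.1, habs.2]) (by linarith [habs.1, habs.2])
    have hor := hor_chart hv hw l o
    rw [← funext H] at hor
    refine ⟨ψ, c, _, hψw, hc, hor.trans hr, ?_⟩
    have := add_sq_add_add_sq_le (x₁ := (a : ℝ) - b) (x₂ := (b : ℝ) - c)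
      (h₁ := √(dist v w ^ 2 - (v l - w l) ^ 2)) (h₂ := r) hvw hℓ
      (by rw [hab, Real.sq_sqrt (sub_nonneg.2 (sq_sub_le_dist_sq v w l))]; linarith) hsq
    simpa using this

/-- Two fibers through a point that are close to each other coincide. -/
theorem IsFiber.eq_of_dist_lt (hX : IsCAT0 X) {m m' : Σ C : S.Cube, Fin (S.dim C)}
    {φ ψ : unitInterval → X} (hφ : S.IsFiber m φ) (hψ : S.IsFiber m' ψ) {a b : unitInterval}
    (hb : (b : ℝ) ∈ Set.Ioo (0 : ℝ) 1) (hab : φ a = ψ b)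
    (h : ∀ c, dist (φ c) (ψ c) < 1 / 2) : φ = ψ := by
  obtain ⟨C, i⟩ := m
  obtain ⟨w, hw, hwa⟩ := hφ.mem_cell a
  obtain ⟨l, hl⟩ := hψ.transfer hb (D := C) (by rw [← hab]; exact hφ.mem_cell a)
  obtain ⟨o, ho, H⟩ := hφ.exists_at hw hwa.symm
  obtain ⟨o', ho', H'⟩ := hl.exists_at hw (hab ▸ hwa.symm)
  have hmem : ∀ (j : Fin (S.dim C)) (o : Bool) (c : unitInterval),
      setCoord w j (flipLevel o c) ∈ unitCube (S.dim C) := fun j o c =>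
    setCoord_mem_unitCube hw j (flipLevel_mem_Icc c.2)
  by_cases hil : i = l
  · subst hil
    have hoo : o = o' := by
      by_contra hne
      have h0 := h 0
      rw [H, H', dist_chart_eq hX (hmem _ _ _) (hmem _ _ _), dist_setCoord_setCoord] at h0
      cases o <;> cases o' <;> first | exact hne rfl | norm_num at h0
    subst hoo
    exact funext fun c => (H c).trans (H' c).symm
  -- For different directions, `φ c` is at least as far from `ψ c` as level `c` is from level `a`.
  -- Both ends `c = 0` and `c = 1` would then be closer than `1 / 2` to `a`.
  · exfalso
    have hc : ∀ c : unitInterval, ((c : ℝ) - a) ^ 2 < 1 / 4 := fun c => by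
      have h0 := h c
      rw [H, H', dist_chart_eq hX (hmem _ _ _) (hmem _ _ _)] at h0
      have h1 := dist_setCoord_ne_sq w hil (flipLevel o c) (flipLevel o' c)
      rw [ho, flipLevel_sub_sq] at h1
      have h2 : dist (setCoord w i (flipLevel o c)) (setCoord w l (flipLevel o' c)) ^ 2
          < (1 / 2) ^ 2 := pow_lt_pow_left₀ h0 dist_nonneg two_ne_zero
      nlinarith [sq_nonneg (w l - flipLevel o' c)]
    have h0 := hc 0
    have h1 := hc 1
    simp only [Set.Icc.coe_zero, Set.Icc.coe_one] at h0 h1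
    nlinarith

theorem eq_of_hor (hX : IsCAT0 X) {m m' : Σ C : S.Cube, Fin (S.dim C)}
    {φ ψ ψ' : unitInterval → X} (hψ : S.IsFiber m ψ) (hψ' : S.IsFiber m' ψ') {b b' : unitInterval}
    (hb' : (b' : ℝ) ∈ Set.Ioo (0 : ℝ) 1) (hbb' : ψ b = ψ' b') {h h' : ℝ}
    (H : Hor φ ψ h) (H' : Hor φ ψ' h') (hlt : h + h' < 1 / 2) : ψ = ψ' :=
  hψ.eq_of_dist_lt hX hψ' hb' hbb' fun c => ((H.symm.trans H').dist_le c).trans_lt hlt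

theorem IsFiber.injective {m : Σ C : S.Cube, Fin (S.dim C)} {φ : unitInterval → X}
    (h : S.IsFiber m φ) : Function.Injective φ := by
  obtain ⟨v, hv, o, h⟩ := h
  intro a b hab
  rw [h, h] at hab
  have := S.injOn _ (setCoord_mem_unitCube hv _ (flipLevel_mem_Icc a.2))
    (setCoord_mem_unitCube hv _ (flipLevel_mem_Icc b.2)) hab
  have e := congrArg (fun v : EuclideanSpace ℝ (Fin (S.dim m.1)) => v m.2) this
  simp only [setCoord_same] at e
  have := congrArg (flipLevel o) e
  simp only [flipLevel_flipLevel] at this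
  exact Subtype.ext this

/-- Points close to an interior point of a fiber lie on fibers parallel to it. -/
theorem exists_lift (hX : IsCAT0 X) {m : Σ C : S.Cube, Fin (S.dim C)} {φ : unitInterval → X}
    (hφ : S.InWall m φ) {a : unitInterval} (ha : (a : ℝ) ∈ Set.Icc (1 / 4 : ℝ) (3 / 4)) {z : X}
    (hz : dist (φ a) z < 1 / 16) :
    ∃ (ψ : unitInterval → X) (b : unitInterval) (r : ℝ), S.InWall m ψ ∧ ψ b = z ∧
      Hor φ ψ r ∧ ((a : ℝ) - b) ^ 2 + r ^ 2 ≤ dist (φ a) z ^ 2 := by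
  set d := dist (φ a) z with hd
  have hd0 : 0 ≤ d := dist_nonneg
  have hglb := S.dist_isGLB (φ a) z
  have key : ∀ r > d, r ≤ 1 / 16 → ∃ (ψ : unitInterval → X) (b : unitInterval) (h : ℝ),
      S.InWall m ψ ∧ ψ b = z ∧ Hor φ ψ h ∧ ((a : ℝ) - b) ^ 2 + h ^ 2 ≤ r ^ 2 := by
    intro r hr hr'
    obtain ⟨ℓ, hℓ, -, hlt⟩ := hglb.exists_between hr
    obtain ⟨h0, ψ, b, h, h1, h2, h3, h4⟩ := exists_lift_of_string hℓ φ a hφ rfl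
      (by linarith [ha.1]) (by linarith [ha.2])
    exact ⟨ψ, b, h, h1, h2, h3, h4.trans (pow_le_pow_left₀ h0 hlt.le 2)⟩
  obtain ⟨ψ, b, h, h1, h2, h3, h4⟩ := key (1 / 16) hz le_rfl
  have hh : h ≤ 1 / 16 := (abs_le_of_sq_le_sq' (by nlinarith [sq_nonneg ((a : ℝ) - b)])
    (by norm_num)).2
  -- Two lifts obtained from different strings are within `1 / 8 < 1 / 2` of each other, so they are
  -- the same fiber and the same level. Only the horizontal bound improves as the string length
  -- tends to `d`.
  have key2 : ∀ r > d, r ≤ 1 / 16 → ∃ h', Hor φ ψ h' ∧ ((a : ℝ) - b) ^ 2 + h' ^ 2 ≤ r ^ 2 := by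
    intro r hr hr'
    obtain ⟨ψ', b', h', h1', h2', h3', h4'⟩ := key r hr hr'
    have hr0 : 0 < r := by linarith
    have hrr : r ^ 2 ≤ (1 / 16) ^ 2 := pow_le_pow_left₀ hr0.le hr' 2
    have hh' : h' ≤ 1 / 16 := (abs_le_of_sq_le_sq' (by nlinarith [sq_nonneg ((a : ℝ) - b')])
      (by norm_num)).2
    have hbb := abs_le_of_sq_le_sq' (show ((a : ℝ) - b') ^ 2 ≤ (1 / 16) ^ 2 by
      nlinarith [sq_nonneg h']) (by norm_num)
    obtain ⟨m₁, -, hf⟩ := h1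
    obtain ⟨m₂, -, hf'⟩ := h1'
    have e : ψ = ψ' := eq_of_hor hX hf hf' (b := b) (b' := b')
      ⟨by linarith [ha.1], by linarith [ha.2]⟩ (h2.trans h2'.symm) h3 h3' (by linarith)
    subst e
    have : b = b' := hf.injective (h2.trans h2'.symm)
    subst this
    exact ⟨h', h3', h4'⟩
  have hnn : ((a : ℝ) - b) ^ 2 ≤ d ^ 2 := by
    have hlim : Filter.Tendsto (fun r : ℝ => r ^ 2) (nhdsWithin d (Set.Ioi d)) (nhds (d ^ 2)) :=
      (Continuous.tendsto (by fun_prop) d).mono_left nhdsWithin_le_nhds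
    refine ge_of_tendsto hlim ?_
    filter_upwards [Ioo_mem_nhdsGT hz] with r hr
    obtain ⟨h', -, h''⟩ := key2 r hr.1 hr.2.le
    nlinarith [sq_nonneg h']
  refine ⟨ψ, b, √(d ^ 2 - ((a : ℝ) - b) ^ 2), h1, h2, ⟨Real.sqrt_nonneg _, fun c e => ?_⟩, ?_⟩
  · rw [Real.sq_sqrt (by linarith)]
    have hlim : Filter.Tendsto (fun r : ℝ => √(((c : ℝ) - e) ^ 2 + (r ^ 2 - ((a : ℝ) - b) ^ 2)))
        (nhdsWithin d (Set.Ioi d)) (nhds √(((c : ℝ) - e) ^ 2 + (d ^ 2 - ((a : ℝ) - b) ^ 2))) :=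
      (Continuous.tendsto (by fun_prop) d).mono_left nhdsWithin_le_nhds
    refine ge_of_tendsto hlim ?_
    filter_upwards [Ioo_mem_nhdsGT hz] with r hr
    obtain ⟨h', hor, h''⟩ := key2 r hr.1 hr.2.le
    exact (hor.2 c e).trans (Real.sqrt_le_sqrt (by linarith))
  · rw [Real.sq_sqrt (by linarith)]; linarith

end CubeComplex

/-! ### Walls are convex and do not cross themselves -/

/-- The steps bound both partial distances by their proportional shares of the total, and the
triangle inequality leaves no slack. -/
theorem isGeodPoint_of_chain {X : Type*} [MetricSpace X] {z : ℕ → X} {n : ℕ} (hn : 0 < n)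
    (h : ∀ k < n, dist (z k) (z (k + 1)) ≤ dist (z 0) (z n) / n) {k : ℕ} (hk : k ≤ n) :
    IsGeodPoint ((k : ℝ) / n) (z 0) (z n) (z k) := by
  have hn' : (0 : ℝ) < n := by exact_mod_cast hn
  have h1 : dist (z 0) (z k) ≤ (k : ℝ) / n * dist (z 0) (z n) := by
    refine (dist_le_Ico_sum_of_dist_le (f := z) (d := fun _ => dist (z 0) (z n) / n) (Nat.zero_le k)
      (fun _ hj => h _ (hj.trans_le hk))).trans (le_of_eq ?_)
    simp; ring
  have h2 : dist (z k) (z n) ≤ (1 - (k : ℝ) / n) * dist (z 0) (z n) := by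
    refine (dist_le_Ico_sum_of_dist_le (f := z) (d := fun _ => dist (z 0) (z n) / n) hk
      (fun _ hj => h _ hj)).trans (le_of_eq ?_)
    simp [Nat.cast_sub hk]; field_simp
  have h3 := dist_triangle (z 0) (z k) (z n)
  exact ⟨by linarith, by linarith⟩

/-- Used for the levels at which a geodesic crosses successive fibers: equal increments between
equal end values must vanish. -/
theorem eq_of_arithmetic {b : ℕ → ℝ} {c : ℝ} {n : ℕ} (hn : 0 < n) (h0 : b 0 = c) (h1 : b n = c)
    (h : ∀ k, k + 2 ≤ n → b k - b (k + 1) = b (k + 1) - b (k + 2)) {k : ℕ} (hk : k ≤ n) :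
    b k = c := by
  have key : ∀ k, k + 1 ≤ n → b k = b 0 + k * (b 1 - b 0) ∧
      b (k + 1) = b 0 + (k + 1 : ℕ) * (b 1 - b 0) := by
    intro k
    induction k with
    | zero => intro _; constructor <;> simp
    | succ k ih =>
      intro hk
      obtain ⟨e1, e2⟩ := ih (by omega)
      refine ⟨e2, ?_⟩
      have := h k hk
      push_cast at e2 ⊢
      rw [show k + 1 + 1 = k + 2 from rfl]
      linarith
  obtain ⟨j, rfl⟩ : ∃ j, n = j + 1 := ⟨n - 1, by omega⟩
  have hj := (key j le_rfl).2
  have hj' : b 1 - b 0 = 0 := by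
    have : ((j + 1 : ℕ) : ℝ) * (b 1 - b 0) = 0 := by linarith
    rcases mul_eq_zero.1 this with h | h
    · exact absurd h (by positivity)
    · exact h
  rcases Nat.lt_or_ge k (j + 1) with hlt | hge
  · rw [(key k hlt).1, hj', h0]; ring
  · rw [le_antisymm hk hge, h1]

namespace CubeComplex

variable {X : Type*} [MetricSpace X] {S : CubeComplex X}

/-- The fibers `φ`, `ψ` of the wall of `m` bound a flat strip subdivided by `n - 1` further
fibers. -/
def Strip (m : Σ C : S.Cube, Fin (S.dim C)) (n : ℕ) (φ ψ : unitInterval → X) : Prop :=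
  ∃ f : ℕ → unitInterval → X, f 0 = φ ∧ f n = ψ ∧ (∀ k ≤ n, S.InWall m (f k)) ∧
    ∀ k < n, Hor (f k) (f (k + 1)) (dist (φ halfLevel) (ψ halfLevel) / n)

theorem Strip.refl {m : Σ C : S.Cube, Fin (S.dim C)} (n : ℕ) {φ : unitInterval → X}
    (h : S.InWall m φ) : S.Strip m n φ φ := by
  refine ⟨fun _ => φ, rfl, rfl, fun _ _ => h, fun k _ => ?_⟩
  obtain ⟨m', -, h⟩ := h
  simpa using h.hor_refl

/-- Subdivide the geodesic from the midpoint of `φ` to that of `ψ'`. Comparison puts its points `z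
k` close to the midpoints of the old fibers `f k`, so each `z k` lies on a unique nearby fiber `χ
k`, at some level `b k`. Between consecutive fibers the displacement is bounded by a planar vector
of length at most `ℓ`, while `z k` and `z (k + 2)` are `2 * ℓ` apart. Equality in the planar
triangle inequality makes the levels an arithmetic progression. It starts and ends at `1 / 2`, so
all levels are `1 / 2` and the fibers `χ k` form the new strip. -/
theorem Strip.extend (hX : IsCAT0 X) {m : Σ C : S.Cube, Fin (S.dim C)} {n : ℕ} (hn : 0 < n)
    {φ ψ ψ' : unitInterval → X} (hs : S.Strip m n φ ψ) (hψ' : S.InWall m ψ') {h : ℝ}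
    (hor : Hor ψ ψ' h) (hh : h < 1 / 32)
    (hL : dist (φ halfLevel) (ψ halfLevel) / n < 1 / 32)
    (hL' : dist (φ halfLevel) (ψ' halfLevel) / n < 1 / 32) : S.Strip m n φ ψ' := by
  obtain ⟨f, rfl, rfl, hfw, hf⟩ := hs
  have hn' : (0 : ℝ) < n := by exact_mod_cast hn
  set L := dist (f 0 halfLevel) (f n halfLevel) / n
  set ℓ := dist (f 0 halfLevel) (ψ' halfLevel) / n with hℓ
  have hI : ∀ k ≤ n, (k : ℝ) / n ∈ Set.Icc (0 : ℝ) 1 := fun j hj =>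
    ⟨by positivity, by rw [div_le_one hn']; exact_mod_cast hj⟩
  have hgp : ∀ k ≤ n, IsGeodPoint ((k : ℝ) / n) (f 0 halfLevel) (f n halfLevel) (f k halfLevel) :=
    fun k hk => isGeodPoint_of_chain (z := fun k => f k halfLevel) hn
      (fun k hk => (hf k hk).dist_le _) hk
  obtain ⟨γ, hγ0, hγ1, hγ⟩ := hX.1.exists_path (f 0 halfLevel) (ψ' halfLevel)
  set z : ℕ → X := fun k => γ ((k : ℝ) / n)
  have hz0 : z 0 = f 0 halfLevel := by simp [z, hγ0]
  have hzn : z n = ψ' halfLevel := by simp [z, div_self hn'.ne', hγ1]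
  have hzd : ∀ k ≤ n, ∀ l ≤ n, dist (z k) (z l) = |(k : ℝ) - l| * ℓ := fun k hk l hl => by
    simp only [z]
    rw [hγ _ (hI k hk) _ (hI l hl), ← sub_div, abs_div, abs_of_pos hn', hℓ]; ring
  have hfz : ∀ k ≤ n, dist (f k halfLevel) (z k) ≤ h := fun k hk => by
    have := hX.dist_le_of_common_left (hI k hk) (hgp k hk)
      (isGeodPoint_of_path hγ0 hγ1 hγ (hI k hk))
    refine this.trans ((mul_le_of_le_one_left dist_nonneg (hI k hk).2).trans (hor.dist_le _))
  have hlift : ∀ k, ∃ (χ : unitInterval → X) (b : unitInterval) (r : ℝ), k ≤ n →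
      S.InWall m χ ∧ χ b = z k ∧ Hor (f k) χ r ∧ (1 / 2 - (b : ℝ)) ^ 2 + r ^ 2 ≤ (1 / 32) ^ 2 := by
    intro k
    by_cases hk : k ≤ n
    · obtain ⟨χ, b, r, h1, h2, h3, h4⟩ := exists_lift hX (hfw k hk) (a := halfLevel)
        (by constructor <;> norm_num) (z := z k) (by linarith [hfz k hk])
      refine ⟨χ, b, r, fun _ => ⟨h1, h2, h3, h4.trans ?_⟩⟩
      exact pow_le_pow_left₀ dist_nonneg ((hfz k hk).trans hh.le) 2
    · exact ⟨f 0, 0, 0, fun h => absurd h hk⟩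
  choose χ b r hχ using hlift
  have hr : ∀ k ≤ n, r k ≤ 1 / 32 := fun k hk =>
    (abs_le_of_sq_le_sq' (by nlinarith [(hχ k hk).2.2.2, sq_nonneg (1 / 2 - (b k : ℝ))])
      (by norm_num)).2
  have hb : ∀ k ≤ n, |1 / 2 - (b k : ℝ)| ≤ 1 / 32 := fun k hk =>
    abs_le_of_sq_le_sq (by nlinarith [(hχ k hk).2.2.2, sq_nonneg (r k)]) (by norm_num)
  have hb1 : ∀ k ≤ n, (b k : ℝ) ∈ Set.Icc (1 / 4 : ℝ) (3 / 4) := fun k hk => by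
    have := abs_le.1 (hb k hk)
    constructor <;> linarith [this.1, this.2]
  have hb2 : ∀ k ≤ n, (b k : ℝ) ∈ Set.Ioo (0 : ℝ) 1 := fun k hk => by
    have := hb1 k hk
    constructor <;> linarith [this.1, this.2]
  -- Fibers through `z k` with horizontal distances below `1 / 4` and at most `1 / 32` from `f k`
  -- are less than `1 / 2` apart, hence equal. This identifies lifts reached along different routes.
  have huniq : ∀ k ≤ n, ∀ (χ' : unitInterval → X) (b' : unitInterval) (r' : ℝ),
      S.InWall m χ' → χ' b' = z k → Hor (f k) χ' r' → r' < 1 / 4 → χ' = χ k ∧ b' = b k := by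
    intro k hk χ' b' r' h1 h2 h3 h4
    obtain ⟨⟨m₁, -, hf₁⟩, h2', h3', -⟩ := hχ k hk
    obtain ⟨m₂, -, hf₂⟩ := h1
    have e := eq_of_hor hX hf₂ hf₁ (hb2 k hk) (h2.trans h2'.symm) h3 h3' (by linarith [hr k hk])
    subst e
    exact ⟨rfl, hf₂.injective (h2.trans h2'.symm)⟩
  have h0 : f 0 = χ 0 ∧ halfLevel = b 0 := by
    have hw := hfw 0 (Nat.zero_le _)
    obtain ⟨m₁, -, hf₁⟩ := id hw
    exact huniq 0 (Nat.zero_le _) _ _ 0 hw hz0.symm hf₁.hor_refl (by norm_num)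
  have hlast : ψ' = χ n ∧ halfLevel = b n :=
    huniq n le_rfl _ _ h hψ' hzn.symm hor (by linarith)
  have hstep : ∀ k < n, ∃ s, Hor (χ k) (χ (k + 1)) s ∧
      ((b k : ℝ) - b (k + 1)) ^ 2 + s ^ 2 ≤ ℓ ^ 2 := by
    intro k hk
    obtain ⟨h1, h2, h3, -⟩ := hχ k hk.le
    have hd : dist (z k) (z (k + 1)) = ℓ := by
      rw [hzd k hk.le (k + 1) hk]; push_cast; simp
    have hℓ0 : 0 ≤ ℓ := hd ▸ dist_nonneg
    obtain ⟨χ', b', s, h1', h2', h3', h4'⟩ := exists_lift hX h1 (hb1 k hk.le) (z := z (k + 1))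
      (by rw [h2, hd]; linarith)
    rw [h2, hd] at h4'
    have hs : s ≤ 1 / 32 := by
      have := (abs_le_of_sq_le_sq' (show s ^ 2 ≤ ℓ ^ 2 by
        nlinarith [sq_nonneg ((b k : ℝ) - b')]) hℓ0).2
      linarith
    obtain ⟨e1, e2⟩ := huniq (k + 1) hk χ' b' _ h1' h2' (((hf k hk).symm.trans h3).trans h3')
      (by linarith [hr k hk.le])
    subst e1 e2
    exact ⟨s, h3', h4'⟩
  have hbhalf : ∀ k ≤ n, (b k : ℝ) = 1 / 2 := by
    intro k hk
    refine eq_of_arithmetic (b := fun k => (b k : ℝ)) hn (by rw [← h0.2]; rfl)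
      (by rw [← hlast.2]; rfl) (fun j hj => ?_) hk
    obtain ⟨s, hs1, hs2⟩ := hstep j (by omega)
    obtain ⟨s', hs1', hs2'⟩ := hstep (j + 1) (by omega)
    have hd := (hs1.trans hs1').dist_sq_le (b j) (b (j + 1 + 1))
    rw [(hχ j (by omega)).2.1, (hχ (j + 1 + 1) hj).2.1, hzd j (by omega) (j + 1 + 1) hj] at hd
    refine eq_of_add_sq_add_add_sq_ge hs2 hs2' ?_
    have e : |(j : ℝ) - ((j + 1 + 1 : ℕ) : ℝ)| = 2 := by
      push_cast
      rw [show (j : ℝ) - (j + 1 + 1) = -2 by ring]; norm_num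
    rw [e] at hd
    calc (2 * ℓ) ^ 2 ≤ _ := hd
      _ = _ := by ring
  refine ⟨χ, h0.1.symm, hlast.1.symm, fun k hk => (hχ k hk).1, fun k hk => ?_⟩
  obtain ⟨s, hs1, hs2⟩ := hstep k hk
  refine hs1.mono (abs_le_of_sq_le_sq' ?_ (by positivity)).2
  nlinarith [sq_nonneg ((b k : ℝ) - b (k + 1))]

/-- Two fibers of the wall of `m` that are close to each other. -/
def NearFibers (m : Σ C : S.Cube, Fin (S.dim C)) (φ ψ : unitInterval → X) : Prop :=
  S.InWall m φ ∧ S.InWall m ψ ∧ ∃ h < 1 / 32, Hor φ ψ h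

/-- Induction along the chain. Each extension needs spacing below `1 / 32` for both the old and the
new end, hence the claim for all sufficiently large `n`. -/
theorem exists_strip (hX : IsCAT0 X) {m : Σ C : S.Cube, Fin (S.dim C)} {φ ψ : unitInterval → X}
    (hφ : S.InWall m φ) (h : Relation.ReflTransGen (S.NearFibers m) φ ψ) :
    ∃ N, ∀ n ≥ N, S.Strip m n φ ψ := by
  induction h with
  | refl => exact ⟨0, fun n _ => Strip.refl n hφ⟩
  | @tail ψ ψ' _ hn ih =>
    obtain ⟨N, hN⟩ := ih
    obtain ⟨-, hψ', h, hh, hor⟩ := hn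
    have key : ∀ D : ℝ, ∃ N : ℕ, ∀ n ≥ N, D / n < 1 / 32 := by
      intro D
      have := tendsto_const_div_atTop_nhds_zero_nat D
      have := this.eventually (gt_mem_nhds (show (0 : ℝ) < 1 / 32 by norm_num))
      exact Filter.eventually_atTop.1 this
    obtain ⟨N₁, h₁⟩ := key (dist (φ halfLevel) (ψ halfLevel))
    obtain ⟨N₂, h₂⟩ := key (dist (φ halfLevel) (ψ' halfLevel))
    refine ⟨max (max N 1) (max N₁ N₂), fun n hn => ?_⟩
    simp only [ge_iff_le, max_le_iff] at hn
    exact (hN n hn.1.1).extend hX (by omega) hψ' hor hh (h₁ n hn.2.1) (h₂ n hn.2.2)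

theorem NearFibers.symm {m : Σ C : S.Cube, Fin (S.dim C)} {φ ψ : unitInterval → X}
    (h : S.NearFibers m φ ψ) : S.NearFibers m ψ φ :=
  let ⟨h1, h2, r, hr, hor⟩ := h
  ⟨h2, h1, r, hr, hor.symm⟩

theorem comp_symm_comp_symm {Y : Type*} (φ : unitInterval → Y) :
    (φ ∘ unitInterval.symm) ∘ unitInterval.symm = φ := by
  funext a; simp

/-- The fibers `φ` and `ψ`, up to orientation, are joined by a chain of close fibers. -/
def Chained (m : Σ C : S.Cube, Fin (S.dim C)) (φ ψ : unitInterval → X) : Prop :=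
  Relation.ReflTransGen (S.NearFibers m) φ ψ ∨
    Relation.ReflTransGen (S.NearFibers m) φ (ψ ∘ unitInterval.symm)

theorem chain_comp_symm {m : Σ C : S.Cube, Fin (S.dim C)} {φ ψ : unitInterval → X}
    (h : Relation.ReflTransGen (S.NearFibers m) φ ψ) :
    Relation.ReflTransGen (S.NearFibers m) (φ ∘ unitInterval.symm) (ψ ∘ unitInterval.symm) := by
  induction h with
  | refl => exact .refl
  | tail _ hn ih =>
    obtain ⟨h1, h2, r, hr, hor⟩ := hn
    exact ih.tail ⟨h1.symm, h2.symm, r, hr, hor.comp_symm⟩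

theorem chain_symm {m : Σ C : S.Cube, Fin (S.dim C)} {φ ψ : unitInterval → X}
    (h : Relation.ReflTransGen (S.NearFibers m) φ ψ) :
    Relation.ReflTransGen (S.NearFibers m) ψ φ := by
  induction h with
  | refl => exact .refl
  | tail _ hn ih => exact .head hn.symm ih

theorem Chained.symm {m : Σ C : S.Cube, Fin (S.dim C)} {φ ψ : unitInterval → X}
    (h : S.Chained m φ ψ) : S.Chained m ψ φ := by
  rcases h with h | h
  · exact .inl (chain_symm h)
  · have := chain_comp_symm (chain_symm h)
    rw [comp_symm_comp_symm] at this
    exact .inr this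

theorem Chained.trans {m : Σ C : S.Cube, Fin (S.dim C)} {φ ψ χ : unitInterval → X}
    (h : S.Chained m φ ψ) (h' : S.Chained m ψ χ) : S.Chained m φ χ := by
  rcases h with h | h <;> rcases h' with h' | h'
  · exact .inl (h.trans h')
  · exact .inr (h.trans h')
  · exact .inr (h.trans (chain_comp_symm h'))
  · have := chain_comp_symm h'
    rw [comp_symm_comp_symm] at this
    exact .inl (h.trans this)

/-- The segment from `v` to `w` is subdivided into steps shorter than `1 / 32`, the bound in
`NearFibers`. -/
theorem chain_chart {m : Σ C : S.Cube, Fin (S.dim C)} {C : S.Cube} {i : Fin (S.dim C)}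
    (hm : S.SameWall m ⟨C, i⟩) {v w : EuclideanSpace ℝ (Fin (S.dim C))}
    (hv : v ∈ unitCube (S.dim C)) (hw : w ∈ unitCube (S.dim C)) (o : Bool) :
    Relation.ReflTransGen (S.NearFibers m)
      (fun a : unitInterval => S.chart C (setCoord v i (flipLevel o a)))
      (fun a : unitInterval => S.chart C (setCoord w i (flipLevel o a))) := by
  obtain ⟨N, hN⟩ := exists_nat_gt (32 * dist v w)
  have hN0 : (0 : ℝ) < N := lt_of_le_of_lt (by positivity) hN
  set u : ℕ → EuclideanSpace ℝ (Fin (S.dim C)) := fun j => AffineMap.lineMap v w ((j : ℝ) / N)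
  have hu : ∀ j ≤ N, u j ∈ unitCube (S.dim C) := fun j hj =>
    convex_unitCube.lineMap_mem hv hw ⟨by positivity, by rw [div_le_one hN0]; exact_mod_cast hj⟩
  have key : ∀ j ≤ N, Relation.ReflTransGen (S.NearFibers m)
      (fun a : unitInterval => S.chart C (setCoord v i (flipLevel o a)))
      (fun a : unitInterval => S.chart C (setCoord (u j) i (flipLevel o a))) := by
    intro j
    induction j with
    | zero =>
      intro _
      have : u 0 = v := by simp [u]
      rw [this]
    | succ j ih =>
      intro hj
      refine (ih (by omega)).tail ⟨⟨_, hm, isFiber_chart (hu j (by omega)) i o⟩,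
        ⟨_, hm, isFiber_chart (hu (j + 1) hj) i o⟩, _, ?_,
        hor_chart (hu j (by omega)) (hu (j + 1) hj) i o⟩
      have hd : dist (u j) (u (j + 1)) = dist v w / N := by
        simp only [u]
        rw [dist_lineMap_lineMap, Real.dist_eq, ← sub_div, abs_div, abs_of_pos hN0]
        push_cast
        rw [show (j : ℝ) - (j + 1) = -1 by ring, abs_neg, abs_one]; ring
      have hlt : dist v w / N < 1 / 32 := by rw [div_lt_iff₀ hN0]; linarith
      refine lt_of_le_of_lt ?_ hlt
      rw [hd]
      exact Real.sqrt_le_iff.2 ⟨by positivity, by linarith [sq_nonneg (u j i - u (j + 1) i)]⟩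
  have := key N le_rfl
  have hN1 : u N = w := by simp only [u]; rw [div_self hN0.ne']; simp
  rwa [hN1] at this

theorem IsFiber.chained {m m' : Σ C : S.Cube, Fin (S.dim C)} (hm : S.SameWall m m')
    {φ ψ : unitInterval → X} (hφ : S.IsFiber m' φ) (hψ : S.IsFiber m' ψ) : S.Chained m φ ψ := by
  obtain ⟨v, hv, o, h⟩ := hφ
  obtain ⟨w, hw, o', h'⟩ := hψ
  have key := chain_chart hm hv hw o
  rw [← funext h] at key
  by_cases hoo : o = o'
  · subst hoo
    rw [← funext h'] at key
    exact .inl key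
  · right
    convert! key using 1
    funext a
    rw [Function.comp_apply, h']
    cases o <;> cases o' <;> simp_all

/-- The center of a cube. -/
noncomputable def cubeCenter (n : ℕ) : EuclideanSpace ℝ (Fin n) := WithLp.toLp 2 fun _ => 1 / 2

@[simp] theorem cubeCenter_apply (n : ℕ) (i : Fin n) : cubeCenter n i = 1 / 2 := rfl

theorem cubeCenter_mem (n : ℕ) : cubeCenter n ∈ unitCube n := fun i => by
  rw [cubeCenter_apply]; norm_num

/-- Take the fiber of the larger midcube through the center of `C`; it is a fiber of `C` in some
direction `j`. If `j` were not the direction `i` of the smaller midcube, an end of the fiber would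
still lie in that midcube, hence in the larger one, yet it has level `0` there. -/
theorem exists_common_fiber {m m' : Σ C : S.Cube, Fin (S.dim C)}
    (h : S.midcube m ⊆ S.midcube m') : ∃ φ, S.IsFiber m φ ∧ S.IsFiber m' φ := by
  obtain ⟨C, i⟩ := m
  obtain ⟨D, l⟩ := m'
  obtain ⟨u, ⟨hu, hul⟩, hu'⟩ := h ⟨cubeCenter _, ⟨cubeCenter_mem _, rfl⟩, rfl⟩
  have hf := isFiber_chart hu l false
  refine ⟨_, ?_, hf⟩
  have hhalf : S.chart D (setCoord u l (flipLevel false halfLevel)) = S.chart C (cubeCenter _) := by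
    rw [flipLevel_false, coe_halfLevel, ← hul, setCoord_self]; exact hu'
  obtain ⟨j, hj⟩ := hf.transfer (a := halfLevel) halfLevel_mem_Ioo (D := C)
    (Set.mem_of_eq_of_mem hhalf (S.chart_mem_cell (cubeCenter_mem _)))
  suffices j = i by subst this; exact hj
  by_contra hne
  obtain ⟨o, -, H⟩ := hj.exists_at (a := halfLevel) (cubeCenter_mem _) hhalf
  obtain ⟨u', ⟨hu1, hu2⟩, hu3⟩ := h ⟨setCoord (cubeCenter _) j (flipLevel o (0 : unitInterval)),
    ⟨setCoord_mem_unitCube (cubeCenter_mem _) _ (flipLevel_mem_Icc (0 : unitInterval).2),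
      by rw [setCoord_ne _ (Ne.symm hne)]; rfl⟩, rfl⟩
  have e := S.injOn D hu1 (setCoord_mem_unitCube hu l
    (flipLevel_mem_Icc (o := false) (0 : unitInterval).2)) (hu3.trans (H 0).symm)
  have e' := congrArg (fun v : EuclideanSpace ℝ (Fin (S.dim D)) => v l) e
  simp only [setCoord_same] at e'
  rw [hu2] at e'
  norm_num at e'

/-- A symmetric and transitive relation between fibers holds for any two fibers of a wall if it
holds for parallel fibers of the same cube. -/
theorem InWall.rel {m : Σ C : S.Cube, Fin (S.dim C)}
    {r : (unitInterval → X) → (unitInterval → X) → Prop} (hsymm : ∀ φ ψ, r φ ψ → r ψ φ)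
    (htrans : ∀ φ ψ χ, r φ ψ → r ψ χ → r φ χ)
    (hr : ∀ m' φ ψ, S.SameWall m m' → S.IsFiber m' φ → S.IsFiber m' ψ → r φ ψ)
    {φ ψ : unitInterval → X} (hφ : S.InWall m φ) (hψ : S.InWall m ψ) : r φ ψ := by
  have key : ∀ m₁ m₂, S.SameWall m₁ m₂ → S.SameWall m m₁ → ∀ φ ψ : unitInterval → X,
      S.IsFiber m₁ φ → S.IsFiber m₂ ψ → r φ ψ := by
    intro m₁ m₂ h
    induction h with
    | rel m₁ m₂ h =>
      intro hm φ ψ hφ hψ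
      obtain ⟨χ, hχ, hχ'⟩ := exists_common_fiber h
      exact htrans _ _ _ (hr _ _ _ hm hφ hχ) (hr _ _ _ (hm.trans (SameWall.of_subset h)) hχ' hψ)
    | refl m₁ => exact fun hm φ ψ hφ hψ => hr _ _ _ hm hφ hψ
    | symm m₁ m₂ h ih =>
      exact fun hm φ ψ hφ hψ =>
        hsymm _ _ (ih (SameWall.trans hm (SameWall.symm h)) ψ φ hψ hφ)
    | trans m₁ m₂ m₃ h₁ h₂ ih₁ ih₂ =>
      intro hm φ ψ hφ hψ
      have hf := isFiber_chart (S := S) (cubeCenter_mem (S.dim m₂.1)) m₂.2 false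
      exact htrans _ _ _ (ih₁ hm _ _ hφ hf) (ih₂ (SameWall.trans hm h₁) _ _ hf hψ)
  obtain ⟨m₁, h₁, hφ⟩ := hφ
  obtain ⟨m₂, h₂, hψ⟩ := hψ
  exact key m₁ m₂ (h₁.symm.trans h₂) h₁ φ ψ hφ hψ

theorem InWall.chained {m : Σ C : S.Cube, Fin (S.dim C)} {φ ψ : unitInterval → X}
    (hφ : S.InWall m φ) (hψ : S.InWall m ψ) : S.Chained m φ ψ :=
  InWall.rel (fun _ _ h => h.symm) (fun _ _ _ h h' => h.trans h')
    (fun _ _ _ hm h h' => IsFiber.chained hm h h') hφ hψ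

theorem InWall.exists_strip (hX : IsCAT0 X) {m : Σ C : S.Cube, Fin (S.dim C)}
    {φ ψ : unitInterval → X} (hφ : S.InWall m φ) (hψ : S.InWall m ψ) :
    ∃ ψ', (ψ' = ψ ∨ ψ' = ψ ∘ unitInterval.symm) ∧ ∃ N, ∀ n ≥ N, S.Strip m n φ ψ' := by
  rcases hφ.chained hψ with h | h
  · exact ⟨ψ, .inl rfl, CubeComplex.exists_strip hX hφ h⟩
  · exact ⟨_, .inr rfl, CubeComplex.exists_strip hX hφ h⟩

/-- Through a point of a wall there is only one fiber belonging to this wall, up to orientation. -/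
theorem InWall.eq_or_eq_symm (hX : IsCAT0 X) {m : Σ C : S.Cube, Fin (S.dim C)}
    {φ ψ : unitInterval → X} (hφ : S.InWall m φ) (hψ : S.InWall m ψ)
    (h : φ halfLevel = ψ halfLevel) : φ = ψ ∨ φ = ψ ∘ unitInterval.symm := by
  obtain ⟨ψ', hψ', N, hN⟩ := hφ.exists_strip hX hψ
  have hd : φ halfLevel = ψ' halfLevel := by
    rcases hψ' with rfl | rfl <;> simp [h]
  obtain ⟨f, hf0, hfN, -, hf⟩ := hN N le_rfl
  -- Equal midpoints make the strip one of width zero, in which successive fibers coincide.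
  have key : ∀ k ≤ N, f k = φ := by
    intro k
    induction k with
    | zero => exact fun _ => hf0
    | succ k ih =>
      intro hk
      have := hf k hk
      rw [hd, dist_self, zero_div] at this
      rw [← this.eq_of_zero, ih (by omega)]
  have : φ = ψ' := (key N le_rfl).symm.trans hfN
  rcases hψ' with h | h
  · exact .inl (this.trans h)
  · exact .inr (this.trans h)

/-- A wall crosses a cube in at most one direction. -/
theorem direction_unique_of_sameWall (hX : IsCAT0 X) {m : Σ C : S.Cube, Fin (S.dim C)}
    {C : S.Cube} {i l : Fin (S.dim C)} (hi : S.SameWall m ⟨C, i⟩) (hl : S.SameWall m ⟨C, l⟩) :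
    i = l := by
  have h1 := isFiber_chart (S := S) (cubeCenter_mem (S.dim C)) i false
  have h2 := isFiber_chart (S := S) (cubeCenter_mem (S.dim C)) l false
  have hhalf : ∀ i : Fin (S.dim C), setCoord (cubeCenter (S.dim C)) i (flipLevel false halfLevel)
      = cubeCenter (S.dim C) := fun i => by
    rw [flipLevel_false, coe_halfLevel, ← cubeCenter_apply _ i, setCoord_self]
  rcases InWall.eq_or_eq_symm hX (m := m) ⟨_, hi, h1⟩ ⟨_, hl, h2⟩
    (by simp only [hhalf]) with e | e
  · rw [← e] at h2; exact h1.direction_unique h2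
  · have h2 := h2.symm
    rw [← e] at h2; exact h1.direction_unique h2

/-- The wall containing the midcube `m`. -/
def wallSet (m : Σ C : S.Cube, Fin (S.dim C)) : Set X :=
  ⋃ m' ∈ {m' | S.SameWall m m'}, S.midcube m'

theorem mem_wallSet_iff {m : Σ C : S.Cube, Fin (S.dim C)} {p : X} :
    p ∈ S.wallSet m ↔ ∃ φ, S.InWall m φ ∧ φ halfLevel = p := by
  simp only [wallSet, Set.mem_iUnion, exists_prop]
  constructor
  · rintro ⟨m', hm', w, ⟨hw, hwi⟩, rfl⟩
    refine ⟨_, ⟨m', hm', isFiber_chart hw m'.2 false⟩, ?_⟩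
    rw [flipLevel_false, coe_halfLevel, ← hwi, setCoord_self]
  · rintro ⟨φ, ⟨m', hm', v, hv, o, h⟩, rfl⟩
    refine ⟨m', hm', _, ⟨setCoord_mem_unitCube hv m'.2 (flipLevel_mem_Icc halfLevel.2), ?_⟩,
      (h halfLevel).symm⟩
    rw [setCoord_same, coe_halfLevel, flipLevel_half]

theorem chart_mem_wallSet_iff {m : Σ C : S.Cube, Fin (S.dim C)} {C : S.Cube}
    {v : EuclideanSpace ℝ (Fin (S.dim C))} (hv : v ∈ unitCube (S.dim C)) :
    S.chart C v ∈ S.wallSet m ↔ ∃ i, v i = 1 / 2 ∧ S.SameWall m ⟨C, i⟩ := by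
  constructor
  · rw [mem_wallSet_iff]
    rintro ⟨φ, hφ, hp⟩
    obtain ⟨m', hm', h⟩ := id hφ
    obtain ⟨l, hl⟩ := h.transfer halfLevel_mem_Ioo (D := C) (by rw [hp]; exact S.chart_mem_cell hv)
    obtain ⟨o, ho, -⟩ := hl.exists_at hv hp
    exact ⟨l, by rw [ho, coe_halfLevel, flipLevel_half], hφ.sameWall hl⟩
  · rintro ⟨i, hi, hm⟩
    simp only [wallSet, Set.mem_iUnion, exists_prop]
    exact ⟨⟨C, i⟩, hm, v, ⟨hv, hi⟩, rfl⟩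

/-- A point near the wall lies on a fiber of the wall at a level close to `1 / 2`. Up to reversal
this level is one of the finitely many coordinates of the point, so sufficiently close means equal.
-/
theorem isClosed_wallSet (hX : IsCAT0 X) (m : Σ C : S.Cube, Fin (S.dim C)) :
    IsClosed (S.wallSet m) := by
  refine isClosed_of_closure_subset fun p hp => ?_
  rw [Metric.mem_closure_iff] at hp
  obtain ⟨C, v, hv, rfl⟩ := S.cover p
  have hfin : ∀ᶠ ε in nhdsWithin (0 : ℝ) (Set.Ioi 0), ∀ i, v i ≠ 1 / 2 → ε < |v i - 1 / 2| := by
    refine Filter.eventually_all.2 fun i => ?_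
    by_cases h : v i = 1 / 2
    · simp [h]
    · have : 0 < |v i - 1 / 2| := abs_pos.2 (sub_ne_zero.2 h)
      filter_upwards [mem_nhdsWithin_of_mem_nhds (Iio_mem_nhds this)] with ε hε _ using hε
  have h1 : ∀ᶠ ε in nhdsWithin (0 : ℝ) (Set.Ioi 0), ε < 1 / 16 :=
    mem_nhdsWithin_of_mem_nhds (Iio_mem_nhds (by norm_num))
  obtain ⟨ε, ⟨hε, h1⟩, h0⟩ := ((hfin.and h1).and self_mem_nhdsWithin).exists
  obtain ⟨q, hq, hpq⟩ := hp ε h0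
  obtain ⟨φ, hφ, rfl⟩ := mem_wallSet_iff.1 hq
  rw [dist_comm] at hpq
  obtain ⟨ψ, b, r, hψ, hb, -, hsq⟩ := exists_lift hX hφ (a := halfLevel)
    (by constructor <;> norm_num) (hpq.trans h1)
  have hb' : |1 / 2 - (b : ℝ)| < ε :=
    (abs_le_of_sq_le_sq (by rw [coe_halfLevel] at hsq; nlinarith [sq_nonneg r])
      dist_nonneg).trans_lt hpq
  have hbI : (b : ℝ) ∈ Set.Ioo (0 : ℝ) 1 := by
    rw [abs_lt] at hb'
    constructor <;> linarith [hb'.1, hb'.2]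
  obtain ⟨m', hm', h⟩ := id hψ
  obtain ⟨l, hl⟩ := h.transfer hbI (D := C) (by rw [hb]; exact S.chart_mem_cell hv)
  obtain ⟨o, ho, -⟩ := hl.exists_at hv hb
  refine (chart_mem_wallSet_iff hv).2 ⟨l, ?_, hψ.sameWall hl⟩
  by_contra hne
  have := hε l hne
  have e : |v l - 1 / 2| = |1 / 2 - (b : ℝ)| := by
    rw [← sq_eq_sq_iff_abs_eq_abs, ho]
    nth_rw 1 [← flipLevel_half o]
    rw [flipLevel_sub_sq]; ring
  linarith

theorem geodConvex_wallSet (hX : IsCAT0 X) (m : Σ C : S.Cube, Fin (S.dim C)) :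
    GeodConvex (S.wallSet m) := by
  refine hX.geodConvex_of_midpoint (isClosed_wallSet hX m) fun x hx y hy p hp => ?_
  obtain ⟨φ, hφ, rfl⟩ := mem_wallSet_iff.1 hx
  obtain ⟨ψ, hψ, rfl⟩ := mem_wallSet_iff.1 hy
  obtain ⟨ψ', hψ', N, hN⟩ := hφ.exists_strip hX hψ
  have hd : ψ' halfLevel = ψ halfLevel := by rcases hψ' with rfl | rfl <;> simp
  -- An even number of pieces: the midpoint of the middle fiber is then the midpoint of the
  -- geodesic.
  obtain ⟨f, hf0, hfn, hfw, hf⟩ := hN (2 * (N + 1)) (by omega)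
  have hg := isGeodPoint_of_chain (z := fun k => f k halfLevel) (n := 2 * (N + 1)) (by omega)
    (fun k hk => by
      have := (hf k hk).dist_le halfLevel
      rwa [← hf0, ← hfn] at this) (k := N + 1) (by omega)
  have e : (((N + 1 : ℕ) : ℝ) / ((2 * (N + 1) : ℕ) : ℝ)) = 1 / 2 := by
    push_cast; field_simp
  rw [e, hf0, hfn, hd] at hg
  have := hX.isGeodPoint_unique (by norm_num) hp hg
  rw [this]
  exact mem_wallSet_iff.2 ⟨f (N + 1), hfw _ (by omega), rfl⟩

end CubeComplex

/-! ### The sides of a wall and half-spaces -/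

namespace CubeComplex

variable {X : Type*} [MetricSpace X] {S : CubeComplex X}

/-- Near a point of a wall there is a continuous function measuring the position with respect to
the wall; it is symmetric along geodesics through this point. -/
theorem exists_level (hX : IsCAT0 X) {m : Σ C : S.Cube, Fin (S.dim C)} {φ : unitInterval → X}
    (hφ : S.InWall m φ) : ∃ s : X → ℝ,
      (∀ z z', dist (φ halfLevel) z < 1 / 32 → dist (φ halfLevel) z' < 1 / 32 →
        |s z - s z'| ≤ dist z z') ∧
      (∀ z, dist (φ halfLevel) z < 1 / 32 → s z = 1 / 2 → z ∈ S.wallSet m) ∧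
      ∀ z z', dist (φ halfLevel) z < 1 / 32 → dist (φ halfLevel) z' < 1 / 32 →
        IsGeodPoint (1 / 2) z z' (φ halfLevel) → s z + s z' = 1 := by
  have hlift : ∀ z, ∃ (ψ : unitInterval → X) (b : unitInterval) (r : ℝ),
      dist (φ halfLevel) z < 1 / 32 → S.InWall m ψ ∧ ψ b = z ∧ Hor φ ψ r ∧
        (1 / 2 - (b : ℝ)) ^ 2 + r ^ 2 ≤ dist (φ halfLevel) z ^ 2 := by
    intro z
    by_cases hz : dist (φ halfLevel) z < 1 / 32
    · obtain ⟨ψ, b, r, h⟩ := exists_lift hX hφ (a := halfLevel)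
        (by constructor <;> norm_num) (z := z) (by linarith)
      exact ⟨ψ, b, r, fun _ => h⟩
    · exact ⟨φ, 0, 0, fun h => absurd h hz⟩
  choose ψ b r hψ using hlift
  have hr : ∀ z, dist (φ halfLevel) z < 1 / 32 → r z ≤ 1 / 32 := fun z hz => by
    have := (abs_le_of_sq_le_sq' (show r z ^ 2 ≤ dist (φ halfLevel) z ^ 2 by
      nlinarith [(hψ z hz).2.2.2, sq_nonneg (1 / 2 - (b z : ℝ))]) dist_nonneg).2
    linarith
  have hb : ∀ z, dist (φ halfLevel) z < 1 / 32 → |1 / 2 - (b z : ℝ)| ≤ 1 / 32 := fun z hz =>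
    (abs_le_of_sq_le_sq (by nlinarith [(hψ z hz).2.2.2, sq_nonneg (r z)]) dist_nonneg).trans hz.le
  refine ⟨fun z => b z, fun z z' hz hz' => ?_, fun z hz h => ?_, fun z z' hz hz' hg => ?_⟩
  · obtain ⟨h1, h2, h3, -⟩ := hψ z hz
    obtain ⟨⟨m', -, hf'⟩, h2', h3', -⟩ := hψ z' hz'
    have hbz := abs_le.1 (hb z hz)
    have hbz' := abs_le.1 (hb z' hz')
    have hzz : dist z z' < 1 / 16 := by
      linarith [dist_triangle z (φ halfLevel) z', dist_comm z (φ halfLevel)]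
    obtain ⟨χ, c, t, ⟨m'', -, hf⟩, hc, hor, hsq⟩ := exists_lift hX h1 (a := b z)
      ⟨by linarith [hbz.2], by linarith [hbz.1]⟩ (z := z') (by rw [h2]; exact hzz)
    rw [h2] at hsq
    have ht : t ≤ 1 / 16 := by
      have := (abs_le_of_sq_le_sq' (show t ^ 2 ≤ dist z z' ^ 2 by
        nlinarith [sq_nonneg ((b z : ℝ) - c)]) dist_nonneg).2
      linarith
    have e : χ = ψ z' := eq_of_hor hX hf hf' (b := c) (b' := b z')
      ⟨by linarith [hbz'.2], by linarith [hbz'.1]⟩ (hc.trans h2'.symm) (h3.trans hor) h3'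
      (by linarith [hr z hz, hr z' hz'])
    subst e
    have e : c = b z' := hf'.injective (hc.trans h2'.symm)
    subst e
    exact abs_le_of_sq_le_sq (by nlinarith [sq_nonneg t]) dist_nonneg
  · obtain ⟨h1, h2, -⟩ := hψ z hz
    refine mem_wallSet_iff.2 ⟨ψ z, h1, ?_⟩
    rw [← h2]; congr 1; exact Subtype.ext h.symm
  · obtain ⟨-, h2, h3, h4⟩ := hψ z hz
    obtain ⟨-, h2', h3', h4'⟩ := hψ z' hz'
    have hd := (h3.symm.trans h3').dist_sq_le (b z) (b z')
    rw [h2, h2'] at hd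
    have e1 : dist (φ halfLevel) z = dist z z' / 2 := by rw [dist_comm, hg.1]; ring
    have e2 : dist (φ halfLevel) z' = dist z z' / 2 := by rw [hg.2]; ring
    rw [e1] at h4
    rw [e2] at h4'
    have := eq_of_add_sq_add_add_sq_ge (x₁ := (b z : ℝ) - 1 / 2) (x₂ := 1 / 2 - (b z' : ℝ))
      (h₁ := r z) (h₂ := r z') (ℓ := dist z z' / 2) (by linarith) h4'
      (by
        calc (2 * (dist z z' / 2)) ^ 2 = dist z z' ^ 2 := by ring
          _ ≤ _ := hd
          _ = _ := by ring)
    linarith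

/-- If a geodesic between points off a wall meets the wall, so do nearby geodesics. -/
theorem crossing_stable (hX : IsCAT0 X) {m : Σ C : S.Cube, Fin (S.dim C)} {x y : X}
    (hx : x ∉ S.wallSet m) (hy : y ∉ S.wallSet m) (h : (geodSeg x y ∩ S.wallSet m).Nonempty) :
    ∃ ρ > 0, ∀ y', dist y y' < ρ → (geodSeg x y' ∩ S.wallSet m).Nonempty := by
  obtain ⟨γ, hγ0, hγ1, hγ⟩ := hX.1.exists_path x y
  have hgs := hX.eq_path_of_mem_geodSeg hγ0 hγ1 hγ
  set T := Set.Icc (0 : ℝ) 1 ∩ γ ⁻¹' S.wallSet m with hT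
  have hTcl : IsClosed T :=
    (continuousOn_path hγ).preimage_isClosed_of_isClosed isClosed_Icc (isClosed_wallSet hX m)
  have hTne : T.Nonempty := by
    obtain ⟨p, hp, hpV⟩ := h
    rw [hgs] at hp
    obtain ⟨t, ht, rfl⟩ := hp
    exact ⟨t, ht, hpV⟩
  -- Just after the last parameter `t₀` on the wall the level differs from `1 / 2`, and by the
  -- symmetry of the level along the geodesic it lies on the opposite side just before. A nearby
  -- geodesic has nearly the same levels there, so it crosses level `1 / 2` by the intermediate
  -- value theorem.
  obtain ⟨t₀, ⟨ht₀, ht₀V⟩, hmax⟩ :=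
    (isCompact_Icc.of_isClosed_subset hTcl Set.inter_subset_left).exists_isGreatest hTne
  have h0 : 0 < t₀ := lt_of_le_of_ne ht₀.1 fun e => hx (by rw [← hγ0, e]; exact ht₀V)
  have h1 : t₀ < 1 := lt_of_le_of_ne ht₀.2 fun e => hy (by rw [← hγ1, ← e]; exact ht₀V)
  obtain ⟨φ, hφ, hφp⟩ := mem_wallSet_iff.1 ht₀V
  obtain ⟨s, hsl, hsV, hss⟩ := exists_level hX hφ
  rw [hφp] at hsl hsV hss
  have hxy : 0 < dist x y := dist_pos.2 fun e => by
    have : dist x (γ t₀) = 0 := by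
      rw [(isGeodPoint_of_path hγ0 hγ1 hγ ht₀).1, e, dist_self, mul_zero]
    exact hx (dist_eq_zero.1 this ▸ ht₀V)
  obtain ⟨η, hη, hη0, hη1, hηL⟩ : ∃ η > 0, η ≤ t₀ ∧ η ≤ 1 - t₀ ∧ η * dist x y ≤ 1 / 128 := by
    refine ⟨min (min t₀ (1 - t₀)) (1 / 128 / dist x y), ?_, ?_, ?_, ?_⟩
    · exact lt_min (lt_min h0 (by linarith)) (by positivity)
    · exact (min_le_left _ _).trans (min_le_left _ _)
    · exact (min_le_left _ _).trans (min_le_right _ _)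
    · exact (le_div_iff₀ hxy).1 (min_le_right _ _)
  have hIm : t₀ - η ∈ Set.Icc (0 : ℝ) 1 := ⟨by linarith, by linarith⟩
  have hIp : t₀ + η ∈ Set.Icc (0 : ℝ) 1 := ⟨by linarith, by linarith⟩
  have hIsub : Set.Icc (t₀ - η) (t₀ + η) ⊆ Set.Icc (0 : ℝ) 1 := fun t ht =>
    ⟨hIm.1.trans ht.1, ht.2.trans hIp.2⟩
  have hnear : ∀ t ∈ Set.Icc (t₀ - η) (t₀ + η), dist (γ t₀) (γ t) ≤ 1 / 128 := fun t ht => by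
    rw [hγ _ ht₀ _ (hIsub ht)]
    refine le_trans (mul_le_mul_of_nonneg_right (abs_le.2 ⟨?_, ?_⟩) dist_nonneg) hηL <;>
      linarith [ht.1, ht.2]
  have hmm : t₀ - η ∈ Set.Icc (t₀ - η) (t₀ + η) := ⟨le_rfl, by linarith⟩
  have hpp : t₀ + η ∈ Set.Icc (t₀ - η) (t₀ + η) := ⟨by linarith, le_rfl⟩
  have hsp : s (γ (t₀ + η)) ≠ 1 / 2 := fun e => by
    have := hmax ⟨hIp, hsV _ (by linarith [hnear _ hpp]) e⟩
    linarith
  have hsum : s (γ (t₀ - η)) + s (γ (t₀ + η)) = 1 := by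
    refine hss _ _ (by linarith [hnear _ hmm]) (by linarith [hnear _ hpp]) ⟨?_, ?_⟩
    · rw [hγ _ hIm _ ht₀, hγ _ hIm _ hIp, abs_of_neg (by linarith), abs_of_neg (by linarith)]; ring
    · rw [hγ _ ht₀ _ hIp, hγ _ hIm _ hIp, abs_of_neg (by linarith), abs_of_neg (by linarith)]; ring
  set κ := |s (γ (t₀ + η)) - 1 / 2| with hκ
  have hκ0 : 0 < κ := abs_pos.2 (sub_ne_zero.2 hsp)
  refine ⟨min κ (1 / 128), lt_min hκ0 (by norm_num), fun y' hy' => ?_⟩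
  obtain ⟨γ', hγ0', hγ1', hγ'⟩ := hX.1.exists_path x y'
  have hclose : ∀ t ∈ Set.Icc (0 : ℝ) 1, dist (γ t) (γ' t) ≤ dist y y' := fun t ht => by
    have := hX.dist_le_of_common_left ht (isGeodPoint_of_path hγ0 hγ1 hγ ht)
      (isGeodPoint_of_path hγ0' hγ1' hγ' ht)
    exact this.trans (mul_le_of_le_one_left dist_nonneg ht.2)
  have hball : ∀ t ∈ Set.Icc (t₀ - η) (t₀ + η), dist (γ t₀) (γ' t) < 1 / 32 := fun t ht => by
    linarith [hnear t ht, hclose t (hIsub ht), dist_triangle (γ t₀) (γ t) (γ' t),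
      min_le_right κ (1 / 128)]
  have hcont : ContinuousOn (fun t => s (γ' t)) (Set.uIcc (t₀ - η) (t₀ + η)) := by
    rw [Set.uIcc_of_le (by linarith)]
    have : LipschitzOnWith 1 s (Metric.ball (γ t₀) (1 / 32)) := by
      refine LipschitzOnWith.of_dist_le_mul fun z hz z' hz' => ?_
      rw [NNReal.coe_one, one_mul, Real.dist_eq]
      exact hsl z z' (by rw [dist_comm]; exact hz) (by rw [dist_comm]; exact hz')
    refine this.continuousOn.comp ((continuousOn_path hγ').mono hIsub) fun t ht => ?_
    rw [Metric.mem_ball, dist_comm]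
    exact hball t ht
  have hivt := intermediate_value_uIcc hcont
  have hd1 := abs_lt.1 ((hsl _ _ (by linarith [hnear _ hpp]) (hball _ hpp)).trans_lt
    (((hclose _ hIp).trans_lt hy').trans_le (min_le_left _ _)))
  have hd2 := abs_lt.1 ((hsl _ _ (by linarith [hnear _ hmm]) (hball _ hmm)).trans_lt
    (((hclose _ hIm).trans_lt hy').trans_le (min_le_left _ _)))
  have hmem : (1 / 2 : ℝ) ∈ Set.uIcc (s (γ' (t₀ - η))) (s (γ' (t₀ + η))) := by
    rw [Set.mem_uIcc]
    rcases le_total 0 (s (γ (t₀ + η)) - 1 / 2) with hpos | hneg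
    · rw [abs_of_nonneg hpos] at hκ
      left; constructor <;> linarith [hd1.1, hd1.2, hd2.1, hd2.2]
    · rw [abs_of_nonpos hneg] at hκ
      right; constructor <;> linarith [hd1.1, hd1.2, hd2.1, hd2.2]
  obtain ⟨t, ht, hst⟩ := hivt hmem
  rw [Set.uIcc_of_le (by linarith)] at ht
  exact ⟨γ' t, (isGeodPoint_of_path hγ0' hγ1' hγ' (hIsub ht)).mem_geodSeg,
    hsV _ (hball t ht) hst⟩

/-- The points `x` and `y` are not separated by the wall of `m`. -/
def SameSide (m : Σ C : S.Cube, Fin (S.dim C)) (x y : X) : Prop :=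
  Disjoint (geodSeg x y) (S.wallSet m)

theorem geodSeg_self (x : X) : geodSeg x x = {x} := by
  ext y
  simp only [geodSeg, dist_self, Set.mem_ofPred_eq, Set.mem_singleton_iff]
  constructor
  · intro h
    have : dist y x = 0 := by
      linarith [dist_nonneg (x := x) (y := y), dist_nonneg (x := y) (y := x)]
    exact dist_eq_zero.1 this
  · rintro rfl; simp

/-- The points off the wall whose geodesic from `x` avoids the wall, and those whose geodesic meets
it, form two disjoint open sets; for the second this is `crossing_stable`. A connected set
containing `x` lies in the first. -/
theorem mem_connectedComponentIn_iff (hX : IsCAT0 X) {m : Σ C : S.Cube, Fin (S.dim C)} {x y : X}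
    (hx : x ∉ S.wallSet m) :
    y ∈ connectedComponentIn (S.wallSet m)ᶜ x ↔ S.SameSide m x y := by
  constructor
  · intro hy
    by_contra hcon
    have hyV : y ∉ S.wallSet m := connectedComponentIn_subset _ _ hy
    set A := {y | Disjoint (geodSeg x y) (S.wallSet m)}
    set B := {y | y ∉ S.wallSet m ∧ (geodSeg x y ∩ S.wallSet m).Nonempty}
    have hA : IsOpen A := by
      refine Metric.isOpen_iff.2 fun y hy => ?_
      obtain ⟨r, hr, hd⟩ := hy.exists_thickenings (hX.isCompact_geodSeg x y)
        (isClosed_wallSet hX m)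
      refine ⟨r, hr, fun y' hy' => Disjoint.mono ?_ (Metric.self_subset_thickening hr _) hd⟩
      intro z hz
      obtain ⟨t, ht, hz⟩ := exists_isGeodPoint_of_mem_geodSeg hz
      obtain ⟨z', hz'⟩ := hX.1.exists_isGeodPoint x y ht
      refine Metric.mem_thickening_iff.2 ⟨z', hz'.mem_geodSeg, ?_⟩
      refine (hX.dist_le_of_common_left ht hz hz').trans_lt ?_
      exact (mul_le_of_le_one_left dist_nonneg ht.2).trans_lt hy'
    have hB : IsOpen B := by
      refine Metric.isOpen_iff.2 fun y hy => ?_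
      obtain ⟨ρ, hρ, h⟩ := crossing_stable hX hx hy.1 hy.2
      obtain ⟨ρ', hρ', h'⟩ := Metric.isOpen_iff.1 (isClosed_wallSet hX m).isOpen_compl y hy.1
      refine ⟨min ρ ρ', lt_min hρ hρ', fun y' hy' => ⟨h' ?_, h y' ?_⟩⟩
      · exact Metric.ball_subset_ball (min_le_right _ _) hy'
      · rw [dist_comm]; exact (Metric.mem_ball.1 hy').trans_le (min_le_left _ _)
    have hpre : IsPreconnected (connectedComponentIn (S.wallSet m)ᶜ x) :=
      isPreconnected_connectedComponentIn
    obtain ⟨z, -, hzA, hzB⟩ := hpre A B hA hB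
      (fun z hz => by
        by_cases h : Disjoint (geodSeg x z) (S.wallSet m)
        · exact .inl h
        · exact .inr ⟨connectedComponentIn_subset _ _ hz, Set.not_disjoint_iff_nonempty_inter.1 h⟩)
      ⟨x, mem_connectedComponentIn hx, by
        change Disjoint (geodSeg x x) _
        rw [geodSeg_self]; exact Set.disjoint_singleton_left.2 hx⟩
      ⟨y, hy, hyV, Set.not_disjoint_iff_nonempty_inter.1 hcon⟩
    exact Set.not_disjoint_iff_nonempty_inter.2 hzB.2 hzA
  · intro h
    exact (hX.isPreconnected_geodSeg x y).subset_connectedComponentIn (left_mem_geodSeg x y)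
      h.subset_compl_right (right_mem_geodSeg x y)

theorem SameSide.left_notMem {m : Σ C : S.Cube, Fin (S.dim C)} {x y : X}
    (h : S.SameSide m x y) : x ∉ S.wallSet m :=
  Set.disjoint_left.1 h (left_mem_geodSeg x y)

theorem SameSide.symm {m : Σ C : S.Cube, Fin (S.dim C)} {x y : X}
    (h : S.SameSide m x y) : S.SameSide m y x := by
  rwa [SameSide, geodSeg_comm]

theorem SameSide.trans (hX : IsCAT0 X) {m : Σ C : S.Cube, Fin (S.dim C)} {x y z : X}
    (h : S.SameSide m x y) (h' : S.SameSide m y z) : S.SameSide m x z := by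
  have h1 := (mem_connectedComponentIn_iff hX h.left_notMem).2 h
  have h2 := (mem_connectedComponentIn_iff hX h'.left_notMem).2 h'
  rw [← connectedComponentIn_eq h1] at h2
  exact (mem_connectedComponentIn_iff hX h.left_notMem).1 h2

theorem sameSide_of_isPreconnected (hX : IsCAT0 X) {m : Σ C : S.Cube, Fin (S.dim C)} {A : Set X}
    (hA : IsPreconnected A) (hAV : Disjoint A (S.wallSet m)) {x y : X} (hx : x ∈ A) (hy : y ∈ A) :
    S.SameSide m x y :=
  (mem_connectedComponentIn_iff hX (Set.disjoint_left.1 hAV hx)).1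
    (hA.subset_connectedComponentIn hx hAV.subset_compl_right hy)

theorem continuousOn_chart (C : S.Cube) : ContinuousOn (S.chart C) (unitCube (S.dim C)) := by
  have : LipschitzOnWith 1 (S.chart C) (unitCube (S.dim C)) :=
    LipschitzOnWith.of_dist_le_mul fun v hv w hw => by
      rw [NNReal.coe_one, one_mul]; exact dist_chart_le hv hw
  exact this.continuousOn

/-- Points of a cube on the same side of the midcubes that belong to a wall. -/
theorem sameSide_chart (hX : IsCAT0 X) {m : Σ C : S.Cube, Fin (S.dim C)} {C : S.Cube}
    {v w : EuclideanSpace ℝ (Fin (S.dim C))} (hv : v ∈ unitCube (S.dim C))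
    (hw : w ∈ unitCube (S.dim C))
    (h : ∀ i, S.SameWall m ⟨C, i⟩ → (v i < 1 / 2 ∧ w i < 1 / 2) ∨ (1 / 2 < v i ∧ 1 / 2 < w i)) :
    S.SameSide m (S.chart C v) (S.chart C w) := by
  refine sameSide_of_isPreconnected hX (A := S.chart C '' segment ℝ v w)
    ((convex_segment v w).isPreconnected.image _
      ((continuousOn_chart C).mono (convex_unitCube.segment_subset hv hw))) ?_
    ⟨v, left_mem_segment ℝ v w, rfl⟩ ⟨w, right_mem_segment ℝ v w, rfl⟩
  rw [Set.disjoint_left]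
  rintro _ ⟨u, hu, rfl⟩ hV
  obtain ⟨i, hi, hm⟩ := (chart_mem_wallSet_iff (convex_unitCube.segment_subset hv hw hu)).1 hV
  obtain ⟨a, b, ha, hb, hab, rfl⟩ := hu
  simp only [PiLp.add_apply, PiLp.smul_apply, smul_eq_mul] at hi
  obtain rfl : a = 1 - b := by linarith
  rcases h i hm with ⟨h1, h2⟩ | ⟨h1, h2⟩
  · rcases eq_or_lt_of_le hb with rfl | hb
    · linarith
    · nlinarith
  · rcases eq_or_lt_of_le hb with rfl | hb
    · linarith
    · nlinarith

/-- Every point off a wall is on the side of one of the ends of any fiber of the wall. -/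
theorem InWall.sameSide_or (hX : IsCAT0 X) {m : Σ C : S.Cube, Fin (S.dim C)}
    {φ : unitInterval → X} (hφ : S.InWall m φ) {x : X} (hx : x ∉ S.wallSet m) :
    S.SameSide m (φ 0) x ∨ S.SameSide m (φ 1) x := by
  -- it suffices to find one fiber with this property
  have key : ∀ ψ, S.InWall m ψ → (S.SameSide m (ψ 0) x ∨ S.SameSide m (ψ 1) x) →
      (S.SameSide m (φ 0) x ∨ S.SameSide m (φ 1) x) := by
    intro ψ hψ
    refine (InWall.rel (m := m) (r := fun φ ψ => (S.SameSide m (φ 0) x ∨ S.SameSide m (φ 1) x) ↔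
      (S.SameSide m (ψ 0) x ∨ S.SameSide m (ψ 1) x)) (fun _ _ h => h.symm)
      (fun _ _ _ h h' => h.trans h') ?_ hφ hψ).2
    -- The wall has only the direction `i` in the cube `C`, so ends of fibers in the same half of
    -- this coordinate are on the same side of the wall.
    have half : ∀ m' φ ψ, S.SameWall m m' → S.IsFiber m' φ → S.IsFiber m' ψ →
        (S.SameSide m (φ 0) x ∨ S.SameSide m (φ 1) x) →
        (S.SameSide m (ψ 0) x ∨ S.SameSide m (ψ 1) x) := by
      rintro ⟨C, i⟩ φ ψ hm ⟨v, hv, o, h⟩ ⟨w, hw, o', h'⟩ hor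
      have hss : ∀ c c' : unitInterval,
          (flipLevel o c < 1 / 2 ∧ flipLevel o' c' < 1 / 2 ∨
            1 / 2 < flipLevel o c ∧ 1 / 2 < flipLevel o' c') → S.SameSide m (φ c) x →
          S.SameSide m (ψ c') x := by
        intro c c' hcc hc
        refine SameSide.trans hX ?_ hc
        rw [h, h']
        refine (sameSide_chart hX (setCoord_mem_unitCube hv i (flipLevel_mem_Icc c.2))
          (setCoord_mem_unitCube hw i (flipLevel_mem_Icc c'.2)) fun l hl => ?_).symm
        obtain rfl := direction_unique_of_sameWall hX hm hl
        simpa using hcc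
      rcases hor with h0 | h0 <;> cases o <;> cases o' <;>
        first
          | (refine .inl (hss _ 0 ?_ h0); norm_num; done)
          | (refine .inr (hss _ 1 ?_ h0); norm_num)
    exact fun m' φ ψ hm h h' => ⟨half m' φ ψ hm h h', half m' ψ φ hm h' h⟩
  obtain ⟨γ, hγ0, hγ1, hγ⟩ := hX.1.exists_path x (φ halfLevel)
  set T := Set.Icc (0 : ℝ) 1 ∩ γ ⁻¹' S.wallSet m with hT
  have hTcl : IsClosed T :=
    (continuousOn_path hγ).preimage_isClosed_of_isClosed isClosed_Icc (isClosed_wallSet hX m)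
  have hTne : T.Nonempty := ⟨1, by simp, by
    rw [Set.mem_preimage, hγ1]; exact mem_wallSet_iff.2 ⟨φ, hφ, rfl⟩⟩
  -- Just before the first point of the wall on a geodesic issuing from `x`, the geodesic is still
  -- on the side of `x` and passes through a fiber `ξ` of the wall off its midpoint. The nearer end
  -- of `ξ` is on the side of `x`.
  obtain ⟨t₀, ⟨ht₀, ht₀V⟩, hmin⟩ :=
    (isCompact_Icc.of_isClosed_subset hTcl Set.inter_subset_left).exists_isLeast hTne
  have h0 : 0 < t₀ := lt_of_le_of_ne ht₀.1 fun e => hx (by rw [← hγ0, e]; exact ht₀V)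
  set L := dist x (φ halfLevel) with hL
  have hL0 : 0 ≤ L := dist_nonneg
  obtain ⟨η, hη, hη0, hηL⟩ : ∃ η > 0, η ≤ t₀ ∧ η * L < 1 / 16 := by
    refine ⟨min t₀ (1 / 16 / (L + 1)), lt_min h0 (by positivity), min_le_left _ _, ?_⟩
    have h1 : min t₀ (1 / 16 / (L + 1)) * (L + 1) ≤ 1 / 16 :=
      (le_div_iff₀ (by positivity)).1 (min_le_right _ _)
    have h2 : 0 < min t₀ (1 / 16 / (L + 1)) := lt_min h0 (by positivity)
    nlinarith
  have hI : t₀ - η ∈ Set.Icc (0 : ℝ) 1 := ⟨by linarith, by linarith [ht₀.2]⟩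
  obtain ⟨ψ, hψ, hψp⟩ := mem_wallSet_iff.1 ht₀V
  have hzV : γ (t₀ - η) ∉ S.wallSet m := fun h => by
    have := hmin ⟨hI, h⟩
    linarith
  have hxz : S.SameSide m (γ (t₀ - η)) x := by
    refine sameSide_of_isPreconnected hX (A := γ '' Set.Icc 0 (t₀ - η))
      (isPreconnected_Icc.image _ ((continuousOn_path hγ).mono
        (Set.Icc_subset_Icc le_rfl hI.2))) ?_ ⟨_, ⟨hI.1, le_rfl⟩, rfl⟩
      ⟨0, ⟨le_rfl, hI.1⟩, hγ0⟩
    rw [Set.disjoint_left]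
    rintro _ ⟨t, ht, rfl⟩ hV
    have := hmin ⟨⟨ht.1, ht.2.trans hI.2⟩, hV⟩
    linarith [ht.2]
  obtain ⟨ξ, b, r, hξ, hb, -, hsq⟩ := exists_lift hX hψ (a := halfLevel)
    (by constructor <;> norm_num) (z := γ (t₀ - η)) (by
      rw [hψp, hγ _ ht₀ _ hI, show t₀ - (t₀ - η) = η by ring, abs_of_pos hη]; exact hηL)
  have hb' : (b : ℝ) ≠ 1 / 2 := fun e => hzV (mem_wallSet_iff.2 ⟨ξ, hξ, by
    rw [← hb]; congr 1; exact Subtype.ext e.symm⟩)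
  obtain ⟨⟨C, i⟩, hm', v, hv, o, hξC⟩ := id hξ
  have hss : ∀ c : unitInterval, (((b : ℝ) < 1 / 2 ∧ (c : ℝ) < 1 / 2) ∨
      (1 / 2 < (b : ℝ) ∧ 1 / 2 < (c : ℝ))) → S.SameSide m (ξ c) x := by
    intro c hbc
    refine SameSide.trans hX ?_ hxz
    rw [← hb, hξC, hξC]
    refine (sameSide_chart hX (setCoord_mem_unitCube hv i (flipLevel_mem_Icc b.2))
      (setCoord_mem_unitCube hv i (flipLevel_mem_Icc c.2)) fun l hl => ?_).symm
    obtain rfl := direction_unique_of_sameWall hX hm' hl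
    simp only [setCoord_same]
    cases o
    · simpa using hbc
    · simp only [flipLevel_true]
      rcases hbc with h | h
      · right; constructor <;> linarith [h.1, h.2]
      · left; constructor <;> linarith [h.1, h.2]
  refine key ξ hξ ?_
  rcases lt_or_gt_of_ne hb' with h | h
  · exact .inl (hss 0 (.inl ⟨h, by norm_num⟩))
  · exact .inr (hss 1 (.inr ⟨h, by norm_num⟩))

/-! ### Half-spaces -/

theorem IsHalfSpace.exists_eq (hX : IsCAT0 X) {A : Set X} (hA : S.IsHalfSpace A) :
    ∃ m x, x ∉ S.wallSet m ∧ A = closure {y | S.SameSide m x y} := by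
  obtain ⟨⟨W, m, rfl⟩, x, hx, rfl⟩ := hA
  refine ⟨m, x, hx, ?_⟩
  congr 1
  ext y
  exact mem_connectedComponentIn_iff hX hx

theorem geodConvex_sameSide (hX : IsCAT0 X) (m : Σ C : S.Cube, Fin (S.dim C)) (x : X) :
    GeodConvex {y | S.SameSide m x y} := by
  intro y hy z hz p hp
  have hyz : S.SameSide m y z := SameSide.trans hX (SameSide.symm hy) hz
  exact SameSide.trans hX hy (sameSide_of_isPreconnected hX (hX.isPreconnected_geodSeg y z) hyz
    (left_mem_geodSeg y z) hp)

theorem IsHalfSpace.geodConvex (hX : IsCAT0 X) {A : Set X} (hA : S.IsHalfSpace A) :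
    GeodConvex A := by
  obtain ⟨m, x, -, rfl⟩ := hA.exists_eq hX
  exact hX.geodConvex_closure (geodConvex_sameSide hX m x)

theorem sameSide_of_mem_closure (hX : IsCAT0 X) {m : Σ C : S.Cube, Fin (S.dim C)} {x y : X}
    (hy : y ∈ closure {y | S.SameSide m x y}) (hyV : y ∉ S.wallSet m) : S.SameSide m x y := by
  obtain ⟨ρ, hρ, h⟩ := Metric.isOpen_iff.1 (isClosed_wallSet hX m).isOpen_compl y hyV
  obtain ⟨z, hz, hyz⟩ := Metric.mem_closure_iff.1 hy ρ hρ
  refine SameSide.trans hX hz (SameSide.symm ?_)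
  refine Set.disjoint_left.2 fun p hp hpV => h ?_ hpV
  have hp' : dist y p + dist p z = dist y z := hp
  rw [Metric.mem_ball, dist_comm]
  linarith [dist_nonneg (x := p) (y := z)]

end CubeComplex

/-! ### Vertices, edges and intersections of half-spaces -/

namespace CubeComplex

variable {X : Type*} [MetricSpace X] {S : CubeComplex X}

/-- The wall containing the midcube `m`. -/
def wallOf (m : Σ C : S.Cube, Fin (S.dim C)) : S.Wall := ⟨S.wallSet m, m, rfl⟩

theorem Wall.exists_eq (W : S.Wall) : ∃ m, W = S.wallOf m := by
  obtain ⟨W, m, rfl⟩ := W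
  exact ⟨m, rfl⟩

theorem wallSet_eq {m m' : Σ C : S.Cube, Fin (S.dim C)} (h : S.SameWall m m') :
    S.wallSet m = S.wallSet m' := by
  have : {n | S.SameWall m n} = {n | S.SameWall m' n} :=
    Set.ext fun n => ⟨fun hn => h.symm.trans hn, fun hn => h.trans hn⟩
  rw [wallSet, this, wallSet]

theorem SameSide.congr {m m' : Σ C : S.Cube, Fin (S.dim C)} (h : S.SameWall m m') {x y : X}
    (hxy : S.SameSide m x y) : S.SameSide m' x y := by
  rwa [SameSide, ← wallSet_eq h]

/-- A coordinate strictly between `0` and `1` would reappear as a coordinate of a cube of dimension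
`0`. Conversely, fixing all coordinates gives a one-point face, and the chart of the cube with this
image is injective only in dimension `0`. -/
theorem isVertex_chart_iff {C : S.Cube} {v : EuclideanSpace ℝ (Fin (S.dim C))}
    (hv : v ∈ unitCube (S.dim C)) : S.IsVertex (S.chart C v) ↔ ∀ i, v i = 0 ∨ v i = 1 := by
  constructor
  · rintro ⟨D, hD, w, hw, hwv⟩ i
    by_contra! h
    obtain ⟨l, -⟩ := exists_coord_eq hw hv hwv
      ⟨lt_of_le_of_ne (hv i).1 h.1.symm, lt_of_le_of_ne (hv i).2 h.2⟩
    rw [hD] at l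
    exact l.elim0
  · intro h
    classical
    obtain ⟨D, hD⟩ := S.face_mem C (fun i => some (decide (v i = 1)))
    have hvF : ∀ w ∈ cubeFace (fun i => some (decide (v i = 1))), w = v := by
      intro w hw
      ext i
      rw [hw.2 i _ rfl]
      rcases h i with h | h <;> simp [h]
    have hvv : v ∈ cubeFace (fun i => some (decide (v i = 1))) := by
      refine ⟨hv, fun i b hb => ?_⟩
      rcases h i with h | h <;> simp_all
    refine ⟨D, ?_, by rw [cell, hD]; exact ⟨v, hvv, rfl⟩⟩
    by_contra hdim
    have hall : ∀ w ∈ unitCube (S.dim D), S.chart D w = S.chart C v := by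
      intro w hw
      obtain ⟨u, hu, hu'⟩ :
          S.chart D w ∈ S.chart C '' cubeFace (fun i => some (decide (v i = 1))) :=
        hD ▸ Set.mem_image_of_mem _ hw
      rw [← hu', hvF u hu]
    let i : Fin (S.dim D) := ⟨0, Nat.pos_of_ne_zero hdim⟩
    have hc := cubeCenter_mem (S.dim D)
    have h1 := setCoord_mem_unitCube hc i (show (1 : ℝ) ∈ Set.Icc (0 : ℝ) 1 by simp)
    have e := S.injOn D hc h1 ((hall _ hc).trans (hall _ h1).symm)
    have e' := congrArg (fun v : EuclideanSpace ℝ (Fin (S.dim D)) => v i) e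
    simp only [setCoord_same, cubeCenter_apply] at e'
    norm_num at e'

theorem IsVertex.notMem_wallSet {x : X} (hx : S.IsVertex x) (m : Σ C : S.Cube, Fin (S.dim C)) :
    x ∉ S.wallSet m := by
  obtain ⟨C, v, hv, rfl⟩ := S.cover x
  rw [chart_mem_wallSet_iff hv]
  rintro ⟨i, hi, -⟩
  rcases (isVertex_chart_iff hv).1 hx i with h | h <;> rw [h] at hi <;> norm_num at hi

/-- Corners of a cube that differ in one coordinate are joined by an edge. -/
theorem exists_joins {C : S.Cube} {v : EuclideanSpace ℝ (Fin (S.dim C))}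
    (hv : v ∈ unitCube (S.dim C)) (hc : ∀ i, v i = 0 ∨ v i = 1) (i : Fin (S.dim C)) :
    ∃ E, S.Joins E (S.chart C v) (S.chart C (setCoord v i (1 - v i))) ∧
      S.Dual E (S.wallOf ⟨C, i⟩) := by
  classical
  set σ : Fin (S.dim C) → Option Bool := fun l => if l = i then none else some (decide (v l = 1))
    with hσ
  obtain ⟨E, hE⟩ := S.face_mem C σ
  have hmem : ∀ a ∈ Set.Icc (0 : ℝ) 1, setCoord v i a ∈ cubeFace σ := by
    intro a ha
    refine ⟨setCoord_mem_unitCube hv i ha, fun l b hb => ?_⟩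
    have hli : l ≠ i := by rintro rfl; simp [hσ] at hb
    rw [setCoord_ne v hli]
    rcases hc l with h | h <;> simp_all
  have hmem' : ∀ w ∈ cubeFace σ, w = setCoord v i (w i) := by
    intro w hw
    ext l
    by_cases hli : l = i
    · subst hli; simp
    · rw [setCoord_ne v hli, hw.2 l (decide (v l = 1)) (by simp [hσ, hli])]
      rcases hc l with h | h <;> simp [h]
  have hcell : ∀ a ∈ Set.Icc (0 : ℝ) 1, S.chart C (setCoord v i a) ∈ S.cell E := fun a ha => by
    rw [cell, hE]; exact ⟨_, hmem a ha, rfl⟩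
  set φ : unitInterval → X := fun a => S.chart C (setCoord v i (flipLevel false a)) with hφ
  have hf : S.IsFiber ⟨C, i⟩ φ := isFiber_chart hv i false
  obtain ⟨l, hl⟩ := hf.transfer (a := halfLevel) halfLevel_mem_Ioo (D := E)
    (hcell _ (by norm_num))
  obtain ⟨w, hw, hwa⟩ := hl.mem_cell halfLevel
  obtain ⟨o, ho, H⟩ := hl.exists_at hw hwa.symm
  -- Every point of the cube `E` lies on `φ`, along which only the coordinate `l` varies; so there
  -- is no other direction.
  have hdim : S.dim E = 1 := by
    have hsub : ∀ l' : Fin (S.dim E), l' = l := by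
      intro l'
      by_contra hne
      obtain ⟨a, ha, haw⟩ : ∃ a ∈ Set.Icc (0 : ℝ) 1, a ≠ w l' := by
        by_cases h0 : w l' = 0
        · exact ⟨1, by simp, by rw [h0]; norm_num⟩
        · exact ⟨0, by simp, Ne.symm h0⟩
      have hm := setCoord_mem_unitCube hw l' ha
      obtain ⟨u, hu, hu'⟩ : S.chart E (setCoord w l' a) ∈ S.chart C '' cubeFace σ :=
        hE ▸ ⟨_, hm, rfl⟩
      have hu2 : φ ⟨u i, hu.1 i⟩ = S.chart E (setCoord w l' a) := by
        rw [← hu', hφ]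
        change S.chart C (setCoord v i (u i)) = _
        rw [← hmem' u hu]
      rw [H] at hu2
      have e := S.injOn E (setCoord_mem_unitCube hw l (flipLevel_mem_Icc (hu.1 i))) hm hu2
      have e' := congrArg (fun v : EuclideanSpace ℝ (Fin (S.dim E)) => v l') e
      simp only [setCoord_same, setCoord_ne w hne] at e'
      exact haw e'.symm
    have := Fintype.card_eq_one_iff.2 ⟨l, hsub⟩
    simpa using this
  have hv1 : 1 - v i ∈ Set.Icc (0 : ℝ) 1 := ⟨by linarith [(hv i).2], by linarith [(hv i).1]⟩
  have hne : S.chart C v ≠ S.chart C (setCoord v i (1 - v i)) := fun h => by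
    have e := S.injOn C hv (setCoord_mem_unitCube hv i hv1) h
    have e' := congrArg (fun v : EuclideanSpace ℝ (Fin (S.dim C)) => v i) e
    simp only [setCoord_same] at e'
    rcases hc i with h | h <;> rw [h] at e' <;> norm_num at e'
  refine ⟨E, ⟨hdim, (isVertex_chart_iff hv).2 hc,
    (isVertex_chart_iff (setCoord_mem_unitCube hv i hv1)).2 fun l => ?_, hne, ?_,
    hcell _ hv1⟩, hdim, φ halfLevel, hl.mem_cell _,
    mem_wallSet_iff.2 ⟨φ, ⟨_, SameWall.refl _, hf⟩, rfl⟩⟩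
  · by_cases h : l = i
    · subst h
      rw [setCoord_same]
      rcases hc l with h | h <;> simp [h]
    · rw [setCoord_ne v h]; exact hc l
  · have := hcell (v i) (hv i)
    rwa [setCoord_self] at this

/-- The wall dual to an edge is unique and passes through the midpoint of the edge. -/
theorem Dual.exists_eq {E : S.Cube} {W : S.Wall} (h : S.Dual E W) :
    ∃ i : Fin (S.dim E), W = S.wallOf ⟨E, i⟩ := by
  obtain ⟨m, rfl⟩ := W.exists_eq
  obtain ⟨-, p, ⟨v, hv, rfl⟩, hp⟩ := h
  obtain ⟨i, -, hi⟩ := (chart_mem_wallSet_iff hv).1 hp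
  exact ⟨i, Subtype.ext (wallSet_eq hi)⟩

theorem Dual.unique {E : S.Cube} {W W' : S.Wall} (h : S.Dual E W) (h' : S.Dual E W') : W = W' := by
  obtain ⟨i, rfl⟩ := h.exists_eq
  obtain ⟨l, rfl⟩ := h'.exists_eq
  have : i = l := by
    have h1 := h.1
    apply Fin.ext
    omega
  rw [this]

theorem chart_cubeCenter_mem {C : S.Cube} (i : Fin (S.dim C)) :
    S.chart C (cubeCenter _) ∈ (S.wallOf ⟨C, i⟩).1 :=
  (chart_mem_wallSet_iff (cubeCenter_mem _)).2 ⟨i, rfl, SameWall.refl _⟩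

variable {𝒜 : Set (Set X)}

theorem geodConvex_sInter (hX : IsCAT0 X) (h𝒜 : ∀ A ∈ 𝒜, S.IsHalfSpace A) :
    GeodConvex (⋂₀ 𝒜) := fun x hx y hy _ hp A hA =>
  (h𝒜 A hA).geodConvex hX x (hx A hA) y (hy A hA) hp

theorem isClosed_sInter_halfSpaces (h𝒜 : ∀ A ∈ 𝒜, S.IsHalfSpace A) : IsClosed (⋂₀ 𝒜) :=
  isClosed_sInter fun A hA => by
    obtain ⟨W, x, -, rfl⟩ := h𝒜 A hA
    exact isClosed_closure

/-- The midpoint of an edge with an end in an intersection of half-spaces belongs to the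
intersection. -/
theorem chart_cubeCenter_mem_sInter (hX : IsCAT0 X) (h𝒜 : ∀ A ∈ 𝒜, S.IsHalfSpace A) {E : S.Cube}
    (hE : S.dim E = 1) {x : X} (hx : x ∈ ⋂₀ 𝒜) (hxv : S.IsVertex x) (hxE : x ∈ S.cell E) :
    S.chart E (cubeCenter _) ∈ ⋂₀ 𝒜 := by
  intro A hA
  have hxA := hx A hA
  obtain ⟨m, x₀, -, rfl⟩ := (h𝒜 A hA).exists_eq hX
  have hx₀ := sameSide_of_mem_closure hX hxA (hxv.notMem_wallSet m)
  obtain ⟨v, hv, rfl⟩ := hxE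
  have hvc := (isVertex_chart_iff hv).1 hxv
  rw [Metric.mem_closure_iff]
  intro ε hε
  -- points between the end and the midpoint
  obtain ⟨t, ht0, ht1, htε⟩ : ∃ t : ℝ, 0 < t ∧ t < 1 ∧ t < ε :=
    ⟨min (1 / 2) (ε / 2), lt_min (by norm_num) (by linarith),
      (min_le_left _ _).trans_lt (by norm_num), (min_le_right _ _).trans_lt (by linarith)⟩
  set w := AffineMap.lineMap (cubeCenter (S.dim E)) v t with hw
  have hwm : w ∈ unitCube (S.dim E) :=
    convex_unitCube.lineMap_mem (cubeCenter_mem _) hv ⟨ht0.le, ht1.le⟩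
  have hwi : ∀ i, w i = 1 / 2 + t * (v i - 1 / 2) := fun i => by
    simp [hw, AffineMap.lineMap_apply]; ring
  refine ⟨S.chart E w, SameSide.trans hX hx₀ (sameSide_chart hX hv hwm fun i _ => ?_), ?_⟩
  · rw [hwi]
    rcases hvc i with h | h <;> rw [h]
    · left; constructor <;> nlinarith
    · right; constructor <;> nlinarith
  · refine (dist_chart_le (cubeCenter_mem _) hwm).trans_lt ?_
    rw [hw, dist_left_lineMap, Real.norm_of_nonneg ht0.le]
    have hd : dist (cubeCenter (S.dim E)) v ≤ 1 := by
      have := dist_sq_eq_sum (cubeCenter (S.dim E)) v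
      have h2 : ∑ l, (cubeCenter (S.dim E) l - v l) ^ 2 ≤ ∑ _l : Fin (S.dim E), (1 : ℝ) := by
        refine Finset.sum_le_sum fun l _ => ?_
        rw [cubeCenter_apply]
        rcases hvc l with h | h <;> rw [h] <;> norm_num
      rw [← this] at h2
      simp only [Finset.sum_const, Finset.card_univ, Fintype.card_fin, hE, one_smul] at h2
      nlinarith [dist_nonneg (x := cubeCenter (S.dim E)) (y := v)]
    nlinarith

/-- Intersections of half-spaces contain the corners of a cube between corners they contain. -/
theorem chart_mem_sInter_of_between (hX : IsCAT0 X) (h𝒜 : ∀ A ∈ 𝒜, S.IsHalfSpace A) {C : S.Cube}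
    {v w u : EuclideanSpace ℝ (Fin (S.dim C))} (hv : v ∈ unitCube (S.dim C))
    (hw : w ∈ unitCube (S.dim C)) (hu : u ∈ unitCube (S.dim C))
    (hvc : ∀ i, v i = 0 ∨ v i = 1) (hwc : ∀ i, w i = 0 ∨ w i = 1)
    (huc : ∀ i, u i = v i ∨ u i = w i) (hvZ : S.chart C v ∈ ⋂₀ 𝒜) (hwZ : S.chart C w ∈ ⋂₀ 𝒜) :
    S.chart C u ∈ ⋂₀ 𝒜 := by
  intro A hA
  have hvA := hvZ A hA
  have hwA := hwZ A hA
  obtain ⟨m, x₀, -, rfl⟩ := (h𝒜 A hA).exists_eq hX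
  have h1 := sameSide_of_mem_closure hX hvA (((isVertex_chart_iff hv).2 hvc).notMem_wallSet m)
  have h2 := sameSide_of_mem_closure hX hwA (((isVertex_chart_iff hw).2 hwc).notMem_wallSet m)
  have h3 : S.SameSide m (S.chart C v) (S.chart C w) := SameSide.trans hX h1.symm h2
  refine subset_closure (SameSide.trans hX h1 (sameSide_chart hX hv hu fun i hi => ?_))
  -- Otherwise the midpoint of `v` and `w` would lie on the wall, although the wall does not
  -- separate these corners.
  have hvw : v i = w i := by
    by_contra hne
    set c := AffineMap.lineMap v w (1 / 2 : ℝ) with hc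
    have hcm : c ∈ unitCube (S.dim C) := convex_unitCube.lineMap_mem hv hw (by norm_num)
    suffices hcseg : S.chart C c ∈ geodSeg (S.chart C v) (S.chart C w) by
      refine Set.disjoint_left.1 h3 hcseg ((chart_mem_wallSet_iff hcm).2 ⟨i, ?_, hi⟩)
      have : c i = v i + 1 / 2 * (w i - v i) := by simp [hc, AffineMap.lineMap_apply]; ring
      rw [this]
      rcases hvc i with h | h <;> rcases hwc i with h' | h' <;> rw [h, h'] <;> first
        | exact absurd (h.trans h'.symm) hne
        | norm_num
    · change dist _ _ + dist _ _ = dist _ _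
      rw [dist_chart_eq hX hv hcm, dist_chart_eq hX hcm hw, dist_chart_eq hX hv hw, hc,
        dist_left_lineMap, dist_lineMap_right]
      norm_num; ring
  have hui : u i = v i := by rcases huc i with h | h <;> simp [h, hvw]
  rw [hui]
  rcases hvc i with h | h <;> rw [h] <;> norm_num

/-- If an intersection of half-spaces contains a vertex, then every cube meeting it has a corner
in it. -/
theorem exists_vertex_mem_sInter (hX : IsCAT0 X) (h𝒜 : ∀ A ∈ 𝒜, S.IsHalfSpace A) {x : X}
    (hx : x ∈ ⋂₀ 𝒜) (hxv : S.IsVertex x) {C : S.Cube} {p : X} (hpC : p ∈ S.cell C)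
    (hp : p ∈ ⋂₀ 𝒜) : ∃ y ∈ S.cell C, S.IsVertex y ∧ y ∈ ⋂₀ 𝒜 := by
  obtain ⟨v, hv, rfl⟩ := hpC
  -- Round `v` to the nearest corner. A tie in coordinate `i` means that the point lies on a wall
  -- with this direction; it is decided by the end of the fiber on the side of `x`.
  have key : ∀ i, ∃ ε : ℝ, (ε = 0 ∨ ε = 1) ∧ (v i < 1 / 2 → ε = 0) ∧ (1 / 2 < v i → ε = 1) ∧
      (v i = 1 / 2 → S.SameSide ⟨C, i⟩ (S.chart C (setCoord v i ε)) x) := by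
    intro i
    rcases lt_trichotomy (v i) (1 / 2) with h | h | h
    · exact ⟨0, .inl rfl, fun _ => rfl, fun h' => by linarith, fun h' => by linarith⟩
    · have hf : S.InWall ⟨C, i⟩ (fun a : unitInterval => S.chart C (setCoord v i (flipLevel false a))) :=
        ⟨_, SameWall.refl _, isFiber_chart hv i false⟩
      rcases hf.sameSide_or hX (hxv.notMem_wallSet _) with h' | h'
      · exact ⟨0, .inl rfl, fun h => by linarith, fun h => by linarith, fun _ => by simpa using h'⟩
      · exact ⟨1, .inr rfl, fun h => by linarith, fun h => by linarith, fun _ => by simpa using h'⟩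
    · exact ⟨1, .inr rfl, fun h' => by linarith, fun h' => rfl, fun h' => by linarith⟩
  choose ε hε h0 h1 hhalf using key
  set u : EuclideanSpace ℝ (Fin (S.dim C)) := WithLp.toLp 2 ε with hu
  have hui : ∀ i, u i = ε i := fun i => rfl
  have hum : u ∈ unitCube (S.dim C) := fun i => by
    rw [hui]; rcases hε i with h | h <;> simp [h]
  refine ⟨S.chart C u, S.chart_mem_cell hum, (isVertex_chart_iff hum).2 hε, fun A hA => ?_⟩
  have hxA := hx A hA
  have hpA := hp A hA
  obtain ⟨m, x₀, -, rfl⟩ := (h𝒜 A hA).exists_eq hX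
  have hx₀ := sameSide_of_mem_closure hX hxA (hxv.notMem_wallSet m)
  apply subset_closure
  by_cases hV : S.chart C v ∈ S.wallSet m
  · obtain ⟨i, hvi, hi⟩ := (chart_mem_wallSet_iff hv).1 hV
    have hs := (hhalf i hvi).congr hi.symm
    have hεI : ε i ∈ Set.Icc (0 : ℝ) 1 := by rcases hε i with h | h <;> simp [h]
    refine SameSide.trans hX hx₀ (SameSide.trans hX hs.symm (sameSide_chart hX
      (setCoord_mem_unitCube hv i hεI) hum fun l hl => ?_))
    obtain rfl := direction_unique_of_sameWall hX hi hl
    rw [setCoord_same, hui]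
    rcases hε i with h | h <;> rw [h] <;> norm_num
  · have hp₀ := sameSide_of_mem_closure hX hpA hV
    refine SameSide.trans hX hp₀ (sameSide_chart hX hv hum fun i hi => ?_)
    rw [hui]
    rcases lt_trichotomy (v i) (1 / 2) with h | h | h
    · left; rw [h0 i h]; exact ⟨h, by norm_num⟩
    · exact absurd ((chart_mem_wallSet_iff hv).2 ⟨i, h, hi⟩) hV
    · right; rw [h1 i h]; exact ⟨h, by norm_num⟩

end CubeComplex

/-! ### Colours along geodesics -/

section Colours

variable {G X : Type*} [Group G] [MetricSpace X] [MulAction G X] {S : CubeComplex X}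
  {K : Subgroup G} {R : ℝ} {k j : ℕ} {Z : Set X} {H : Subgroup G} {c : X → QuotWall S K → ℕ}

theorem quotDist_nonneg (a b : QuotSpace K X) : 0 ≤ quotDist K a b := by
  refine Real.sInf_nonneg ?_
  rintro _ ⟨x, -, y, -, rfl⟩
  exact dist_nonneg

theorem quotDist_le (x y : X) : quotDist K (quotMap K x) (quotMap K y) ≤ dist x y := by
  refine csInf_le ⟨0, ?_⟩ ⟨x, rfl, y, rfl, rfl⟩
  rintro _ ⟨x, -, y, -, rfl⟩
  exact dist_nonneg

theorem wallGraph_adj_of_dist_le {V W : S.Wall} {p q : X} (hp : p ∈ V.1) (hq : q ∈ W.1)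
    (hd : dist p q ≤ R) (hne : V.bar K ≠ W.bar K) : (wallGraph S K R).Adj (V.bar K) (W.bar K) := by
  refine ⟨hne, le_trans (csInf_le ⟨0, ?_⟩ ⟨_, ⟨p, hp, rfl⟩, _, ⟨q, hq, rfl⟩, rfl⟩)
    ((quotDist_le p q).trans hd)⟩
  rintro _ ⟨a, -, b, -, rfl⟩
  exact quotDist_nonneg a b

/-- The two colourings agree on a ball about the image of `W` whose radius is a colour, hence at
least `1`. As `V` is within `R` of `W`, its image lies in this ball. -/
theorem IsStageTriple.colour_eq_of_joins (hZ : IsStageTriple S K R k j Z H c) {E : S.Cube} {x y : X}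
    {W V : S.Wall} (hE : S.Joins E x y) (hW : S.Dual E W) (hx : x ∈ Z) (hy : y ∈ Z) {p q : X}
    (hp : p ∈ W.1) (hq : q ∈ V.1) (hd : dist p q ≤ R) : c x (V.bar K) = c y (V.bar K) := by
  have hcx := hZ.colouring x hx hE.2.1
  have hcy := hZ.colouring y hy hE.2.2.1
  have hmem : c x ∈ colourClass (wallGraph S K R) (k + 1) (W.bar K) (c y) := by
    rw [← hZ.compatible E x y W hE hW hx hy]
    exact ⟨hcx, fun _ _ => rfl⟩
  refine hmem.2 _ ?_
  have h1 : ((1 : ℕ) : ℕ∞) ≤ (c y (W.bar K) : ℕ∞) := by exact_mod_cast (hcy.1 (W.bar K)).1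
  refine le_trans ?_ h1
  by_cases hne : W.bar K = V.bar K
  · rw [hne, SimpleGraph.edist_self]; exact bot_le
  · have hadj := wallGraph_adj_of_dist_le hp hq hd hne
    rw [SimpleGraph.edist_eq_one_iff_adj.2 hadj]; rfl

/-- Walk from `x` to `y` by changing one coordinate at a time. All corners on the way lie in `Z`,
and the wall of each edge crosses the cube within `1 / 2` of `p`, hence within `R` of `V`. -/
theorem IsStageTriple.colour_eq_of_cube (hX : IsCAT0 X) (hZ : IsStageTriple S K R k j Z H c)
    {C : S.Cube} {V : S.Wall} {x y p q : X} (hx : x ∈ Z) (hy : y ∈ Z) (hxv : S.IsVertex x)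
    (hyv : S.IsVertex y) (hxC : x ∈ S.cell C) (hyC : y ∈ S.cell C) (hpC : p ∈ S.cell C)
    (hq : q ∈ V.1) (hd : dist p q + 1 / 2 ≤ R) : c x (V.bar K) = c y (V.bar K) := by
  classical
  obtain ⟨𝒜, h𝒜, hZ𝒜⟩ := hZ.halfSpaces
  obtain ⟨v, hv, rfl⟩ := hxC
  obtain ⟨w, hw, rfl⟩ := hyC
  obtain ⟨a, ha, rfl⟩ := hpC
  have hvc := (CubeComplex.isVertex_chart_iff hv).1 hxv
  have hwc := (CubeComplex.isVertex_chart_iff hw).1 hyv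
  set u : Finset (Fin (S.dim C)) → EuclideanSpace ℝ (Fin (S.dim C)) :=
    fun s => WithLp.toLp 2 fun i => if i ∈ s then w i else v i with hu
  have hui : ∀ s i, u s i = if i ∈ s then w i else v i := fun s i => rfl
  have huc : ∀ s i, u s i = 0 ∨ u s i = 1 := fun s i => by
    rw [hui]; split_ifs; exacts [hwc i, hvc i]
  have hum : ∀ s, u s ∈ unitCube (S.dim C) := fun s i => by
    rw [hui]; split_ifs; exacts [hw i, hv i]
  have huZ : ∀ s, S.chart C (u s) ∈ Z := fun s => by
    rw [hZ𝒜] at hx hy ⊢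
    refine CubeComplex.chart_mem_sInter_of_between hX h𝒜 hv hw (hum s) hvc hwc (fun i => ?_) hx hy
    rw [hui]; split_ifs <;> simp
  have key : ∀ s, c (S.chart C v) (V.bar K) = c (S.chart C (u s)) (V.bar K) := by
    intro s
    induction s using Finset.induction_on with
    | empty =>
      have : u ∅ = v := by ext i; simp [hui]
      rw [this]
    | insert i s hi ih =>
      rw [ih]
      by_cases hvw : v i = w i
      · have : u (insert i s) = u s := by
          ext l
          rw [hui, hui]
          by_cases hl : l = i
          · subst hl; simp [hvw]
          · simp [hl]
        rw [this]
      · have hflip : u (insert i s) = setCoord (u s) i (1 - u s i) := by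
          ext l
          by_cases hl : l = i
          · subst hl
            rw [setCoord_same, hui, hui]
            simp only [Finset.mem_insert_self, if_true, hi, if_false]
            rcases hvc l with h | h <;> rcases hwc l with h' | h' <;> rw [h, h'] <;> first
              | exact absurd (h.trans h'.symm) hvw
              | norm_num
          · rw [setCoord_ne _ hl, hui, hui]; simp [hl]
        obtain ⟨E, hE, hdual⟩ := CubeComplex.exists_joins (hum s) (huc s) i
        rw [← hflip] at hE
        have hm : setCoord a i (1 / 2) ∈ unitCube (S.dim C) :=
          setCoord_mem_unitCube ha i (by norm_num)
        refine hZ.colour_eq_of_joins hE hdual (huZ s) (huZ _)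
          ((CubeComplex.chart_mem_wallSet_iff hm).2 ⟨i, setCoord_same _ _ _,
            CubeComplex.SameWall.refl _⟩) hq ?_
        have h1 : dist (S.chart C (setCoord a i (1 / 2))) (S.chart C a) ≤ 1 / 2 := by
          refine (CubeComplex.dist_chart_le hm ha).trans ?_
          nth_rw 2 [← setCoord_self a i]
          rw [dist_setCoord_setCoord, abs_le]
          constructor <;> linarith [(ha i).1, (ha i).2]
        linarith [dist_triangle (S.chart C (setCoord a i (1 / 2))) (S.chart C a) q]
  have := key Finset.univ
  have hw' : u Finset.univ = w := by ext i; simp [hui]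
  rwa [hw'] at this

/-- The cubes `C` and `D` intersect in a cube containing `p`; it has a corner in `Z`, through which
`x` and `y` are compared. -/
theorem IsStageTriple.colour_eq_of_star (hX : IsCAT0 X) (hZ : IsStageTriple S K R k j Z H c)
    {C D : S.Cube} {V : S.Wall} {x y p q : X} (hx : x ∈ Z) (hy : y ∈ Z) (hxv : S.IsVertex x)
    (hyv : S.IsVertex y) (hxC : x ∈ S.cell C) (hyD : y ∈ S.cell D) (hpC : p ∈ S.cell C)
    (hpD : p ∈ S.cell D) (hp : p ∈ Z) (hq : q ∈ V.1) (hd : dist p q + 1 / 2 ≤ R) :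
    c x (V.bar K) = c y (V.bar K) := by
  obtain ⟨𝒜, h𝒜, hZ𝒜⟩ := hZ.halfSpaces
  obtain ⟨E, hE⟩ := CubeComplex.exists_cell_eq_inter ⟨p, hpC, hpD⟩
  obtain ⟨z, hzE, hzv, hzZ⟩ := CubeComplex.exists_vertex_mem_sInter hX h𝒜 (hZ𝒜 ▸ hx) hxv
    (hE ▸ ⟨hpC, hpD⟩ : p ∈ S.cell E) (hZ𝒜 ▸ hp)
  rw [← hZ𝒜] at hzZ
  rw [hE] at hzE
  exact (hZ.colour_eq_of_cube hX hx hzZ hxv hzv hxC hzE.1 hpC hq hd).trans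
    (hZ.colour_eq_of_cube hX hzZ hy hzv hyv hzE.2 hyD hpD hq hd)

/-- The colour of a wall does not change along a geodesic in `Z` that stays close to the wall. -/
theorem IsStageTriple.colour_eq_of_geodSeg (hX : IsCAT0 X) (hZ : IsStageTriple S K R k j Z H c)
    {C D : S.Cube} {V : S.Wall} {x y p p' : X} (hx : x ∈ Z) (hy : y ∈ Z) (hxv : S.IsVertex x)
    (hyv : S.IsVertex y) (hxC : x ∈ S.cell C) (hyD : y ∈ S.cell D) (hpC : p ∈ S.cell C)
    (hpD : p' ∈ S.cell D) (hp : p ∈ Z) (hp' : p' ∈ Z)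
    (hd : ∀ z ∈ geodSeg p p', ∃ q ∈ V.1, dist z q + 1 / 2 ≤ R) :
    c x (V.bar K) = c y (V.bar K) := by
  obtain ⟨𝒜, h𝒜, hZ𝒜⟩ := hZ.halfSpaces
  have hconv : geodSeg p p' ⊆ Z := by
    rw [hZ𝒜] at hp hp' ⊢
    exact CubeComplex.geodConvex_sInter hX h𝒜 p hp p' hp'
  have hvert : ∀ z ∈ Z, ∀ C, z ∈ S.cell C → ∃ u ∈ S.cell C, S.IsVertex u ∧ u ∈ Z := by
    intro z hz C hzC
    rw [hZ𝒜] at hz hx ⊢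
    exact CubeComplex.exists_vertex_mem_sInter hX h𝒜 hx hxv hzC hz
  -- Quantifying over all cubes through `z` and `z'` makes the relation symmetric and composable.
  -- Locally it holds because nearby points share a cube, so it spreads over the connected geodesic.
  let P : X → X → Prop := fun z z' => ∀ x ∈ Z, ∀ y ∈ Z, S.IsVertex x → S.IsVertex y →
    ∀ C D, x ∈ S.cell C → z ∈ S.cell C → y ∈ S.cell D → z' ∈ S.cell D →
      c x (V.bar K) = c y (V.bar K)
  have hPsymm : ∀ z z', P z z' → P z' z := fun z z' h x hx y hy hxv hyv C D h1 h2 h3 h4 =>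
    (h y hy x hx hyv hxv D C h3 h4 h1 h2).symm
  have key : P p p' := by
    refine (hX.isPreconnected_geodSeg p p').induction₂' P ?_ ?_ (left_mem_geodSeg p p')
      (right_mem_geodSeg p p')
    · intro z hz
      obtain ⟨ε, hε, hstar⟩ := CubeComplex.exists_star S z
      refine eventually_nhdsWithin_iff.2 ?_
      filter_upwards [Metric.ball_mem_nhds z hε] with z' hz' hz'seg
      suffices h : P z z' from ⟨h, hPsymm _ _ h⟩
      intro x hx y hy hxv hyv C D h1 h2 h3 h4
      obtain ⟨E, hzE, hz'E⟩ := hstar z' (by rw [dist_comm]; exact hz')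
      obtain ⟨u, huE, huv, huZ⟩ := hvert z (hconv hz) E hzE
      obtain ⟨q, hq, hqd⟩ := hd z hz
      obtain ⟨q', hq', hqd'⟩ := hd z' hz'seg
      exact (hZ.colour_eq_of_star hX hx huZ hxv huv h1 huE h2 hzE (hconv hz) hq hqd).trans
        (hZ.colour_eq_of_star hX huZ hy huv hyv huE h3 hz'E h4 (hconv hz'seg) hq' hqd')
    · intro z₁ z₂ z₃ _ hz₂ _ h12 h23 x hx y hy hxv hyv C D h1 h2 h3 h4
      obtain ⟨E, hE⟩ := S.cover z₂
      obtain ⟨u, huE, huv, huZ⟩ := hvert z₂ (hconv hz₂) E hE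
      exact (h12 x hx u huZ hxv huv C E h1 h2 huE hE).trans
        (h23 u huZ y hy huv hyv E D huE hE h3 h4)
  exact key x hx y hy hxv hyv C D hxC hpC hyD hpD

end Colours

/-! ### Group actions on CAT(0) spaces -/

/-- The geodesics from `a` and `b` to `v` approach each other linearly towards `v`. The point `q` is
within `δ + D` of `v`, a small fraction of a length of at least `N`, so the gap there is at most `(δ
+ D) * D / N`. -/
theorem IsCAT0.exists_dist_le_of_mem_geodSeg {X : Type*} [MetricSpace X] (hX : IsCAT0 X) {B : Set X} (hB : GeodConvex B)
    {u v q a b : X} {δ D N ε : ℝ} (hv : v ∈ B) (hb : b ∈ B) (hab : dist a b ≤ D)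
    (huv : dist u v ≤ D) (hq : q ∈ geodSeg a v) (huq : dist u q ≤ δ) (hN : 0 < N)
    (hav : N ≤ dist a v) (hDN : (δ + D) * D ≤ ε * N) : ∃ p ∈ B, dist u p ≤ δ + ε := by
  obtain ⟨t, ht, hqt⟩ := exists_isGeodPoint_of_mem_geodSeg hq
  obtain ⟨p, hp⟩ := hX.1.exists_isGeodPoint b v ht
  refine ⟨p, hB b hb v hv hp.mem_geodSeg, ?_⟩
  have h1 := hX.dist_isGeodPoint_le ht hqt hp
  rw [dist_self, mul_zero, add_zero] at h1
  have h2 : (1 - t) * dist a v ≤ δ + D := by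
    rw [← hqt.2]
    linarith [dist_triangle q u v, dist_comm q u]
  have ht' : 0 ≤ 1 - t := by linarith [ht.2]
  have hD : 0 ≤ D := dist_nonneg.trans hab
  have h3 : (1 - t) * dist a b ≤ (1 - t) * D := mul_le_mul_of_nonneg_left hab ht'
  have h4 : (1 - t) * D ≤ ε := by
    refine le_of_mul_le_mul_right ?_ hN
    have h5 : (1 - t) * N ≤ δ + D := (mul_le_mul_of_nonneg_left hav ht').trans h2
    nlinarith [mul_le_mul_of_nonneg_right h5 hD]
  linarith [dist_triangle u q p]

section Actions

variable {G X : Type*} [Group G] [MetricSpace X] [MulAction G X] [IsIsometricSMul G X]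

/-- By properness and compactness, only finitely many translates of `B` meet the ball of radius `r /
2` about `x`; their union is a compact neighbourhood of `x`. -/
theorem IsProperAction.weaklyLocallyCompactSpace (h : IsProperAction G X) {B : Set X}
    (hB : IsCompact B) (hcov : ∀ z, ∃ g : G, g • z ∈ B) : WeaklyLocallyCompactSpace X := by
  refine ⟨fun x => ?_⟩
  obtain ⟨r, hr, hfin⟩ := h x
  have hpt : ∀ b : X, {g : G | dist (g • b) x < r}.Finite := by
    intro b
    rcases Set.eq_empty_or_nonempty {g : G | dist (g • b) x < r} with he | ⟨g₀, hg₀⟩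
    · rw [he]; exact Set.finite_empty
    · refine (hfin.image fun k => k * g₀).subset fun g hg => ⟨g * g₀⁻¹, ?_, by simp⟩
      refine ⟨g • b, ⟨g₀ • b, hg₀, ?_⟩, hg⟩
      simp [mul_smul]
  obtain ⟨t, -, ht, hBt⟩ := hB.finite_cover_balls (half_pos hr)
  have hF : {g : G | ∃ b ∈ B, dist (g • b) x < r / 2}.Finite := by
    refine (ht.biUnion fun b _ => hpt b).subset ?_
    rintro g ⟨b, hb, hgb⟩
    obtain ⟨b', hb', hbb'⟩ := Set.mem_iUnion₂.1 (hBt hb)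
    refine Set.mem_iUnion₂.2 ⟨b', hb', ?_⟩
    have : dist (g • b') (g • b) < r / 2 := by rw [dist_smul, dist_comm]; exact hbb'
    change dist (g • b') x < r
    linarith [dist_triangle (g • b') (g • b) x]
  refine ⟨_, hF.isCompact_biUnion fun g _ => hB.smul g,
    Filter.mem_of_superset (Metric.ball_mem_nhds x (half_pos hr)) fun z hz => ?_⟩
  obtain ⟨g, hg⟩ := hcov z
  refine Set.mem_iUnion₂.2 ⟨g⁻¹, ⟨g • z, hg, by simpa using hz⟩, g • z, hg, by simp⟩

/-- A metric space with a proper cocompact action by isometries is complete. -/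
theorem IsProperAction.completeSpace (h : IsProperAction G X) {B : Set X}
    (hB : IsCompact B) (hcov : ∀ z, ∃ g : G, g • z ∈ B) : CompleteSpace X := by
  have := h.weaklyLocallyCompactSpace hB hcov
  obtain ⟨B', hB', hBB'⟩ := exists_compact_superset hB
  obtain ⟨ε, hε, hεB⟩ := hB.exists_thickening_subset_open isOpen_interior hBB'
  refine Metric.complete_of_cauchySeq_tendsto fun u hu => ?_
  obtain ⟨n₀, hn₀⟩ := Metric.cauchySeq_iff'.1 hu ε hε
  obtain ⟨g, hg⟩ := hcov (u n₀)
  have hmem : ∀ n, g • u (n + n₀) ∈ B' := fun n => by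
    refine interior_subset (hεB (Metric.mem_thickening_iff.2 ⟨_, hg, ?_⟩))
    rw [dist_smul]
    exact hn₀ _ (Nat.le_add_left _ _)
  have hu' : CauchySeq fun n => g • u (n + n₀) :=
    (isometry_smul X g).uniformContinuous.comp_cauchySeq
      (hu.comp_tendsto (Filter.tendsto_add_atTop_nat n₀))
  obtain ⟨z, -, hz⟩ := cauchySeq_tendsto_of_isComplete hB'.isComplete hmem hu'
  refine ⟨g⁻¹ • z, (Filter.tendsto_add_atTop_iff_nat n₀).1 ?_⟩
  simpa using hz.const_smul g⁻¹

/-- An isometry of a complete CAT(0) space with a bounded orbit has a fixed point in every closed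
convex invariant set containing the orbit. -/
theorem IsCAT0.exists_fixedPoint [CompleteSpace X] (hX : IsCAT0 X) {Z : Set X} (hcl : IsClosed Z)
    (hconv : GeodConvex Z) {g : G} (hg : ∀ z ∈ Z, g • z ∈ Z) {a : X} (ha : a ∈ Z) {M : ℝ}
    (hM : ∀ n : ℤ, dist a (g ^ n • a) ≤ M) : ∃ z ∈ Z, g • z = z := by
  -- The radii of balls with center in `Z` that contain the orbit; the infimum is the circumradius
  -- relative to `Z`. The fixed point will be the circumcentre.
  set T : Set ℝ := {ρ | 0 ≤ ρ ∧ ∃ z ∈ Z, ∀ n : ℤ, dist z (g ^ n • a) ≤ ρ} with hT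
  have hMT : M ∈ T := ⟨dist_nonneg.trans (hM 0), a, ha, hM⟩
  have hbdd : BddBelow T := ⟨0, fun ρ hρ => hρ.1⟩
  set ρ₀ := sInf T with hρ₀
  have hρ₀0 : 0 ≤ ρ₀ := Real.sInf_nonneg fun ρ hρ => hρ.1
  -- The midpoint of two centers is a center for a smaller radius, so centers of nearly minimal
  -- balls are close. This yields existence by completeness, and uniqueness.
  have key : ∀ ρ, ∀ z ∈ Z, ∀ w ∈ Z, (∀ n : ℤ, dist z (g ^ n • a) ≤ ρ) →
      (∀ n : ℤ, dist w (g ^ n • a) ≤ ρ) → dist z w ^ 2 ≤ 4 * (ρ ^ 2 - ρ₀ ^ 2) := by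
    intro ρ z hz w hw hzρ hwρ
    obtain ⟨m, hm⟩ := hX.1.exists_isGeodPoint z w (t := 1 / 2) (by norm_num)
    have hd : ∀ n : ℤ, dist m (g ^ n • a) ^ 2 ≤ ρ ^ 2 - dist z w ^ 2 / 4 := by
      intro n
      have h1 := hX.dist_sq_le (t := 1 / 2) (by norm_num) hm (g ^ n • a)
      have h2 := pow_le_pow_left₀ dist_nonneg (hzρ n) 2
      have h3 := pow_le_pow_left₀ dist_nonneg (hwρ n) 2
      linarith
    have hle : ρ₀ ≤ √(ρ ^ 2 - dist z w ^ 2 / 4) :=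
      csInf_le hbdd ⟨Real.sqrt_nonneg _, m, hconv z hz w hw hm.mem_geodSeg,
        fun n => Real.le_sqrt_of_sq_le (hd n)⟩
    have h0 : 0 ≤ ρ ^ 2 - dist z w ^ 2 / 4 := (sq_nonneg _).trans (hd 0)
    have h1 := pow_le_pow_left₀ hρ₀0 hle 2
    rw [Real.sq_sqrt h0] at h1
    linarith
  set s : ℕ → Set X :=
    fun i => {z | z ∈ Z ∧ ∀ n : ℤ, dist z (g ^ n • a) ≤ ρ₀ + 1 / ((i : ℝ) + 1)} with hs
  have hscl : ∀ i, IsClosed (s i) := fun i => by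
    have : s i = Z ∩ ⋂ n : ℤ, Metric.closedBall (g ^ n • a) (ρ₀ + 1 / ((i : ℝ) + 1)) := by
      ext z; simp [hs, Metric.mem_closedBall]
    rw [this]
    exact hcl.inter (isClosed_iInter fun n => Metric.isClosed_closedBall)
  have hsne : ∀ i, (s i).Nonempty := fun i => by
    obtain ⟨ρ, ⟨-, z, hz, hzρ⟩, hlt⟩ := exists_lt_of_csInf_lt ⟨M, hMT⟩
      (show sInf T < ρ₀ + 1 / ((i : ℝ) + 1) from lt_add_of_pos_right _ (by positivity))
    exact ⟨z, hz, fun n => (hzρ n).trans hlt.le⟩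
  have hanti : ∀ i l, i ≤ l → s l ⊆ s i := fun i l hil z hz => by
    refine ⟨hz.1, fun n => (hz.2 n).trans ?_⟩
    have : (i : ℝ) ≤ l := by exact_mod_cast hil
    gcongr
  have hdiam : ∀ i, Metric.diam (s i) ≤ √(4 * ((ρ₀ + 1 / ((i : ℝ) + 1)) ^ 2 - ρ₀ ^ 2)) := fun i =>
    Metric.diam_le_of_forall_dist_le (Real.sqrt_nonneg _) fun z hz w hw =>
      Real.le_sqrt_of_sq_le (key _ z hz.1 w hw.1 hz.2 hw.2)
  have hlim : Filter.Tendsto (fun i : ℕ => √(4 * ((ρ₀ + 1 / ((i : ℝ) + 1)) ^ 2 - ρ₀ ^ 2)))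
      Filter.atTop (nhds 0) := by
    have h1 : Filter.Tendsto (fun i : ℕ => 1 / ((i : ℝ) + 1)) Filter.atTop (nhds 0) :=
      tendsto_one_div_add_atTop_nhds_zero_nat
    have hc : Continuous fun x : ℝ => √(4 * ((ρ₀ + x) ^ 2 - ρ₀ ^ 2)) := by fun_prop
    have h2 := (hc.tendsto 0).comp h1
    rwa [add_zero, sub_self, mul_zero, Real.sqrt_zero] at h2
  obtain ⟨z, hz⟩ := Metric.nonempty_iInter_of_nonempty_biInter hscl
    (fun i => Metric.isBounded_closedBall.subset
      (s := s i) (t := Metric.closedBall a (ρ₀ + 1 / ((i : ℝ) + 1))) fun z hz => by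
        simpa using hz.2 0)
    (fun i => (hsne i).mono fun z hz => Set.mem_iInter₂.2 fun l hl => hanti l i hl hz)
    (squeeze_zero (fun _ => Metric.diam_nonneg) hdiam hlim)
  have hzs := Set.mem_iInter.1 hz
  have hzρ : ∀ n : ℤ, dist z (g ^ n • a) ≤ ρ₀ := fun n => by
    have h1 : Filter.Tendsto (fun i : ℕ => ρ₀ + 1 / ((i : ℝ) + 1)) Filter.atTop (nhds (ρ₀ + 0)) :=
      tendsto_one_div_add_atTop_nhds_zero_nat.const_add _
    rw [add_zero] at h1
    exact ge_of_tendsto' h1 fun i => (hzs i).2 n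
  have hzZ := (hzs 0).1
  refine ⟨z, hzZ, ?_⟩
  have hgz : ∀ n : ℤ, dist (g • z) (g ^ n • a) ≤ ρ₀ := fun n => by
    have : g ^ n • a = g • g ^ (n - 1) • a := by
      rw [← mul_smul, ← zpow_one_add]; congr 2; ring
    rw [this, dist_smul]
    exact hzρ _
  have := key ρ₀ (g • z) (hg z hzZ) z hzZ hgz hzρ
  rw [sub_self, mul_zero] at this
  exact dist_eq_zero.1 (pow_eq_zero_iff (two_ne_zero) |>.1 (le_antisymm this (sq_nonneg _)))

/-- In a hyperbolic CAT(0) space, convex sets that are invariant under an isometry with unbounded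
orbits come almost as close to each other as the hyperbolicity constant. -/
theorem IsCAT0.exists_dist_le_of_unbounded (hX : IsCAT0 X) {δ : ℝ} (hδ : IsDeltaHyperbolic X δ)
    {A B : Set X} (hA : GeodConvex A) (hB : GeodConvex B) {g : G} {a b : X}
    (ha : ∀ n : ℤ, g ^ n • a ∈ A) (hb : ∀ n : ℤ, g ^ n • b ∈ B)
    (hunb : ∀ M : ℝ, ∃ n : ℤ, M < dist a (g ^ n • a)) {ε : ℝ} (hε : 0 < ε) :
    ∃ p ∈ A, ∃ q ∈ B, dist p q ≤ δ + ε := by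
  have hδ0 : 0 ≤ δ := by
    obtain ⟨q, -, hq⟩ := hδ a a a a (left_mem_geodSeg a a)
    exact dist_nonneg.trans hq
  set D := dist a b with hD
  have hD0 : 0 ≤ D := dist_nonneg
  set N := (δ + D) * D / ε + 1 with hN
  have hN0 : 0 < N := by positivity
  have hDN : (δ + D) * D ≤ ε * N := by
    have : ε * N = (δ + D) * D + ε := by rw [hN]; field_simp
    linarith
  -- The midpoint `u` is then farther than `N + D` from both ends, so `v`, within `D` of `u`, is
  -- farther than `N` from them.
  obtain ⟨n, hn⟩ := hunb (2 * (N + D))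
  have hhalf : (1 / 2 : ℝ) ∈ Set.Icc (0 : ℝ) 1 := by norm_num
  obtain ⟨u, hu⟩ := hX.1.exists_isGeodPoint a (g ^ n • a) hhalf
  obtain ⟨v, hv⟩ := hX.1.exists_isGeodPoint b (g ^ n • b) hhalf
  have ha0 : a ∈ A := by simpa using ha 0
  have hb0 : b ∈ B := by simpa using hb 0
  have huA := hA a ha0 _ (ha n) hu.mem_geodSeg
  have hvB := hB b hb0 _ (hb n) hv.mem_geodSeg
  have huv : dist u v ≤ D := by
    have := hX.dist_isGeodPoint_le hhalf hu hv
    rw [dist_smul] at this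
    linarith
  refine ⟨u, huA, ?_⟩
  obtain ⟨q, hq | hq, huq⟩ := hδ a (g ^ n • a) v u hu.mem_geodSeg
  · refine hX.exists_dist_le_of_mem_geodSeg hB hvB hb0 le_rfl huv hq huq hN0 ?_ hDN
    linarith [dist_triangle a v u, hu.1, dist_comm u v]
  · refine hX.exists_dist_le_of_mem_geodSeg hB hvB (hb n) (dist_smul _ _ _).le huv hq huq hN0 ?_ hDN
    linarith [dist_triangle (g ^ n • a) v u, hu.2, dist_comm u v, dist_comm u (g ^ n • a)]

end Actions

/-! ### Translates of walls -/

namespace CubeComplex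

variable {G X : Type*} [Group G] [MetricSpace X] [MulAction G X] {S : CubeComplex X}

/-- On a cube the automorphism is an isometry onto a cube. It permutes the coordinate directions up
to reversal, and reversal fixes the level `1 / 2`. -/
theorem IsCubicalAction.exists_smul_midcube (h : S.IsCubicalAction G) (g : G)
    (m : Σ C : S.Cube, Fin (S.dim C)) : ∃ m', g • S.midcube m = S.midcube m' := by
  classical
  obtain ⟨C, i⟩ := m
  obtain ⟨D, f, hf⟩ := h g C
  set F : EuclideanSpace ℝ (Fin (S.dim C)) → EuclideanSpace ℝ (Fin (S.dim D)) :=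
    fun v => if hv : v ∈ unitCube (S.dim C) then f ⟨v, hv⟩ else 0 with hF
  have hFv : ∀ v : unitCube (S.dim C), F v = f v := fun v => by simp [hF]
  obtain ⟨l, o, hl⟩ := exists_coord_of_isometry (σ := fun _ : Fin (S.dim C) => none)
    (τ := fun _ : Fin (S.dim D) => none) (F := F) (i := i)
    (by
      rw [cubeFace_none, cubeFace_none]
      intro v hv
      rw [hFv ⟨v, hv⟩]
      exact (f ⟨v, hv⟩).2)
    (by
      rw [cubeFace_none, cubeFace_none]
      intro w hw
      refine ⟨f.symm ⟨w, hw⟩, (f.symm ⟨w, hw⟩).2, ?_⟩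
      rw [hFv, f.apply_symm_apply])
    (by
      rw [cubeFace_none]
      intro v hv w hw
      rw [hFv ⟨v, hv⟩, hFv ⟨w, hw⟩]
      exact f.isometry.dist_eq ⟨v, hv⟩ ⟨w, hw⟩) rfl
  rw [cubeFace_none] at hl
  have hcoord : ∀ v : unitCube (S.dim C), (f v).1 l = flipLevel o (v.1 i) := fun v => by
    have e := hl v.1 v.2 (v.1 i) (v.2 i)
    rw [setCoord_self, hFv] at e
    rw [e, setCoord_same]
  refine ⟨⟨D, l⟩, Set.Subset.antisymm ?_ ?_⟩
  · rintro _ ⟨_, ⟨v, ⟨hv, hvi⟩, rfl⟩, rfl⟩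
    refine ⟨f ⟨v, hv⟩, ⟨(f ⟨v, hv⟩).2, ?_⟩, (hf ⟨v, hv⟩).symm⟩
    change (f ⟨v, hv⟩).1 l = _
    rw [hcoord]
    change flipLevel o (v i) = _
    rw [hvi, flipLevel_half]
  · rintro _ ⟨w, ⟨hw, hwl⟩, rfl⟩
    set v := f.symm ⟨w, hw⟩ with hv
    have hfv : f v = ⟨w, hw⟩ := f.apply_symm_apply _
    refine ⟨S.chart C v, ⟨v, ⟨v.2, ?_⟩, rfl⟩, ?_⟩
    · have e := hcoord v
      rw [hfv] at e
      change v.1 i = 1 / 2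
      rw [← flipLevel_flipLevel o (v.1 i), ← e]
      change flipLevel o (w l) = _
      rw [show w l = 1 / 2 from hwl, flipLevel_half]
    · change g • S.chart C v = S.chart D w
      rw [hf v, hfv]

/-- Translation preserves inclusions of midcubes and hence the relation they generate. Applying this
to `g⁻¹` as well gives equality. -/
theorem IsCubicalAction.exists_smul_wallSet (h : S.IsCubicalAction G) (g : G)
    (m : Σ C : S.Cube, Fin (S.dim C)) : ∃ m', g • S.wallSet m = S.wallSet m' := by
  choose t ht using fun g m => h.exists_smul_midcube g m
  have hsame : ∀ (g : G) m m', S.SameWall m m' → S.SameWall (t g m) (t g m') := by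
    intro g m m' hm
    induction hm with
    | rel m m' hm =>
      refine SameWall.of_subset ?_
      rw [← ht, ← ht]
      exact Set.smul_set_mono hm
    | refl => exact SameWall.refl _
    | symm _ _ _ ih => exact ih.symm
    | trans _ _ _ _ _ ih ih' => exact ih.trans ih'
  have hsub : ∀ (g : G) m, g • S.wallSet m ⊆ S.wallSet (t g m) := by
    rintro g m _ ⟨p, hp, rfl⟩
    simp only [wallSet, Set.mem_iUnion, exists_prop] at hp ⊢
    obtain ⟨m', hm', hp⟩ := hp
    exact ⟨t g m', hsame g m m' hm', ht g m' ▸ Set.smul_mem_smul_set hp⟩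
  refine ⟨t g m, (hsub g m).antisymm ?_⟩
  have hback := hsub g⁻¹ (t g m)
  have hmm : S.SameWall (t g⁻¹ (t g m)) m := SameWall.of_subset (by
    rw [← ht, ← ht, inv_smul_smul])
  rw [wallSet_eq hmm] at hback
  exact Set.subset_smul_set_iff.2 hback

end CubeComplex

/-! ### Portals -/

section Portals

variable {G 𝒢 X : Type*} [Group G] [Group 𝒢] [MetricSpace X] [MulAction G X] {S : CubeComplex X}
  {K : Subgroup G} {R : ℝ} {k j : ℕ} {Z : Set X} {H : Subgroup G} {c : X → QuotWall S K → ℕ}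

/-- Walls of `X` that are close to each other and have the same image in `X / K` coincide. -/
theorem HasFiniteWallKernel.eq_of_bar_eq [IsIsometricSMul G X] {φ : G →* 𝒢} {m : ℕ}
    {W : Fin m → S.Wall} {N : Fin m → Subgroup G} (hφ : HasFiniteWallKernel S R φ W N)
    (hcub : S.IsCubicalAction G) {V V' : S.Wall} (hbar : V.bar φ.ker = V'.bar φ.ker) {p q : X}
    (hp : p ∈ V.1) (hq : q ∈ V'.1) (hd : dist p q ≤ 2 * R) {E : S.Cube} (hE : S.Dual E V') :
    V = V' := by
  -- Some `κ` in the kernel moves a point of `V` to a point of `V'` on the edge `E`. The translate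
  -- of `V` is a wall meeting `E`, and only one wall does.
  obtain ⟨κ, hκ, hκV⟩ : ∃ κ ∈ φ.ker, κ • V.1 = V'.1 := by
    obtain ⟨e, heE, heV⟩ := hE.2
    have hset : quotMap φ.ker '' V.1 = quotMap φ.ker '' V'.1 := congrArg Subtype.val hbar
    obtain ⟨w, hw, hwe⟩ : quotMap φ.ker e ∈ quotMap φ.ker '' V.1 := hset ▸ ⟨e, heV, rfl⟩
    obtain ⟨κ, hκ⟩ := Quotient.exact hwe.symm
    refine ⟨κ, κ.2, ?_⟩
    obtain ⟨n, rfl⟩ := V.exists_eq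
    obtain ⟨n', hn'⟩ := hcub.exists_smul_wallSet (κ : G) n
    have hdual : S.Dual E (S.wallOf n') :=
      ⟨hE.1, e, heE, hn'.subset ⟨w, hw, hκ⟩⟩
    rw [← hdual.unique hE]
    exact hn'
  -- Conjugated to the representative `W i`, the kernel element moves it by at most `2 * R` and has
  -- trivial image under `φ`, so separation puts it into `N i` and thus into the stabiliser.
  obtain ⟨i, ⟨g, hg⟩, -⟩ := hφ.representatives V
  have hγ : (g⁻¹ * κ * g) • (W i).1 = g⁻¹ • V'.1 := by
    rw [mul_smul, mul_smul, hg, hκV]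
  have hγφ : φ (g⁻¹ * κ * g) = 1 := by
    rw [map_mul, map_mul, MonoidHom.mem_ker.1 hκ, map_inv]; simp
  have hWi : (W i).1 = g⁻¹ • V.1 := by rw [← hg, inv_smul_smul]
  have hmem : g⁻¹ * κ * g ∈ N i := by
    by_contra hnot
    refine hφ.separates i _ hnot ?_ (hγφ ▸ one_mem _)
    refine le_trans (csInf_le ⟨0, ?_⟩ ⟨g⁻¹ • q, hγ ▸ Set.smul_mem_smul_set hq, g⁻¹ • p,
      hWi ▸ Set.smul_mem_smul_set hp, rfl⟩) ?_
    · rintro _ ⟨a, -, b, -, rfl⟩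
      exact dist_nonneg
    · rwa [dist_smul, dist_comm]
  have hstab := MulAction.mem_stabilizer_iff.1 (hφ.le_stabilizer i hmem)
  rw [hγ, hWi] at hstab
  exact Subtype.ext (smul_left_cancel _ hstab).symm

theorem IsBoundaryWall.nonempty_inter (hX : IsCAT0 X) (hZ : IsStageTriple S K R k j Z H c)
    {W : S.Wall} (hW : IsBoundaryWall S K j Z c W) : (Z ∩ W.1).Nonempty := by
  obtain ⟨𝒜, h𝒜, rfl⟩ := hZ.halfSpaces
  obtain ⟨E, x, y, hE, hdual, hx, -, -⟩ := hW
  obtain ⟨i, rfl⟩ := hdual.exists_eq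
  exact ⟨_, CubeComplex.chart_cubeCenter_mem_sInter hX h𝒜 hE.1 hx hE.2.1 hE.2.2.2.2.1,
    CubeComplex.chart_cubeCenter_mem i⟩

/-- A cube that meets a portal has a corner in `Z`. -/
theorem IsBoundaryWall.exists_vertex (hX : IsCAT0 X) (hZ : IsStageTriple S K R k j Z H c)
    {W : S.Wall} (hW : IsBoundaryWall S K j Z c W) {p : X} (hp : p ∈ Z) :
    ∃ C, p ∈ S.cell C ∧ ∃ y ∈ S.cell C, S.IsVertex y ∧ y ∈ Z := by
  obtain ⟨𝒜, h𝒜, rfl⟩ := hZ.halfSpaces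
  obtain ⟨E, x, y', hE, -, hx, -, -⟩ := hW
  obtain ⟨C, hC⟩ := S.cover p
  exact ⟨C, hC, CubeComplex.exists_vertex_mem_sInter hX h𝒜 hx hE.2.1 hC hp⟩

/-- A boundary wall has the colour `j` at all vertices of `Z` near the portal. -/
theorem IsBoundaryWall.colour_eq (hX : IsCAT0 X) (hZ : IsStageTriple S K R k j Z H c)
    (hR : 1 / 2 ≤ R) {W : S.Wall} (hW : IsBoundaryWall S K j Z c W) {p y : X} (hp : p ∈ Z)
    (hpW : p ∈ W.1) (hy : y ∈ Z) (hyv : S.IsVertex y) {D : S.Cube} (hyD : y ∈ S.cell D)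
    (hpD : p ∈ S.cell D) : c y (W.bar K) = j := by
  obtain ⟨𝒜, h𝒜, hZ𝒜⟩ := hZ.halfSpaces
  obtain ⟨E, x, y', hE, hdual, hx, -, hj⟩ := hW
  obtain ⟨i, rfl⟩ := hdual.exists_eq
  have hxE : x ∈ S.cell E := hE.2.2.2.2.1
  have hqW := CubeComplex.chart_cubeCenter_mem i
  have hqZ : S.chart E (CubeComplex.cubeCenter _) ∈ Z := by
    rw [hZ𝒜] at hx ⊢
    exact CubeComplex.chart_cubeCenter_mem_sInter hX h𝒜 hE.1 hx hE.2.1 hxE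
  rw [← hj]
  -- The geodesic from the midpoint of the crossing edge to `p` stays in the wall itself, by
  -- convexity.
  refine (hZ.colour_eq_of_geodSeg hX hx hy hE.2.1 hyv hxE hyD
    (CubeComplex.chart_mem_cell _ (CubeComplex.cubeCenter_mem _)) hpD hqZ hp fun z hz => ⟨z, ?_, ?_⟩).symm
  · exact CubeComplex.geodConvex_wallSet hX _ _ hqW _ hpW hz
  · rwa [dist_self, zero_add]

/-- Portals that come close to each other coincide. -/
theorem IsBoundaryWall.eq_of_dist_le [IsIsometricSMul G X] (hX : IsCAT0 X)
    (hcub : S.IsCubicalAction G) {φ : G →* 𝒢} {m : ℕ} {W : Fin m → S.Wall}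
    {N : Fin m → Subgroup G} (hφ : HasFiniteWallKernel S R φ W N)
    {c : X → QuotWall S φ.ker → ℕ} (hZ : IsStageTriple S φ.ker R k j Z H c) {W₀ W₁ : S.Wall}
    (h₀ : IsBoundaryWall S φ.ker j Z c W₀) (h₁ : IsBoundaryWall S φ.ker j Z c W₁) {p₀ p₁ : X}
    (hp₀ : p₀ ∈ Z ∩ W₀.1) (hp₁ : p₁ ∈ Z ∩ W₁.1) (hd : dist p₀ p₁ + 1 / 2 ≤ R) : W₀ = W₁ := by
  have hR : 1 / 2 ≤ R := by linarith [dist_nonneg (x := p₀) (y := p₁)]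
  have hbar : W₀.bar φ.ker = W₁.bar φ.ker := by
    by_contra hne
    obtain ⟨C, hpC, x, hxC, hxv, hx⟩ := h₀.exists_vertex hX hZ hp₀.1
    obtain ⟨D, hpD, y, hyD, hyv, hy⟩ := h₁.exists_vertex hX hZ hp₁.1
    have e₀ := h₀.colour_eq hX hZ hR hp₀.1 hp₀.2 hx hxv hxC hpC
    have e₁ := h₁.colour_eq hX hZ hR hp₁.1 hp₁.2 hy hyv hyD hpD
    have e := hZ.colour_eq_of_geodSeg hX (V := W₀) hx hy hxv hyv hxC hyD hpC hpD hp₀.1 hp₁.1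
      fun z hz => ⟨p₀, hp₀.2, by
        have hz' : dist p₀ z + dist z p₁ = dist p₀ p₁ := hz
        linarith [dist_nonneg (x := z) (y := p₁), dist_comm z p₀]⟩
    exact (hZ.colouring y hy hyv).2 _ _
      (wallGraph_adj_of_dist_le hp₀.2 hp₁.2 (by linarith) hne) ((e.symm.trans e₀).trans e₁.symm)
  obtain ⟨E, x, y, -, hdual, -⟩ := h₁
  exact hφ.eq_of_bar_eq hcub hbar hp₀.2 hp₁.2 (by linarith) hdual

end Portals

theorem lemma8p5 {X G 𝒢 : Type*} [MetricSpace X] [Group G] [Group 𝒢] [MulAction G X]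
    [IsIsometricSMul G X]
    -- `X` is a `δ`-hyperbolic CAT(0) cube complex with a proper cocompact action of `G`
    (S : CubeComplex X) (hX : IsCAT0 X) (δ : ℝ) (hδ : IsDeltaHyperbolic X δ)
    (hcub : S.IsCubicalAction G) (hproper : IsProperAction G X)
    (hcocompact : ActsCocompactlyOn (⊤ : Subgroup G) (Set.univ : Set X))
    -- the constant `R`, with `R ≥ δ + 2 √(dim X)`
    (R : ℝ) (hR : 1 < R) (hRball : ∀ x y : X, ∃ g : G, g • y ∈ Metric.closedBall x R)
    (hRdim : ∀ C : S.Cube, δ + 2 * √(S.dim C : ℝ) ≤ R)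
    -- the homomorphism whose kernel defines the quotient complex
    (φ : G →* 𝒢) {m : ℕ} (W : Fin m → S.Wall) (N : Fin m → Subgroup G)
    (hφ : HasFiniteWallKernel S R φ W N)
    -- the bound on the degrees in the graph of walls
    (k : ℕ) (hk : ∀ A, ((wallGraph S φ.ker R).neighborSet A).encard ≤ k)
    -- the triple and two distinct portals
    (j : ℕ) (Z : Set X) (H : Subgroup G) (c : X → QuotWall S φ.ker → ℕ)
    (hZ : IsStageTriple S φ.ker R k j Z H c)
    (P₀ P₁ : Set X) (hP₀ : IsPortal S φ.ker j Z c P₀) (hP₁ : IsPortal S φ.ker j Z c P₁)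
    (hne : P₀ ≠ P₁) :
    MulAction.stabilizer H P₀ ⊓ MulAction.stabilizer H P₁ = ⊥ := by
  obtain ⟨W₀, h₀, rfl⟩ := hP₀
  obtain ⟨W₁, h₁, rfl⟩ := hP₁
  rw [eq_bot_iff]
  rintro h ⟨hs₀, hs₁⟩
  obtain ⟨-, B, -, hB, hcov⟩ := hcocompact
  have : CompleteSpace X := hproper.completeSpace hB fun z => by
    obtain ⟨g, -, hg⟩ := hcov z trivial
    exact ⟨g, hg⟩
  obtain ⟨𝒜, h𝒜, hZ𝒜⟩ := hZ.halfSpaces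
  have hconv : GeodConvex Z := hZ𝒜 ▸ CubeComplex.geodConvex_sInter hX h𝒜
  have hcl : IsClosed Z := hZ𝒜 ▸ CubeComplex.isClosed_sInter_halfSpaces h𝒜
  have hconvP : ∀ V : S.Wall, GeodConvex (Z ∩ V.1) := fun V => by
    obtain ⟨n, rfl⟩ := V.exists_eq
    exact hconv.inter (CubeComplex.geodConvex_wallSet hX n)
  have horbit : ∀ P : Set X, h ∈ MulAction.stabilizer H P → ∀ a ∈ P, ∀ n : ℤ,
      (h : G) ^ n • a ∈ P := by
    intro P hP a ha n
    have hn : h ^ n • P = P := zpow_mem hP n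
    have : h ^ n • a ∈ P := hn ▸ Set.smul_mem_smul_set ha
    simpa [Subgroup.smul_def] using this
  obtain ⟨a, ha⟩ := h₀.nonempty_inter hX hZ
  obtain ⟨b, hb⟩ := h₁.nonempty_inter hX hZ
  rw [Subgroup.mem_bot]
  by_contra hh
  have hunb : ∀ M : ℝ, ∃ n : ℤ, M < dist a ((h : G) ^ n • a) := by
    by_contra! hbdd
    obtain ⟨M, hM⟩ := hbdd
    obtain ⟨z, hz, hhz⟩ := hX.exists_fixedPoint hcl hconv (g := (h : G))
      (fun z hz => by
        have := hZ.cocompact.1 h h.2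
        exact this ▸ Set.smul_mem_smul_set hz) ha.1 hM
    exact hh (Subtype.ext (hZ.free h h.2 z hz hhz))
  obtain ⟨p₀, hp₀, p₁, hp₁, hd⟩ := hX.exists_dist_le_of_unbounded hδ (hconvP W₀) (hconvP W₁)
    (horbit _ hs₀ a ha) (horbit _ hs₁ b hb) hunb (ε := 1 / 2) (by norm_num)
  -- The dimension bound for an edge. With `ε = 1 / 2` above, the points satisfy `dist p₀ p₁ + 1 / 2
  -- ≤ δ + 1 ≤ R`.
  have hRδ : δ + 2 ≤ R := by
    obtain ⟨E, x, y, hE, -⟩ := h₀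
    have := hRdim E
    rw [hE.1] at this
    simpa using this
  exact hne (by rw [IsBoundaryWall.eq_of_dist_le hX hcub hφ hZ h₀ h₁ hp₀ hp₁ (by linarith)])
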